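/- Throughout, $n\ge 2$, $|\cdot|$ is the Euclidean norm on $\mathbb R^n$, $\sigma_{n-1}$ is the normalized Lebesgue (surface) probability measure on the unit sphere $\mathbb S^{n-1}$, and $\mathbb E_\theta$ denotes integration over $\theta\in\mathbb S^{n-1}$ with respect to $\sigma_{n-1}$. A random vector $X=(X_1,\dots,X_n)$ in $\mathbb R^n$ is called isotropic if $\mathbb E X_iX_j=\delta_{ij}$ for all $i,j\le n$. Put $$\sigma_4=\sigma_4(X)=\Big(\tfrac1n\,\mathrm{Var}(|X|^2)\Big)^{1/2},\qquad F_\theta(x)=\mathbb P\{\langle X,\theta\rangle\le x\},\qquad F(x)=\mathbb E_\theta F_\theta(x)\qquad(x\in\mathbb R),$$ and, for distribution functions $G,H$ on $\mathbb R$, let $\omega(G,H)=\big(\int_{-\infty}^\infty (G(x)-H(x))^2\,dx\big)^{1/2}$. Proposition 12.4. There is an absolute constant $c>0$ such that the following holds for every $n\ge2$. Let $X$ be an isotropic random vector in $\mathbb R^n$ such that $|X|\le b\sqrt n$ almost surely, where $b$ is a real number, and suppose that $$\mathbb E_\theta\,\omega^2(F_\theta,F)\ \ge\ \frac Dn$$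 for some $D>0$. Then $$\mathbb E_\theta\,\omega(F_\theta,F)\ \ge\ \frac{c}{(1+\sigma_4)^3\,b^{3/2}}\,\frac{D^2}{(\log n)^{15/4}\,\sqrt n}.$$ Moreover, $$\sigma_{n-1}\Big\{\theta\in\mathbb S^{n-1}:\ \omega(F_\theta,F)\ge\frac{1}{\sqrt{2n}}\sqrt D\Big\}\ \ge\ \frac{c}{(1+\sigma_4)^6\,b^3}\,\frac{D^3}{(\log n)^{15/2}}.$$ -/

import Mathlib

open MeasureTheory ProbabilityTheory

namespace RandomizedCLT

noncomputable section

/-- Euclidean space `ℝⁿ`. -/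
abbrev E (n : ℕ) : Type := EuclideanSpace ℝ (Fin n)

/-- The unit sphere `S^{n-1}` of `ℝⁿ`. -/
abbrev Sph (n : ℕ) : Type := Metric.sphere (0 : E n) 1

/-- The normalized Lebesgue (surface) measure on the unit sphere of `ℝⁿ`. -/
def sphereMeasure (n : ℕ) : Measure (Sph n) :=
  ((volume : Measure (E n)).toSphere Set.univ)⁻¹ • (volume : Measure (E n)).toSphere

variable {Ω : Type*} [MeasurableSpace Ω] {n : ℕ}

/-- A random vector `X` in `ℝⁿ` is isotropic if `𝔼 Xᵢ Xⱼ = δᵢⱼ` for all `i, j`. (For measurable `X`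
the diagonal equations force every coordinate to be square integrable, since the integral of a
non-integrable function is `0`; hence all the integrals are genuine.) -/
def IsIsotropic (P : Measure Ω) (X : Ω → E n) : Prop :=
  ∀ i j : Fin n, ∫ w, X w i * X w j ∂P = if i = j then 1 else 0

/-- The functional `σ₄(X) = (Var(|X|²) / n)^{1/2}`. -/
def sigma4 (P : Measure Ω) (X : Ω → E n) : ℝ :=
  √((1 / (n : ℝ)) * variance (fun w => ‖X w‖ ^ 2) P)

/-- The distribution function `F_θ(x) = P{⟨X, θ⟩ ≤ x}` of the weighted sum with coefficients `θ`. -/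
def Fθ (P : Measure Ω) (X : Ω → E n) (θ : Sph n) (x : ℝ) : ℝ :=
  P.real {w | inner ℝ (X w) (θ : E n) ≤ x}

/-- The typical distribution function `F(x) = 𝔼_θ F_θ(x)`. -/
def typicalF (P : Measure Ω) (X : Ω → E n) (x : ℝ) : ℝ :=
  ∫ θ, Fθ P X θ x ∂(sphereMeasure n)

/-- The `L²`-distance `ω(G, H) = (∫ (G(x) - H(x))² dx)^{1/2}` of functions on the real line. -/
def omegaDist (G H : ℝ → ℝ) : ℝ :=
  √(∫ x, (G x - H x) ^ 2)

end

end RandomizedCLT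

/-! Write f(θ) = ω(F_θ, F). A lower bound on E f² becomes a lower bound on E f, and on the
probability that f is large, once E f⁴ is bounded above. The core is the estimate E f⁴ ≤ C log n (1
+ σ₄)⁴ / n² for bounded isotropic X (`exists_omegaDist_fourth_moment_const`). With y a multiple of
(log n)^{1/4} (1 + σ₄) / √n and m = E f² ≤ y², truncation gives E f ≥ m² / (4y³), and Paley–Zygmund
gives probability at least m² / (4y⁴) ≥ m³ / (4y⁶). These bounds are free of b and carry smaller
powers of log n than required; the stated form follows from b ≥ 1 and log n ≥ 1/2.

For the fourth moment, Jensen replaces F by F_θ' with an independent direction θ', and a Plancherel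
identity (`integral_sq_cdf_sub`) turns ω²(F_θ, F_θ') into a constant multiple of ∫ |φ(tθ) - φ(tθ')|²
t⁻² dt, where φ is the characteristic function of X. The integral is cut at |t| = T with T² = 256
log n.

Low frequencies use concentration: E |φ(tθ) - φ(tθ')|⁴ ≤ C t⁴ / n²
(`IsotropicLaw.lintegral_charFun_sub_sphere_le`). It is proved for Gaussian vectors by the
Maurey–Pisier rotation argument and carried to the sphere by polar decomposition, φ being
1-Lipschitz.

High frequencies use smallness of φ itself. The Gaussian mean of |φ(sZ)|⁴ is the mean of
exp(-s²|S|²/2), where S = X₁ + X₂ - X₃ - X₄ is built from independent copies. A combinatorial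
argument (`lintegral_four_le`, `one_le_of_norm_sum_sq_le`) shows that |S|² ≤ n/8 has probability
O((1 + σ₄²)² / n²): each summand must be short or strongly correlated with another, and this forces
two unlikely events. -/

namespace RandomizedCLT

/-! ### Moment inequalities: truncation and Paley–Zygmund. -/

/-- Reverse Hölder: a lower bound for the first moment from the second and fourth moments. -/
theorem rpow_le_integral_of_fourth_moment {Θ : Type*} [MeasurableSpace Θ] {σ : Measure Θ}
    [IsProbabilityMeasure σ] {f : Θ → ℝ} (hf0 : ∀ θ, 0 ≤ f θ)
    (h1 : Integrable f σ) (h2 : Integrable (fun θ => f θ ^ 2) σ)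
    (h4 : Integrable (fun θ => f θ ^ 4) σ) {K l : ℝ} (hl : 0 < l)
    (hK : ∫ θ, f θ ^ 4 ∂σ ≤ K) :
    ∫ θ, f θ ^ 2 ∂σ ≤ l * ∫ θ, f θ ∂σ + K / l ^ 2 := by
  -- Truncation at level `l`: below it f² ≤ l f, above it f² ≤ f⁴ / l².
  have key : ∀ θ, f θ ^ 2 ≤ l * f θ + f θ ^ 4 / l ^ 2 := by
    intro θ
    have h0 := hf0 θ
    rcases le_total (f θ) l with h | h
    · have : 0 ≤ f θ ^ 4 / l ^ 2 := by positivity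
      nlinarith
    · have : f θ ^ 2 ≤ f θ ^ 4 / l ^ 2 := by
        rw [le_div_iff₀ (by positivity)]
        have : l ^ 2 ≤ f θ ^ 2 := by gcongr
        nlinarith [sq_nonneg (f θ)]
      nlinarith
  calc ∫ θ, f θ ^ 2 ∂σ ≤ ∫ θ, (l * f θ + f θ ^ 4 / l ^ 2) ∂σ :=
        integral_mono h2 ((h1.const_mul l).add (h4.div_const _)) key
    _ = l * ∫ θ, f θ ∂σ + (∫ θ, f θ ^ 4 ∂σ) / l ^ 2 := by
        rw [integral_add (h1.const_mul l) (h4.div_const _), integral_const_mul, integral_div]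
    _ ≤ _ := by gcongr

/-- The variance of f² is nonnegative. At the end this permits trading a factor E f² for y². -/
theorem integral_sq_le_sqrt_fourth {Θ : Type*} [MeasurableSpace Θ] {σ : Measure Θ}
    [IsProbabilityMeasure σ] {f : Θ → ℝ}
    (h2 : Integrable (fun θ => f θ ^ 2) σ)
    (h4 : Integrable (fun θ => f θ ^ 4) σ) {K : ℝ} (hK : ∫ θ, f θ ^ 4 ∂σ ≤ K) :
    (∫ θ, f θ ^ 2 ∂σ) ^ 2 ≤ K := by
  set m := ∫ θ, f θ ^ 2 ∂σ
  have : 0 ≤ ∫ θ, (f θ ^ 2 - m) ^ 2 ∂σ := integral_nonneg fun _ => sq_nonneg _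
  have e : ∀ θ, (f θ ^ 2 - m) ^ 2 = f θ ^ 4 - 2 * m * f θ ^ 2 + m ^ 2 := fun θ => by ring
  simp_rw [e] at this
  have e2 : ∫ θ, (f θ ^ 4 - 2 * m * f θ ^ 2 + m ^ 2) ∂σ
      = ∫ θ, f θ ^ 4 ∂σ - 2 * m * m + m ^ 2 := by
    rw [integral_add (f := fun θ => f θ ^ 4 - 2 * m * f θ ^ 2) (h4.sub (h2.const_mul _))
      (integrable_const _), integral_sub h4 (h2.const_mul _), integral_const_mul]
    simp [m]
  rw [e2] at this
  nlinarith

/-- Paley–Zygmund inequality for the square of a function. -/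
theorem sq_le_measure_of_fourth_moment {Θ : Type*} [MeasurableSpace Θ] {σ : Measure Θ}
    [IsProbabilityMeasure σ] {f : Θ → ℝ} (hfm : Measurable f)
    (h2 : Integrable (fun θ => f θ ^ 2) σ)
    (h4 : Integrable (fun θ => f θ ^ 4) σ) {K : ℝ} (hK0 : 0 < K)
    (hm : 0 < ∫ θ, f θ ^ 2 ∂σ)
    (hK : ∫ θ, f θ ^ 4 ∂σ ≤ K) :
    (∫ θ, f θ ^ 2 ∂σ) ^ 2 / (4 * K) ≤ σ.real {θ | (∫ θ, f θ ^ 2 ∂σ) / 2 ≤ f θ ^ 2} := by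
  set m := ∫ θ, f θ ^ 2 ∂σ with hmdef
  set A : Set Θ := {θ | m / 2 ≤ f θ ^ 2} with hA
  have hAm : MeasurableSet A := measurableSet_le measurable_const (hfm.pow_const 2)
  -- On `A` this is a completed square, weighted so that the fourth moment costs only m/4. After
  -- integration m/4 is left to be paid by the measure of `A`.
  have key : ∀ θ, f θ ^ 2 ≤ m / 2 + (f θ ^ 4 * (m / (4 * K)) + A.indicator (fun _ => K / m) θ) := by
    intro θ
    by_cases h : θ ∈ A
    · rw [Set.indicator_of_mem h]
      have e : f θ ^ 4 * (m / (4 * K)) + K / m - f θ ^ 2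
          = (f θ ^ 2 * m / (2 * K) - 1) ^ 2 * (K / m) := by
        field_simp; ring
      have : 0 ≤ (f θ ^ 2 * m / (2 * K) - 1) ^ 2 * (K / m) := by positivity
      linarith
    · rw [Set.indicator_of_notMem h]
      have h' : f θ ^ 2 < m / 2 := not_le.1 h
      have : 0 ≤ f θ ^ 4 * (m / (4 * K)) := by positivity
      linarith
  have hi : Integrable (A.indicator (fun _ => K / m)) σ := (integrable_const _).indicator hAm
  have hi4 := h4.mul_const (m / (4 * K))
  have := integral_mono h2 ((integrable_const (m / 2)).add (hi4.add hi)) key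
  rw [integral_add' (integrable_const _) (hi4.add hi), integral_add' hi4 hi, integral_mul_const,
    integral_indicator_const _ hAm] at this
  simp only [integral_const, probReal_univ, smul_eq_mul, one_mul] at this
  have h5 : (∫ θ, f θ ^ 4 ∂σ) * (m / (4 * K)) ≤ K * (m / (4 * K)) := by gcongr
  have h6 : K * (m / (4 * K)) = m / 4 := by field_simp
  have h7 : m / 4 ≤ σ.real A * (K / m) := by linarith
  rw [div_le_iff₀ (by positivity)]
  have h8 : m / 4 * m ≤ σ.real A * (K / m) * m := by gcongr
  have h9 : σ.real A * (K / m) * m = σ.real A * K := by field_simp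
  nlinarith

end RandomizedCLT

/-! ### Gram kernels and the spectral representation of |u|. -/

namespace RandomizedCLT

open Complex in
/-- Fubini for squares of averages: the squared `L²`-norm of `𝔼 h(w, ·)` is the double average of
the Gram kernel of `h`. -/
theorem integral_norm_sq_integral {Ω T : Type*} [MeasurableSpace Ω] [MeasurableSpace T]
    {P : Measure Ω} [IsProbabilityMeasure P] {ν : Measure T} [SFinite ν]
    {h : Ω → T → ℂ} (hm : Measurable (Function.uncurry h))
    (hi : Integrable (fun p : Ω × T => ‖h p.1 p.2‖ ^ 2) (P.prod ν)) :
    Integrable (fun t => ‖∫ w, h w t ∂P‖ ^ 2) ν ∧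
    ∫ t, ‖∫ w, h w t ∂P‖ ^ 2 ∂ν =
      ∫ p : Ω × Ω, (∫ t, (h p.1 t * (starRingEnd ℂ) (h p.2 t)).re ∂ν) ∂(P.prod P) := by
  have hm1 : Measurable fun q : (Ω × Ω) × T => h q.1.1 q.2 :=
    hm.comp ((measurable_fst.comp measurable_fst).prodMk measurable_snd)
  have hm2 : Measurable fun q : (Ω × Ω) × T => h q.1.2 q.2 :=
    hm.comp ((measurable_snd.comp measurable_fst).prodMk measurable_snd)
  have hmk : Measurable fun q : (Ω × Ω) × T => h q.1.1 q.2 * (starRingEnd ℂ) (h q.1.2 q.2) :=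
    hm1.mul (Complex.continuous_conj.measurable.comp hm2)
  have i1 : Integrable (fun q : (Ω × Ω) × T => ‖h q.1.1 q.2‖ ^ 2) ((P.prod P).prod ν) := by
    have mp : MeasurePreserving (Prod.map Prod.fst id : (Ω × Ω) × T → Ω × T)
        ((P.prod P).prod ν) (P.prod ν) :=
      (measurePreserving_fst (μ := P) (ν := P)).prod (MeasurePreserving.id ν)
    exact mp.integrable_comp_of_integrable hi
  have i2 : Integrable (fun q : (Ω × Ω) × T => ‖h q.1.2 q.2‖ ^ 2) ((P.prod P).prod ν) := by
    have mp : MeasurePreserving (Prod.map Prod.snd id : (Ω × Ω) × T → Ω × T)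
        ((P.prod P).prod ν) (P.prod ν) :=
      (measurePreserving_snd (μ := P) (ν := P)).prod (MeasurePreserving.id ν)
    exact mp.integrable_comp_of_integrable hi
  have ik : Integrable (fun q : (Ω × Ω) × T => h q.1.1 q.2 * (starRingEnd ℂ) (h q.1.2 q.2))
      ((P.prod P).prod ν) := by
    refine (i1.add i2).mono' hmk.aestronglyMeasurable (Filter.Eventually.of_forall fun q => ?_)
    simp only [norm_mul, RCLike.norm_conj, Pi.add_apply]
    nlinarith [sq_nonneg (‖h q.1.1 q.2‖ - ‖h q.1.2 q.2‖), sq_nonneg (‖h q.1.1 q.2‖ + ‖h q.1.2 q.2‖)]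
  have ikre : Integrable (fun q : (Ω × Ω) × T =>
      (h q.1.1 q.2 * (starRingEnd ℂ) (h q.1.2 q.2)).re) ((P.prod P).prod ν) := ik.re
  -- The squared modulus of an average is an average over two independent copies. Fubini supplies
  -- integrability of the kernel only for almost every `t`, which is enough.
  have pt : ∀ᵐ t ∂ν, ‖∫ w, h w t ∂P‖ ^ 2
      = ∫ p : Ω × Ω, (h p.1 t * (starRingEnd ℂ) (h p.2 t)).re ∂(P.prod P) := by
    filter_upwards [ik.prod_left_ae] with t ht
    have e1 := integral_prod_mul (μ := P) (ν := P) (fun w => h w t)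
      (fun w => (starRingEnd ℂ) (h w t))
    rw [integral_conj, Complex.mul_conj, Complex.normSq_eq_norm_sq] at e1
    have e2 := integral_re ht
    simp only [RCLike.re_to_complex] at e2
    rw [e2, e1]
    exact (Complex.ofReal_re _).symm
  refine ⟨(ikre.integral_prod_right).congr (pt.mono fun t ht => ht.symm), ?_⟩
  rw [integral_congr_ae pt]
  exact (integral_integral_swap ikre).symm

/-- The normalizing constant `∫ (1 - cos t) / t² dt` of the spectral representation of `|u|`. -/
noncomputable def absKernelConst : ℝ := ∫ t : ℝ, (1 - Real.cos t) / t ^ 2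

theorem integrable_one_sub_cos_div_sq : Integrable fun t : ℝ => (1 - Real.cos t) / t ^ 2 := by
  refine (integrable_inv_one_add_sq.const_mul 4).mono'
    (Measurable.aestronglyMeasurable (by fun_prop))
    (Filter.Eventually.of_forall fun t => ?_)
  have h1 : 1 - Real.cos t ≤ t ^ 2 / 2 := by linarith [Real.one_sub_sq_div_two_le_cos (x := t)]
  have h2 : 0 ≤ 1 - Real.cos t := by linarith [Real.cos_le_one t]
  have h3 : 1 - Real.cos t ≤ 2 := by linarith [Real.neg_one_le_cos t]
  rw [Real.norm_of_nonneg (by positivity)]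
  rcases eq_or_ne t 0 with rfl | ht
  · simp
  · rw [← div_eq_mul_inv, div_le_div_iff₀ (by positivity) (by positivity)]
    nlinarith

theorem absKernelConst_pos : 0 < absKernelConst := by
  rw [absKernelConst, integral_pos_iff_support_of_nonneg _ integrable_one_sub_cos_div_sq]
  · refine lt_of_lt_of_le ?_ (measure_mono (s := Set.Ioo 0 1) fun t ht => ?_)
    · simp
    · have : Real.cos t < 1 := by
        rw [← Real.cos_zero]
        exact Real.cos_lt_cos_of_nonneg_of_le_pi le_rfl (by linarith [ht.2, Real.pi_gt_three]) ht.1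
      have ht0 := ht.1
      have : 0 < (1 - Real.cos t) / t ^ 2 := div_pos (by linarith) (by positivity)
      exact this.ne'
  · intro t
    have h2 : 0 ≤ 1 - Real.cos t := by linarith [Real.cos_le_one t]
    simp only [Pi.zero_apply]
    positivity

/-- Scaling s = ut. Writing |u| as a mixture of cosines is the bridge between distances of points
and characteristic functions. -/
theorem integral_one_sub_cos_mul (u : ℝ) :
    Integrable (fun t : ℝ => (1 - Real.cos (u * t)) / t ^ 2) ∧
    ∫ t : ℝ, (1 - Real.cos (u * t)) / t ^ 2 = absKernelConst * |u| := by
  rcases eq_or_ne u 0 with rfl | hu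
  · simp
  have e : (fun t : ℝ => (1 - Real.cos (u * t)) / t ^ 2)
      = fun t => u ^ 2 * ((fun s : ℝ => (1 - Real.cos s) / s ^ 2) (u * t)) := by
    funext t
    rcases eq_or_ne t 0 with rfl | ht
    · simp
    · field_simp
  rw [e]
  refine ⟨(integrable_one_sub_cos_div_sq.comp_mul_left' hu).const_mul _, ?_⟩
  rw [integral_const_mul, Measure.integral_comp_mul_left (fun s : ℝ => (1 - Real.cos s) / s ^ 2),
    ← absKernelConst]
  rw [smul_eq_mul, abs_inv, ← sq_abs]
  have := abs_pos.2 hu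
  field_simp

/-- Gram kernel of the difference of two Heaviside functions. -/
theorem integral_indicator_sub_mul (a b a' b' : ℝ) :
    ∫ x : ℝ, ((Set.Ici a).indicator 1 x - (Set.Ici b).indicator 1 x) *
        ((Set.Ici a').indicator 1 x - (Set.Ici b').indicator 1 x) =
      (|a - b'| + |b - a'| - |a - a'| - |b - b'|) / 2 := by
  -- Products of single Heaviside functions are not integrable on the line. The product of
  -- differences vanishes outside an interval containing all four jumps, and there it can be
  -- expanded.
  obtain ⟨m, hm⟩ : ∃ m, m ≤ a ∧ m ≤ b ∧ m ≤ a' ∧ m ≤ b' :=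
    ⟨min (min a b) (min a' b'), by simp⟩
  obtain ⟨M, hM⟩ : ∃ M, a ≤ M ∧ b ≤ M ∧ a' ≤ M ∧ b' ≤ M :=
    ⟨max (max a b) (max a' b'), by simp⟩
  have prod : ∀ c d x : ℝ, (Set.Ici c).indicator (1 : ℝ → ℝ) x * (Set.Ici d).indicator 1 x
      = (Set.Ici (max c d)).indicator 1 x := by
    intro c d x
    simp only [Set.indicator_apply, Set.mem_Ici, Pi.one_apply, sup_le_iff]
    split_ifs <;> simp_all
  -- Here max(c, d) = (c + d + |c - d|) / 2; the linear parts and `M` cancel in the alternating sum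
  -- of four such integrals.
  have I : ∀ c d, c ≤ M → d ≤ M → m ≤ c → IntegrableOn
      (fun x : ℝ => (Set.Ici c).indicator (1 : ℝ → ℝ) x * (Set.Ici d).indicator 1 x) (Set.Ico m M) ∧
      ∫ x in Set.Ico m M, (Set.Ici c).indicator (1 : ℝ → ℝ) x * (Set.Ici d).indicator 1 x
        = M - (c + d + |c - d|) / 2 := by
    intro c d hc hd hmc
    simp_rw [prod]
    constructor
    · exact (integrableOn_const (by simp)).indicator measurableSet_Ici
    · rw [setIntegral_indicator measurableSet_Ici]
      have : Set.Ico m M ∩ Set.Ici (max c d) = Set.Ico (max c d) M := by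
        ext x; simp only [Set.mem_inter_iff, Set.mem_Ico, Set.mem_Ici, sup_le_iff]
        constructor
        · rintro ⟨⟨_, h2⟩, h3⟩; exact ⟨h3, h2⟩
        · rintro ⟨h3, h2⟩; exact ⟨⟨hmc.trans h3.1, h2⟩, h3⟩
      rw [this]
      simp only [Pi.one_apply, integral_const, MeasurableSet.univ, measureReal_restrict_apply,
        Set.univ_inter, Real.volume_real_Ico, smul_eq_mul, mul_one]
      rw [max_eq_left (by simp [hc, hd])]
      rcases le_total c d with h | h
      · rw [max_eq_right h, abs_of_nonpos (by linarith)]; ring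
      · rw [max_eq_left h, abs_of_nonneg (by linarith)]; ring
  have supp : Function.support (fun x : ℝ =>
      ((Set.Ici a).indicator (1 : ℝ → ℝ) x - (Set.Ici b).indicator 1 x) *
        ((Set.Ici a').indicator 1 x - (Set.Ici b').indicator 1 x)) ⊆ Set.Ico m M := by
    intro x hx
    by_contra h
    apply hx
    simp only [Set.mem_Ico, not_and_or, not_le, not_lt] at h
    simp only [Set.indicator_apply, Set.mem_Ici, Pi.one_apply]
    rcases h with h | h
    · rw [if_neg (by linarith), if_neg (by linarith)]; simp
    · rw [if_pos (by linarith), if_pos (by linarith)]; simp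
  rw [← setIntegral_eq_integral_of_forall_compl_eq_zero (s := Set.Ico m M)
    (fun x hx => by by_contra h; exact hx (supp h))]
  obtain ⟨i1, e1⟩ := I a a' hM.1 hM.2.2.1 hm.1
  obtain ⟨i2, e2⟩ := I a b' hM.1 hM.2.2.2 hm.1
  obtain ⟨i3, e3⟩ := I b a' hM.2.1 hM.2.2.1 hm.2.1
  obtain ⟨i4, e4⟩ := I b b' hM.2.1 hM.2.2.2 hm.2.1
  have : ∀ x : ℝ, ((Set.Ici a).indicator (1 : ℝ → ℝ) x - (Set.Ici b).indicator 1 x) *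
        ((Set.Ici a').indicator 1 x - (Set.Ici b').indicator 1 x) =
      ((Set.Ici a).indicator 1 x * (Set.Ici a').indicator 1 x
        - (Set.Ici a).indicator 1 x * (Set.Ici b').indicator 1 x)
      - ((Set.Ici b).indicator 1 x * (Set.Ici a').indicator 1 x
        - (Set.Ici b).indicator 1 x * (Set.Ici b').indicator 1 x) := fun x => by ring
  simp_rw [this]
  rw [integral_sub (by exact i1.sub i2) (by exact i3.sub i4), integral_sub (by exact i1)
    (by exact i2), integral_sub (by exact i3) (by exact i4), e1, e2, e3, e4]
  ring

end RandomizedCLT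

/-! ### Plancherel identity for differences of distribution functions. -/

namespace RandomizedCLT

theorem norm_sq_cexp_sub_cexp_div (a b t : ℝ) :
    ‖(Complex.exp (a * t * Complex.I) - Complex.exp (b * t * Complex.I)) / t‖ ^ 2
      = 2 * ((1 - Real.cos ((a - b) * t)) / t ^ 2) := by
  have e : ‖Complex.exp (a * t * Complex.I) - Complex.exp (b * t * Complex.I)‖ ^ 2
      = 2 * (1 - Real.cos ((a - b) * t)) := by
    rw [← Complex.normSq_eq_norm_sq, Complex.normSq_apply, ← Complex.ofReal_mul,
      ← Complex.ofReal_mul, sub_mul, Real.cos_sub]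
    simp only [Complex.sub_re, Complex.sub_im, Complex.exp_ofReal_mul_I_re,
      Complex.exp_ofReal_mul_I_im]
    nlinarith [Real.sin_sq_add_cos_sq (a * t), Real.sin_sq_add_cos_sq (b * t)]
  rw [norm_div, div_pow, e, Complex.norm_real, Real.norm_eq_abs, sq_abs]
  ring

/-- The four cosines carry signs summing to zero, so a 1 can be inserted in each, which makes every
term separately integrable against 1/t². -/
theorem cexp_sub_cexp_div_mul_conj_re (a b a' b' t : ℝ) :
    ((Complex.exp (a * t * Complex.I) - Complex.exp (b * t * Complex.I)) / t *
      (starRingEnd ℂ) ((Complex.exp (a' * t * Complex.I) - Complex.exp (b' * t * Complex.I)) / t)).re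
      = ((1 - Real.cos ((a - b') * t)) / t ^ 2 + (1 - Real.cos ((b - a') * t)) / t ^ 2)
        - ((1 - Real.cos ((a - a') * t)) / t ^ 2 + (1 - Real.cos ((b - b') * t)) / t ^ 2) := by
  rw [map_div₀, Complex.conj_ofReal, div_mul_div_comm, ← Complex.ofReal_mul t t, Complex.div_ofReal_re,
    Complex.mul_re, Complex.conj_re, Complex.conj_im]
  simp only [← Complex.ofReal_mul, sub_mul, Real.cos_sub, Complex.sub_re, Complex.sub_im,
    Complex.exp_ofReal_mul_I_re, Complex.exp_ofReal_mul_I_im]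
  ring

/-- Plancherel for step functions, checked on Gram kernels: both sides reduce to the same
combination of the four distances. -/
theorem integral_gram_cexp (a b a' b' : ℝ) :
    ∫ t : ℝ, ((Complex.exp (a * t * Complex.I) - Complex.exp (b * t * Complex.I)) / t *
      (starRingEnd ℂ) ((Complex.exp (a' * t * Complex.I) - Complex.exp (b' * t * Complex.I)) / t)).re
      = 2 * absKernelConst * ∫ x : ℝ, ((Set.Ici a).indicator 1 x - (Set.Ici b).indicator 1 x) *
        ((Set.Ici a').indicator 1 x - (Set.Ici b').indicator 1 x) := by
  rw [integral_indicator_sub_mul]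
  simp_rw [cexp_sub_cexp_div_mul_conj_re]
  obtain ⟨i1, e1⟩ := integral_one_sub_cos_mul (a - b')
  obtain ⟨i2, e2⟩ := integral_one_sub_cos_mul (b - a')
  obtain ⟨i3, e3⟩ := integral_one_sub_cos_mul (a - a')
  obtain ⟨i4, e4⟩ := integral_one_sub_cos_mul (b - b')
  rw [integral_sub (by exact i1.add i2) (by exact i3.add i4), integral_add (by exact i1)
    (by exact i2), integral_add (by exact i3) (by exact i4), e1, e2, e3, e4]
  ring

theorem integrable_indicator_sub_sq (a b : ℝ) : Integrable fun x : ℝ =>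
    ((Set.Ici a).indicator (1 : ℝ → ℝ) x - (Set.Ici b).indicator 1 x) ^ 2 := by
  have : Integrable ((Set.Icc (min a b) (max a b)).indicator (fun _ : ℝ => (1 : ℝ))) :=
    (integrable_indicator_iff measurableSet_Icc).2 (integrableOn_const (by simp))
  refine this.mono' (Measurable.aestronglyMeasurable ?_) (Filter.Eventually.of_forall fun x => ?_)
  · exact ((measurable_one.indicator measurableSet_Ici).sub
      (measurable_one.indicator measurableSet_Ici)).pow_const 2
  · simp only [Set.indicator_apply, Set.mem_Ici, Pi.one_apply, Set.mem_Icc, inf_le_iff, le_sup_iff]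
    by_cases h1 : a ≤ x <;> by_cases h2 : b ≤ x <;> simp [h1, h2] <;> split_ifs <;> grind

/-- Spectral formula for the `L²` distance between the distribution functions of two random
variables defined on the same probability space. -/
theorem integral_sq_cdf_sub {Ω : Type*} [MeasurableSpace Ω] {P : Measure Ω}
    [IsProbabilityMeasure P] {a b : Ω → ℝ} (ha : Measurable a) (hb : Measurable b)
    (hab : Integrable (fun w => a w - b w) P) :
    Integrable (fun x => (P.real {w | a w ≤ x} - P.real {w | b w ≤ x}) ^ 2) ∧
    Integrable (fun t : ℝ => ‖∫ w, Complex.exp (a w * t * Complex.I) ∂P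
      - ∫ w, Complex.exp (b w * t * Complex.I) ∂P‖ ^ 2 / t ^ 2) ∧
    ∫ t : ℝ, ‖∫ w, Complex.exp (a w * t * Complex.I) ∂P
      - ∫ w, Complex.exp (b w * t * Complex.I) ∂P‖ ^ 2 / t ^ 2 =
    2 * absKernelConst * ∫ x, (P.real {w | a w ≤ x} - P.real {w | b w ≤ x}) ^ 2 := by
  -- Averaging `g` over `w` gives the difference of distribution functions, and averaging `h` gives
  -- the difference of characteristic functions over `t`. Both are square integrable on the product
  -- space, since each section has squared norm proportional to |a - b|.
  let g : Ω → ℝ → ℝ := fun w x =>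
    (Set.Ici (a w)).indicator (1 : ℝ → ℝ) x - (Set.Ici (b w)).indicator 1 x
  let h : Ω → ℝ → ℂ := fun w t =>
    (Complex.exp (a w * t * Complex.I) - Complex.exp (b w * t * Complex.I)) / t
  have hind : ∀ c : Ω → ℝ, Measurable c →
      Measurable fun p : Ω × ℝ => (Set.Ici (c p.1)).indicator (1 : ℝ → ℝ) p.2 := by
    intro c hc
    have hs : MeasurableSet {p : Ω × ℝ | c p.1 ≤ p.2} :=
      measurableSet_le (hc.comp measurable_fst) measurable_snd
    exact measurable_one.indicator hs
  have hgm : Measurable (Function.uncurry g) := (hind a ha).sub (hind b hb)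
  have hhm : Measurable (Function.uncurry h) := by
    unfold Function.uncurry h
    fun_prop
  have hgi : Integrable (fun p : Ω × ℝ => ‖((g p.1 p.2 : ℝ) : ℂ)‖ ^ 2) (P.prod volume) := by
    simp only [Complex.norm_real, Real.norm_eq_abs, sq_abs]
    have hms : AEStronglyMeasurable (fun p : Ω × ℝ => g p.1 p.2 ^ 2) (P.prod volume) :=
      (hgm.pow_const 2).aestronglyMeasurable
    have hsec : ∀ w, Integrable fun x => g w x ^ 2 := fun w =>
      integrable_indicator_sub_sq (a w) (b w)
    refine (integrable_prod_iff hms).2 ⟨Filter.Eventually.of_forall hsec, ?_⟩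
    refine hab.norm.congr (Filter.Eventually.of_forall fun w => ?_)
    have := integral_indicator_sub_mul (a w) (b w) (a w) (b w)
    simp only [norm_pow, Real.norm_eq_abs, sq_abs]
    simp only [g, sq]
    rw [this, abs_sub_comm (b w)]
    simp
  have hhi : Integrable (fun p : Ω × ℝ => ‖h p.1 p.2‖ ^ 2) (P.prod volume) := by
    have hms : AEStronglyMeasurable (fun p : Ω × ℝ => ‖h p.1 p.2‖ ^ 2) (P.prod volume) :=
      (hhm.norm.pow_const 2).aestronglyMeasurable
    refine (integrable_prod_iff hms).2 ?_
    simp only [h, norm_sq_cexp_sub_cexp_div]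
    refine ⟨Filter.Eventually.of_forall fun w => (integral_one_sub_cos_mul _).1.const_mul 2, ?_⟩
    refine ((hab.norm.const_mul absKernelConst).const_mul 2).congr
      (Filter.Eventually.of_forall fun w => ?_)
    dsimp only
    rw [Real.norm_eq_abs, ← (integral_one_sub_cos_mul _).2, ← integral_const_mul]
    refine integral_congr_ae (Filter.Eventually.of_forall fun t => ?_)
    have : 0 ≤ 1 - Real.cos ((a w - b w) * t) := by linarith [Real.cos_le_one ((a w - b w) * t)]
    exact (Real.norm_of_nonneg (by positivity)).symm
  obtain ⟨I1, E1⟩ := integral_norm_sq_integral (h := fun w x => ((g w x : ℝ) : ℂ))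
    (Complex.measurable_ofReal.comp hgm) hgi
  obtain ⟨I2, E2⟩ := integral_norm_sq_integral hhm hhi
  have eg : ∀ x, ‖∫ w, ((g w x : ℝ) : ℂ) ∂P‖ ^ 2
      = (P.real {w | a w ≤ x} - P.real {w | b w ≤ x}) ^ 2 := by
    intro x
    have hc : ∀ c : Ω → ℝ, Measurable c →
        Integrable (fun w => (Set.Ici (c w)).indicator (1 : ℝ → ℝ) x) P ∧
        ∫ w, (Set.Ici (c w)).indicator (1 : ℝ → ℝ) x ∂P = P.real {w | c w ≤ x} := by
      intro c hc
      have hs : MeasurableSet {w | c w ≤ x} := measurableSet_le hc measurable_const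
      have e : (fun w => (Set.Ici (c w)).indicator (1 : ℝ → ℝ) x)
          = {w | c w ≤ x}.indicator 1 := by
        funext w; simp [Set.indicator_apply]
      rw [e]
      exact ⟨(integrable_const (1 : ℝ)).indicator hs, integral_indicator_one hs⟩
    rw [integral_complex_ofReal, Complex.norm_real, Real.norm_eq_abs, sq_abs]
    simp only [g]
    rw [integral_sub (hc a ha).1 (hc b hb).1, (hc a ha).2, (hc b hb).2]
  have eh : ∀ t : ℝ, ‖∫ w, h w t ∂P‖ ^ 2 = ‖∫ w, Complex.exp (a w * t * Complex.I) ∂P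
      - ∫ w, Complex.exp (b w * t * Complex.I) ∂P‖ ^ 2 / t ^ 2 := by
    intro t
    have hc : ∀ c : Ω → ℝ, Measurable c →
        Integrable (fun w => Complex.exp (c w * t * Complex.I)) P := by
      intro c hc
      refine (integrable_const (1 : ℝ)).mono' (Measurable.aestronglyMeasurable (by fun_prop))
        (Filter.Eventually.of_forall fun w => ?_)
      rw [← Complex.ofReal_mul, Complex.norm_exp_ofReal_mul_I]
    simp only [h]
    rw [integral_div, integral_sub (hc a ha) (hc b hb), norm_div, div_pow, Complex.norm_real,
      Real.norm_eq_abs, sq_abs]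
  simp_rw [eg] at I1 E1
  simp_rw [eh] at I2 E2
  refine ⟨I1, I2, ?_⟩
  rw [E1, E2, ← integral_const_mul]
  congr 1
  funext p
  simp only [h]
  rw [integral_gram_cexp]
  congr 2
  funext x
  simp [g]

end RandomizedCLT

/-! ### Density and exponential moments of the standard Gaussian measure. -/

namespace RandomizedCLT

/-- The density of the standard Gaussian measure on `ℝⁿ`. -/
noncomputable def gaussDensity (n : ℕ) (x : E n) : ℝ :=
  (2 * Real.pi) ^ (-(n / 2 : ℝ)) * Real.exp (-(1 / 2) * ‖x‖ ^ 2)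

theorem gaussDensity_nonneg (n : ℕ) (x : E n) : 0 ≤ gaussDensity n x := by
  unfold gaussDensity; positivity

theorem measurable_gaussDensity (n : ℕ) : Measurable (gaussDensity n) := by
  unfold gaussDensity; fun_prop

theorem integrable_gaussDensity (n : ℕ) : Integrable (gaussDensity n) := by
  have := (GaussianFourier.integrable_cexp_neg_mul_sq_norm_add (V := E n) (b := (1 / 2 : ℝ))
    (by simp) 0 0).norm
  refine (this.const_mul ((2 * Real.pi) ^ (-(n / 2 : ℝ)))).congr
    (Filter.Eventually.of_forall fun x => ?_)
  simp only [gaussDensity, Complex.norm_exp]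
  congr 2
  simp [← Complex.ofReal_pow]

/-- Both measures have the same characteristic function. The density is what polar coordinates and
the Laplace transform of |x|² require. -/
theorem stdGaussian_eq_withDensity (n : ℕ) :
    stdGaussian (E n) = volume.withDensity fun x => ENNReal.ofReal (gaussDensity n x) := by
  have : IsFiniteMeasure ((volume : Measure (E n)).withDensity
      fun x => ENNReal.ofReal (gaussDensity n x)) :=
    isFiniteMeasure_withDensity_ofReal (integrable_gaussDensity n).2
  refine Measure.ext_of_charFun (funext fun t => ?_)
  rw [charFun_stdGaussian, charFun_apply, integral_withDensity_eq_integral_toReal_smul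
    (measurable_gaussDensity n).ennreal_ofReal (by simp)]
  have h := GaussianFourier.integral_cexp_neg_mul_sq_norm_add (V := E n) (b := (1 / 2 : ℝ))
    (by simp) Complex.I t
  have e : ∀ x : E n, (ENNReal.ofReal (gaussDensity n x)).toReal •
      Complex.exp (inner ℝ x t * Complex.I) = ((2 * Real.pi : ℝ) ^ (-(n / 2 : ℝ)) : ℝ) *
        Complex.exp (-((1 / 2 : ℝ) : ℂ) * ‖x‖ ^ 2 + Complex.I * inner ℝ t x) := by
    intro x
    rw [ENNReal.toReal_ofReal (gaussDensity_nonneg n x), gaussDensity, Complex.real_smul,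
      Complex.ofReal_mul, Complex.exp_add, real_inner_comm, mul_assoc]
    congr 2
    · push_cast; rfl
    · rw [mul_comm]
  simp_rw [e]
  rw [integral_const_mul, h]
  have e2 : ((Real.pi : ℂ) / ((1 / 2 : ℝ) : ℂ)) ^ ((Module.finrank ℝ (E n) : ℂ) / 2)
      = (((2 * Real.pi : ℝ) ^ (n / 2 : ℝ) : ℝ) : ℂ) := by
    rw [Complex.ofReal_cpow (by positivity)]
    simp
    ring_nf
  rw [e2, ← mul_assoc, ← Complex.ofReal_mul, ← Real.rpow_add (by positivity)]
  simp
  ring_nf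

/-- Tilting by exp(l|x|²) leaves a Gaussian integral with parameter 1/2 - l. This one formula yields
both the tails and the moments of |x|². -/
theorem lintegral_exp_mul_sq_norm_stdGaussian (n : ℕ) {l : ℝ} (hl : l < 1 / 2) :
    ∫⁻ x, ENNReal.ofReal (Real.exp (l * ‖x‖ ^ 2)) ∂(stdGaussian (E n))
      = ENNReal.ofReal ((1 - 2 * l) ^ (-(n / 2 : ℝ))) := by
  have hb : 0 < 1 / 2 - l := by linarith
  have h := GaussianFourier.integral_rexp_neg_mul_sq_norm (V := E n) hb
  have hi : Integrable fun x : E n => Real.exp (-(1 / 2 - l) * ‖x‖ ^ 2) := by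
    have := (GaussianFourier.integrable_cexp_neg_mul_sq_norm_add (V := E n)
      (b := ((1 / 2 - l : ℝ) : ℂ)) (by simpa using hb) 0 0).norm
    refine this.congr (Filter.Eventually.of_forall fun x => ?_)
    simp only [Complex.norm_exp]
    congr 1
    simp [← Complex.ofReal_pow]
  rw [stdGaussian_eq_withDensity, lintegral_withDensity_eq_lintegral_mul _
    (measurable_gaussDensity n).ennreal_ofReal (by fun_prop)]
  have e : ∀ x : E n, ENNReal.ofReal (gaussDensity n x) * ENNReal.ofReal (Real.exp (l * ‖x‖ ^ 2))
      = ENNReal.ofReal ((2 * Real.pi) ^ (-(n / 2 : ℝ)) * Real.exp (-(1 / 2 - l) * ‖x‖ ^ 2)) := by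
    intro x
    rw [← ENNReal.ofReal_mul (gaussDensity_nonneg n x), gaussDensity, mul_assoc, ← Real.exp_add]
    ring_nf
  simp only [Pi.mul_apply, e]
  rw [← ofReal_integral_eq_lintegral_ofReal (hi.const_mul _)
    (Filter.Eventually.of_forall fun x => by positivity), integral_const_mul, h]
  congr 1
  have e3 : Real.pi / (1 / 2 - l) = (2 * Real.pi) * (1 - 2 * l)⁻¹ := by
    have : (1 - 2 * l) ≠ 0 := by linarith
    field_simp
  rw [e3, Real.mul_rpow (x := 2 * Real.pi) (by positivity) (by rw [inv_nonneg]; linarith), ← mul_assoc,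
    finrank_euclideanSpace_fin, ← Real.rpow_add (by positivity)]
  simp
  rw [Real.inv_rpow (by linarith), Real.rpow_neg (by linarith)]

/-- The exponential moments of the standardized squared norm are bounded uniformly in `n`. -/
theorem rpow_mul_exp_le {n : ℕ} {u : ℝ} (hu : |u| ≤ 1 / 2) :
    (1 - u) ^ (-(n / 2 : ℝ)) ≤ Real.exp ((u + u ^ 2) * (n / 2)) := by
  have hu' := abs_le.1 hu
  have h1 : 0 < 1 - u := by linarith
  have h2 : (1 - u)⁻¹ ≤ Real.exp (u + u ^ 2) := by
    have : 1 + (u + u ^ 2) ≤ Real.exp (u + u ^ 2) := by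
      linarith [Real.add_one_le_exp (u + u ^ 2)]
    -- Since (1 - u)(1 + u + u²) = 1 - u³, the first-order bound on exp suffices for u ≤ 0, while u
    -- ≥ 0 needs the quadratic term.
    rcases le_total 0 u with h | h
    · have h3 : 1 + (u + u ^ 2) + (u + u ^ 2) ^ 2 / 2 ≤ Real.exp (u + u ^ 2) :=
        by linarith [Real.quadratic_le_exp_of_nonneg (x := u + u ^ 2) (by positivity)]
      refine le_trans ?_ h3
      rw [inv_le_iff_one_le_mul₀ h1]
      nlinarith [mul_nonneg h (sq_nonneg u), mul_nonneg (sq_nonneg u) (sub_nonneg.2 hu'.2)]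
    · refine le_trans ?_ this
      rw [inv_le_iff_one_le_mul₀ h1]
      nlinarith [mul_nonneg (neg_nonneg.2 h) (sq_nonneg u)]
  rw [Real.rpow_neg h1.le, ← Real.inv_rpow h1.le, Real.exp_mul]
  exact Real.rpow_le_rpow (by positivity) h2 (by positivity)

theorem pow_four_le_exp_add_exp (y : ℝ) : y ^ 4 ≤ 24 * (Real.exp y + Real.exp (-y)) := by
  have h := Real.pow_div_factorial_le_exp |y| (abs_nonneg y) 4
  have e : |y| ^ 4 = y ^ 4 := by rw [Even.pow_abs (by decide)]
  have h2 : Real.exp |y| ≤ Real.exp y + Real.exp (-y) := by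
    rcases abs_choice y with h | h <;> rw [h] <;> nlinarith [Real.exp_pos y, Real.exp_pos (-y)]
  rw [e] at h
  norm_num [Nat.factorial] at h
  linarith

end RandomizedCLT

/-! ### Polar decomposition: uniform direction and independent radius. -/

namespace RandomizedCLT

instance isProbabilityMeasure_sphereMeasure (n : ℕ) [NeZero n] :
    IsProbabilityMeasure (sphereMeasure n) := by
  have : Nonempty (Fin n) := ⟨0⟩
  have : Nontrivial (E n) := inferInstance
  refine ⟨?_⟩
  rw [sphereMeasure, Measure.smul_apply, smul_eq_mul]
  refine ENNReal.inv_mul_cancel ?_ (measure_ne_top _ _)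
  rw [Ne, Measure.measure_univ_eq_zero]
  exact Measure.toSphere_ne_zero _

/-- Polar decomposition of the standard Gaussian measure. -/
theorem exists_polar_stdGaussian (n : ℕ) [NeZero n] :
    ∃ ρ : Measure (Set.Ioi (0 : ℝ)), IsProbabilityMeasure ρ ∧
      MeasurePreserving (fun p : Sph n × Set.Ioi (0 : ℝ) => p.2.1 • (p.1 : E n))
        ((sphereMeasure n).prod ρ) (stdGaussian (E n)) := by
  have : Nonempty (Fin n) := ⟨0⟩
  have : Nontrivial (E n) := inferInstance
  set S : Measure (Sph n) := (volume : Measure (E n)).toSphere with hS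
  set κ := S Set.univ with hκ
  have hκ0 : κ ≠ 0 := by
    rw [hκ, Ne, Measure.measure_univ_eq_zero]; exact Measure.toSphere_ne_zero _
  have hκt : κ ≠ ⊤ := measure_ne_top _ _
  set ν := Measure.volumeIoiPow (Module.finrank ℝ (E n) - 1) with hν
  let d : ℝ → ENNReal := fun r =>
    ENNReal.ofReal ((2 * Real.pi) ^ (-(n / 2 : ℝ)) * Real.exp (-(1 / 2) * r ^ 2))
  have hd : Measurable d := by unfold d; fun_prop
  -- The factor `κ` undoes the normalization of the sphere measure; that `ρ` has mass one is read
  -- off later from `key` with f = 1.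
  let ρ : Measure (Set.Ioi (0 : ℝ)) := κ • ν.withDensity fun r => d r.1
  have hpm : Measurable fun p : Sph n × Set.Ioi (0 : ℝ) => p.2.1 • (p.1 : E n) := by fun_prop
  have key : ∀ f : E n → ENNReal, Measurable f → ∫⁻ x, f x ∂(stdGaussian (E n))
      = ∫⁻ p : Sph n × Set.Ioi (0 : ℝ), f (p.2.1 • (p.1 : E n)) ∂((sphereMeasure n).prod ρ) := by
    intro f hf
    have hdn : ∀ x : E n, ENNReal.ofReal (gaussDensity n x) = d ‖x‖ := fun x => rfl
    have hfd : Measurable fun x : E n => d ‖x‖ * f x := by fun_prop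
    rw [stdGaussian_eq_withDensity, lintegral_withDensity_eq_lintegral_mul _
      (measurable_gaussDensity n).ennreal_ofReal hf]
    simp only [Pi.mul_apply, hdn]
    -- Polar coordinates parametrize only the complement of the origin, which is a null set.
    have e1 : ∫⁻ x : E n, d ‖x‖ * f x
        = ∫⁻ x : ({0}ᶜ : Set (E n)), d ‖(x : E n)‖ * f x ∂((volume : Measure (E n)).comap Subtype.val) := by
      rw [lintegral_subtype_comap (measurableSet_singleton _).compl (fun x : E n => d ‖x‖ * f x),
        restrict_compl_singleton]
    have mp := (volume : Measure (E n)).measurePreserving_homeomorphUnitSphereProd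
    have e2 := mp.symm (homeomorphUnitSphereProd (E n)).toMeasurableEquiv
    have e3 := e2.lintegral_comp (f := fun x : ({0}ᶜ : Set (E n)) => d ‖(x : E n)‖ * f x)
      (hfd.comp measurable_subtype_coe)
    rw [e1, ← e3]
    have hm2 : Measurable fun p : Sph n × Set.Ioi (0 : ℝ) => d p.2.1 * f (p.2.1 • (p.1 : E n)) :=
      by fun_prop
    have e4 : ∀ p : Sph n × Set.Ioi (0 : ℝ),
        d ‖((homeomorphUnitSphereProd (E n)).toMeasurableEquiv.symm p : E n)‖
          * f ((homeomorphUnitSphereProd (E n)).toMeasurableEquiv.symm p : E n)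
        = d p.2.1 * f (p.2.1 • (p.1 : E n)) := by
      intro p
      have : ((homeomorphUnitSphereProd (E n)).toMeasurableEquiv.symm p : E n)
          = p.2.1 • (p.1 : E n) := homeomorphUnitSphereProd_symm_apply_coe (E n) p
      rw [this, norm_smul, norm_eq_of_mem_sphere, Real.norm_of_nonneg p.2.2.le, mul_one]
    simp_rw [e4]
    rw [lintegral_prod _ hm2.aemeasurable,
      lintegral_prod (f := fun p : Sph n × Set.Ioi (0 : ℝ) => f (p.2.1 • (p.1 : E n)))
        (hf.comp hpm).aemeasurable]
    rw [sphereMeasure, lintegral_smul_measure, smul_eq_mul]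
    have e5 : ∀ x : Sph n, ∫⁻ r : Set.Ioi (0 : ℝ), f (r.1 • (x : E n)) ∂ρ
        = κ * ∫⁻ r : Set.Ioi (0 : ℝ), d r.1 * f (r.1 • (x : E n)) ∂ν := by
      intro x
      rw [lintegral_smul_measure, smul_eq_mul, lintegral_withDensity_eq_lintegral_mul _
        (by fun_prop) (by fun_prop)]
      rfl
    simp_rw [e5]
    rw [lintegral_const_mul' _ _ hκt, ← mul_assoc, ENNReal.inv_mul_cancel hκ0 hκt, one_mul]
  have hρ : IsProbabilityMeasure ρ := by
    have := key (fun _ => 1) measurable_const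
    simp only [lintegral_one, measure_univ, ← Set.univ_prod_univ,
      Measure.prod_prod, one_mul] at this
    exact ⟨this.symm⟩
  refine ⟨ρ, hρ, hpm, ?_⟩
  refine Measure.ext fun s hs => ?_
  rw [Measure.map_apply hpm hs, ← lintegral_indicator_one (hpm hs), ← lintegral_indicator_one hs,
    key _ (measurable_one.indicator hs)]
  rfl

end RandomizedCLT

/-! ### Cauchy–Schwarz inequalities, isotropic laws and their characteristic functions. -/

namespace RandomizedCLT

theorem lintegral_sq_le {α : Type*} [MeasurableSpace α] (ν : Measure α) {f : α → ENNReal}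
    (hf : AEMeasurable f ν) :
    (∫⁻ a, f a ∂ν) ^ 2 ≤ ν Set.univ * ∫⁻ a, f a ^ 2 ∂ν := by
  have h := ENNReal.lintegral_mul_le_Lp_mul_Lq ν Real.HolderConjugate.two_two
    (aemeasurable_const (b := (1 : ENNReal))) hf
  simp only [Pi.mul_apply, one_mul, ENNReal.one_rpow, lintegral_one] at h
  have h2 := pow_le_pow_left' h 2
  rw [mul_pow, ← ENNReal.rpow_natCast (_ ^ (1 / 2 : ℝ)), ← ENNReal.rpow_mul,
    ← ENNReal.rpow_natCast (_ ^ (1 / 2 : ℝ)), ← ENNReal.rpow_mul] at h2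
  simpa using h2

theorem lintegral_mul_sq_le {α : Type*} [MeasurableSpace α] (ν : Measure α) {w f : α → ENNReal}
    (hw : Measurable w) (hf : Measurable f) :
    (∫⁻ a, w a * f a ∂ν) ^ 2 ≤ (∫⁻ a, w a ∂ν) * ∫⁻ a, w a * f a ^ 2 ∂ν := by
  have h := lintegral_sq_le (ν.withDensity w) hf.aemeasurable
  rw [lintegral_withDensity_eq_lintegral_mul _ hw hf,
    lintegral_withDensity_eq_lintegral_mul _ hw (hf.pow_const 2), withDensity_apply _ .univ,
    setLIntegral_univ] at h
  exact h

theorem lintegral_pow_four_le {α : Type*} [MeasurableSpace α] (ν : Measure α) {f : α → ENNReal}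
    (hf : AEMeasurable f ν) :
    (∫⁻ a, f a ∂ν) ^ 4 ≤ ν Set.univ ^ 3 * ∫⁻ a, f a ^ 4 ∂ν := by
  have h1 := lintegral_sq_le ν hf
  have h2 := lintegral_sq_le ν (hf.pow_const 2)
  calc (∫⁻ a, f a ∂ν) ^ 4 = ((∫⁻ a, f a ∂ν) ^ 2) ^ 2 := by ring
    _ ≤ (ν Set.univ * ∫⁻ a, f a ^ 2 ∂ν) ^ 2 := by gcongr
    _ = ν Set.univ ^ 2 * (∫⁻ a, f a ^ 2 ∂ν) ^ 2 := by ring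
    _ ≤ ν Set.univ ^ 2 * (ν Set.univ * ∫⁻ a, (f a ^ 2) ^ 2 ∂ν) := by gcongr
    _ = _ := by simp_rw [← pow_mul]; ring

/-- Square integrable isotropic probability laws on `ℝⁿ`. -/
structure IsotropicLaw {n : ℕ} (μ : Measure (E n)) : Prop where
  memLp : MemLp id 2 μ
  integral_inner_sq : ∀ v : E n, ∫ x, inner ℝ x v ^ 2 ∂μ = ‖v‖ ^ 2

theorem sq_integral_le {α : Type*} [MeasurableSpace α] {ν : Measure α} [IsProbabilityMeasure ν]
    {f : α → ℝ} (h1 : Integrable f ν) (h2 : Integrable (fun a => f a ^ 2) ν) :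
    (∫ a, f a ∂ν) ^ 2 ≤ ∫ a, f a ^ 2 ∂ν := by
  set m := ∫ a, f a ∂ν
  have h0 : 0 ≤ ∫ a, (f a - m) ^ 2 ∂ν := integral_nonneg fun _ => sq_nonneg _
  have e : ∀ a, (f a - m) ^ 2 = f a ^ 2 - 2 * m * f a + m ^ 2 := fun a => by ring
  have e2 : ∫ a, (f a - m) ^ 2 ∂ν = ∫ a, f a ^ 2 ∂ν - 2 * m * m + m ^ 2 := by
    simp_rw [e]
    rw [integral_add (by exact h2.sub (h1.const_mul _)) (integrable_const _),
      integral_sub h2 (h1.const_mul _), integral_const_mul]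
    simp [m]
  rw [e2] at h0
  nlinarith

variable {n : ℕ} {μ : Measure (E n)}

namespace IsotropicLaw

theorem memLp_inner (h : IsotropicLaw μ) (v : E n) : MemLp (fun x => inner ℝ x v) 2 μ := by
  have := (innerSL ℝ v).comp_memLp' h.memLp
  refine this.congr_norm (Measurable.aestronglyMeasurable (by fun_prop))
    (Filter.Eventually.of_forall fun x => ?_)
  simp [real_inner_comm]

theorem integrable_inner_sq (h : IsotropicLaw μ) (v : E n) :
    Integrable (fun x => inner ℝ x v ^ 2) μ := (h.memLp_inner v).integrable_sq

theorem lintegral_inner_sq (h : IsotropicLaw μ) (v : E n) :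
    ∫⁻ x, ENNReal.ofReal (inner ℝ x v ^ 2) ∂μ = ENNReal.ofReal (‖v‖ ^ 2) := by
  rw [← ofReal_integral_eq_lintegral_ofReal (h.integrable_inner_sq v)
    (Filter.Eventually.of_forall fun _ => sq_nonneg _), h.integral_inner_sq]

variable [IsProbabilityMeasure μ]

theorem integrable_inner (h : IsotropicLaw μ) (v : E n) :
    Integrable (fun x => inner ℝ x v) μ := (h.memLp_inner v).integrable (by norm_num)

theorem integrable_norm (h : IsotropicLaw μ) : Integrable (fun x => ‖x‖) μ :=
  (h.memLp.integrable (by norm_num)).norm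

theorem integral_abs_inner_le (h : IsotropicLaw μ) (v : E n) :
    ∫ x, |inner ℝ x v| ∂μ ≤ ‖v‖ := by
  have := sq_integral_le (h.integrable_inner v).abs
    (by simpa only [sq_abs] using h.integrable_inner_sq v)
  simp only [sq_abs, h.integral_inner_sq] at this
  exact abs_le_of_sq_le_sq' this (norm_nonneg v) |>.2

end IsotropicLaw

theorem norm_cexp_sub_cexp_le (a b : ℝ) :
    ‖Complex.exp (a * Complex.I) - Complex.exp (b * Complex.I)‖ ≤ |a - b| := by
  have e : Complex.exp (a * Complex.I) - Complex.exp (b * Complex.I)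
      = Complex.exp (b * Complex.I) * (Complex.exp (Complex.I * ((a - b : ℝ) : ℂ)) - 1) := by
    rw [mul_sub, ← Complex.exp_add, mul_one]
    congr 2
    push_cast; ring
  rw [e, norm_mul, Complex.norm_exp_ofReal_mul_I, one_mul]
  exact Real.norm_exp_I_mul_ofReal_sub_one_le

theorem integrable_cexp_inner [IsFiniteMeasure μ] (u : E n) :
    Integrable (fun x => Complex.exp (inner ℝ x u * Complex.I)) μ := by
  refine (integrable_const (1 : ℝ)).mono' (Measurable.aestronglyMeasurable (by fun_prop))
    (Filter.Eventually.of_forall fun w => ?_)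
  rw [Complex.norm_exp_ofReal_mul_I]

/-- The characteristic function of an isotropic law is `1`-Lipschitz. -/
theorem IsotropicLaw.norm_charFun_sub_le [IsProbabilityMeasure μ] (h : IsotropicLaw μ)
    (u v : E n) : ‖charFun μ u - charFun μ v‖ ≤ ‖u - v‖ := by
  rw [charFun_apply, charFun_apply, ← integral_sub (integrable_cexp_inner u)
    (integrable_cexp_inner v)]
  refine (norm_integral_le_integral_norm _).trans (le_trans ?_ (h.integral_abs_inner_le (u - v)))
  refine integral_mono ((integrable_cexp_inner u).sub (integrable_cexp_inner v)).norm
    (h.integrable_inner _).abs fun x => ?_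
  rw [inner_sub_right]
  exact norm_cexp_sub_cexp_le _ _

/-- The directional derivative at `u` along `v` of the characteristic function of `μ`. -/
noncomputable def charFunDeriv (μ : Measure (E n)) (u v : E n) : ℂ :=
  ∫ x, (inner ℝ x v : ℂ) * Complex.I * Complex.exp (inner ℝ x u * Complex.I) ∂μ

theorem measurable_charFunDeriv [SFinite μ] :
    Measurable fun p : E n × E n => charFunDeriv μ p.1 p.2 := by
  unfold charFunDeriv
  have : Measurable fun q : (E n × E n) × E n =>
      (inner ℝ q.2 q.1.2 : ℂ) * Complex.I * Complex.exp (inner ℝ q.2 q.1.1 * Complex.I) := by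
    fun_prop
  exact (this.stronglyMeasurable.integral_prod_right' (ν := μ)).measurable

/-- The derivative of the characteristic function is dominated by two linear functionals of
norm at most one. -/
theorem IsotropicLaw.exists_charFunDeriv_le [IsProbabilityMeasure μ] (h : IsotropicLaw μ)
    (u : E n) : ∃ a b : E n, ‖a‖ ≤ 1 ∧ ‖b‖ ≤ 1 ∧
      ∀ v, ‖charFunDeriv μ u v‖ ^ 2 = inner ℝ a v ^ 2 + inner ℝ b v ^ 2 := by
  have hi : Integrable (fun x : E n => x) μ := h.memLp.integrable (by norm_num)
  -- For a weight |c| ≤ 1 put a = E c(x)x. Testing against itself, |a|² = E c⟨x, a⟩ ≤ E |⟨x, a⟩| ≤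
  -- |a|, whence |a| ≤ 1. The weights used are the cosine and sine of ⟨x, u⟩.
  have main : ∀ c : E n → ℝ, Measurable c → (∀ x, |c x| ≤ 1) →
      ‖∫ x, c x • x ∂μ‖ ≤ 1 ∧ ∀ v, Integrable (fun x => c x * inner ℝ x v) μ ∧
        inner ℝ (∫ x, c x • x ∂μ) v = ∫ x, c x * inner ℝ x v ∂μ := by
    intro c hc hc1
    have hci : Integrable (fun x => c x • x) μ :=
      hi.norm.mono' (hc.smul measurable_id).aestronglyMeasurable
        (Filter.Eventually.of_forall fun x => by
          rw [norm_smul, Real.norm_eq_abs]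
          exact mul_le_of_le_one_left (norm_nonneg _) (hc1 x))
    have hle : ∀ v x, |c x * inner ℝ x v| ≤ |inner ℝ x v| := fun v x => by
      rw [abs_mul]
      exact mul_le_of_le_one_left (abs_nonneg _) (hc1 x)
    have hint : ∀ v, Integrable (fun x => c x * inner ℝ x v) μ := fun v =>
      (h.integrable_inner v).abs.mono' (Measurable.aestronglyMeasurable (by fun_prop))
        (Filter.Eventually.of_forall (hle v))
    have hin : ∀ v, inner ℝ (∫ x, c x • x ∂μ) v = ∫ x, c x * inner ℝ x v ∂μ := by
      intro v
      rw [real_inner_comm, ← integral_inner hci]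
      simp only [inner_smul_right, real_inner_comm v]
    refine ⟨?_, fun v => ⟨hint v, hin v⟩⟩
    set a := ∫ x, c x • x ∂μ with ha
    have h1 : ‖a‖ ^ 2 ≤ ‖a‖ := by
      rw [← real_inner_self_eq_norm_sq, hin a]
      exact (integral_mono (hint a) (h.integrable_inner a).abs fun x =>
        (le_abs_self _).trans (hle a x)).trans (h.integral_abs_inner_le a)
    by_contra! hlt
    nlinarith
  obtain ⟨ha, ha'⟩ := main (fun x => Real.cos (inner ℝ x u)) (by fun_prop)
    (fun x => Real.abs_cos_le_one _)
  obtain ⟨hb, hb'⟩ := main (fun x => Real.sin (inner ℝ x u)) (by fun_prop)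
    (fun x => Real.abs_sin_le_one _)
  refine ⟨_, _, ha, hb, fun v => ?_⟩
  obtain ⟨ia, ea⟩ := ha' v
  obtain ⟨ib, eb⟩ := hb' v
  rw [ea, eb]
  have e : charFunDeriv μ u v = ((∫ x, Real.cos (inner ℝ x u) * inner ℝ x v ∂μ : ℝ) : ℂ) * Complex.I
      - ((∫ x, Real.sin (inner ℝ x u) * inner ℝ x v ∂μ : ℝ) : ℂ) := by
    rw [← integral_complex_ofReal, ← integral_complex_ofReal, ← integral_mul_const,
      ← integral_sub (ia.ofReal.mul_const _) ib.ofReal, charFunDeriv]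
    congr 1
    funext x
    rw [Complex.exp_mul_I]
    push_cast
    linear_combination (inner ℝ x v : ℂ) * Complex.sin (inner ℝ x u : ℂ) * Complex.I_sq
  rw [e, ← Complex.normSq_eq_norm_sq, Complex.normSq_apply]
  simp
  ring

end RandomizedCLT

/-! ### Gaussian concentration of the characteristic function. -/

namespace RandomizedCLT

variable {n : ℕ} {μ : Measure (E n)}

theorem lintegral_exp_inner_stdGaussian (a : E n) :
    ∫⁻ z, ENNReal.ofReal (Real.exp (inner ℝ a z)) ∂(stdGaussian (E n))
      = ENNReal.ofReal (Real.exp (‖a‖ ^ 2 / 2)) := by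
  have hmap := IsGaussian.map_eq_gaussianReal (μ := stdGaussian (E n)) (innerSL ℝ a)
  rw [integral_strongDual_stdGaussian, variance_dual_stdGaussian] at hmap
  have h := mgf_gaussianReal hmap 1
  simp only [mgf, innerSL_apply_apply, one_mul, innerSL_apply_norm, zero_add, one_pow,
    mul_one, Real.coe_toNNReal _ (sq_nonneg ‖a‖)] at h
  -- A nonzero Bochner integral forces integrability.
  have hi : Integrable (fun z => Real.exp (inner ℝ a z)) (stdGaussian (E n)) :=
    Integrable.of_integral_ne_zero (by rw [h]; exact (Real.exp_pos _).ne')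
  rw [← ofReal_integral_eq_lintegral_ofReal hi
    (Filter.Eventually.of_forall fun _ => (Real.exp_pos _).le), h]

/-- The value 96 is 24 · (2 + 2), from y⁴ ≤ 24(eʸ + e⁻ʸ) and exp(1/2) ≤ 2. -/
theorem lintegral_inner_pow_four_le {a : E n} (ha : ‖a‖ ≤ 1) :
    ∫⁻ z, ENNReal.ofReal (inner ℝ a z ^ 4) ∂(stdGaussian (E n)) ≤ 96 := by
  have hb : Real.exp (‖a‖ ^ 2 / 2) ≤ 2 := by
    have h1 : ‖a‖ ^ 2 / 2 ≤ 1 / 2 := by nlinarith [norm_nonneg a]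
    have h2 : Real.exp (1 / 2) ^ 2 = Real.exp 1 := by rw [← Real.exp_nat_mul]; norm_num
    have h3 := Real.exp_one_lt_d9
    have h4 := Real.exp_le_exp.2 h1
    nlinarith [Real.exp_pos (1 / 2)]
  have h : ∀ z, ENNReal.ofReal (inner ℝ a z ^ 4) ≤ 24 * (ENNReal.ofReal (Real.exp (inner ℝ a z))
      + ENNReal.ofReal (Real.exp (inner ℝ (-a) z))) := by
    intro z
    rw [← ENNReal.ofReal_add (Real.exp_pos _).le (Real.exp_pos _).le,
      ← ENNReal.ofReal_ofNat 24, ← ENNReal.ofReal_mul (by norm_num), inner_neg_left]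
    exact ENNReal.ofReal_le_ofReal (pow_four_le_exp_add_exp _)
  refine (lintegral_mono h).trans ?_
  rw [lintegral_const_mul _ (by fun_prop), lintegral_add_left (by fun_prop),
    lintegral_exp_inner_stdGaussian, lintegral_exp_inner_stdGaussian, norm_neg,
    ← ENNReal.ofReal_add (Real.exp_pos _).le (Real.exp_pos _).le, ← ENNReal.ofReal_ofNat 24,
    ← ENNReal.ofReal_mul (by norm_num), ← ENNReal.ofReal_ofNat 96]
  exact ENNReal.ofReal_le_ofReal (by linarith)

/-- With `u` fixed, the squared derivative is a sum of squares of two Gaussian linear forms of norm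
at most one, so the bound does not depend on the dimension. The constant is 2 · (96 + 96). -/
theorem IsotropicLaw.lintegral_charFunDeriv_le [IsProbabilityMeasure μ] (h : IsotropicLaw μ)
    (u : E n) (s : ℝ) :
    ∫⁻ z, ‖charFunDeriv μ u (s • z)‖ₑ ^ 4 ∂(stdGaussian (E n)) ≤ ENNReal.ofReal (384 * s ^ 4) := by
  obtain ⟨a, b, ha, hb, hab⟩ := h.exists_charFunDeriv_le u
  have hp : ∀ z, ‖charFunDeriv μ u (s • z)‖ₑ ^ 4 ≤ ENNReal.ofReal (2 * s ^ 4) *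
      (ENNReal.ofReal (inner ℝ a z ^ 4) + ENNReal.ofReal (inner ℝ b z ^ 4)) := by
    intro z
    rw [← ofReal_norm, ← ENNReal.ofReal_pow (norm_nonneg _), ← ENNReal.ofReal_add (by positivity)
      (by positivity), ← ENNReal.ofReal_mul (by positivity)]
    refine ENNReal.ofReal_le_ofReal ?_
    have e : ‖charFunDeriv μ u (s • z)‖ ^ 4 = (‖charFunDeriv μ u (s • z)‖ ^ 2) ^ 2 := by ring
    rw [e, hab, inner_smul_right, inner_smul_right]
    nlinarith [mul_nonneg (sq_nonneg (s ^ 2)) (sq_nonneg (inner ℝ a z ^ 2 - inner ℝ b z ^ 2))]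
  refine (lintegral_mono hp).trans ?_
  rw [lintegral_const_mul _ (by fun_prop), lintegral_add_left (by fun_prop)]
  calc _ ≤ ENNReal.ofReal (2 * s ^ 4) * (96 + 96) := by
        gcongr <;> exact lintegral_inner_pow_four_le (by assumption)
    _ = _ := by
        have : (96 + 96 : ENNReal) = ENNReal.ofReal 192 := by norm_num
        rw [this, ← ENNReal.ofReal_mul (by positivity)]
        ring_nf

/-- The path is a quarter circle rather than a segment: position and velocity at angle φ are then a
rotation of the pair (z, z'). -/
theorem IsotropicLaw.charFun_sub_eq_integral [IsProbabilityMeasure μ] (h : IsotropicLaw μ)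
    (z z' : E n) (s : ℝ) :
    charFun μ (s • z') - charFun μ (s • z) = ∫ φ in (0 : ℝ)..(Real.pi / 2),
      charFunDeriv μ (s • (Real.cos φ • z + Real.sin φ • z'))
        (s • (-Real.sin φ • z + Real.cos φ • z')) := by
  set c : ℝ → E n := fun φ => s • (Real.cos φ • z + Real.sin φ • z') with hc
  set c' : ℝ → E n := fun φ => s • (-Real.sin φ • z + Real.cos φ • z') with hc'
  have hcc : ∀ φ, HasDerivAt c (c' φ) φ := fun φ =>
    (((Real.hasDerivAt_cos φ).smul_const z).add ((Real.hasDerivAt_sin φ).smul_const z')).const_smul s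
  have hcont' : Continuous c' := by unfold c'; fun_prop
  have hcont : Continuous c := by unfold c; fun_prop
  set B := |s| * (‖z‖ + ‖z'‖) with hB
  have hc'B : ∀ φ, ‖c' φ‖ ≤ B := by
    intro φ
    rw [hc', hB]
    simp only [norm_smul, Real.norm_eq_abs]
    gcongr
    refine (norm_add_le _ _).trans ?_
    simp only [norm_smul, Real.norm_eq_abs, abs_neg]
    exact add_le_add (mul_le_of_le_one_left (norm_nonneg _) (Real.abs_sin_le_one _))
      (mul_le_of_le_one_left (norm_nonneg _) (Real.abs_cos_le_one _))
  have hbound : ∀ (x : E n) (φ : ℝ), ‖(inner ℝ x (c' φ) : ℂ) * Complex.I *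
      Complex.exp (inner ℝ x (c φ) * Complex.I)‖ ≤ ‖x‖ * B := by
    intro x φ
    rw [norm_mul, norm_mul, Complex.norm_exp_ofReal_mul_I, Complex.norm_I, mul_one, mul_one,
      Complex.norm_real]
    exact (norm_inner_le_norm _ _).trans (by gcongr; exact hc'B φ)
  have hder : ∀ φ, HasDerivAt (fun φ => charFun μ (c φ)) (charFunDeriv μ (c φ) (c' φ)) φ := by
    intro φ
    refine (hasDerivAt_integral_of_dominated_loc_of_deriv_le (μ := μ) (s := Set.univ)
      (F := fun φ x => Complex.exp (inner ℝ x (c φ) * Complex.I))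
      (F' := fun φ x => (inner ℝ x (c' φ) : ℂ) * Complex.I *
        Complex.exp (inner ℝ x (c φ) * Complex.I)) (bound := fun x => ‖x‖ * B)
      Filter.univ_mem ?_ (integrable_cexp_inner _) ?_ ?_ (h.integrable_norm.mul_const B) ?_).2
    · exact Filter.Eventually.of_forall fun ψ => (integrable_cexp_inner _).1
    · exact Measurable.aestronglyMeasurable (by fun_prop)
    · exact Filter.Eventually.of_forall fun x ψ _ => hbound x ψ
    · refine Filter.Eventually.of_forall fun x ψ _ => ?_
      have h1 : HasDerivAt (fun φ => inner ℝ x (c φ)) (inner ℝ x (c' ψ)) ψ := by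
        simpa using (hasDerivAt_const ψ x).inner ℝ (hcc ψ)
      have h2 := ((h1.ofReal_comp).mul_const Complex.I).cexp
      convert! h2 using 1
      ring
  have hdc : Continuous fun φ => charFunDeriv μ (c φ) (c' φ) := by
    unfold charFunDeriv
    refine continuous_of_dominated (bound := fun x => ‖x‖ * B)
      (fun φ => Measurable.aestronglyMeasurable (by fun_prop))
      (fun φ => Filter.Eventually.of_forall fun x => hbound x φ) (h.integrable_norm.mul_const B)
      (Filter.Eventually.of_forall fun x => by fun_prop)
  have := intervalIntegral.integral_eq_sub_of_hasDerivAt (a := 0) (b := Real.pi / 2)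
    (fun φ _ => hder φ) (hdc.intervalIntegrable _ _)
  rw [this]
  simp [hc]

/-- Gaussian concentration (Maurey–Pisier) in fourth mean for the characteristic function. -/
theorem IsotropicLaw.lintegral_charFun_sub_stdGaussian_le [IsProbabilityMeasure μ]
    (h : IsotropicLaw μ) (s : ℝ) :
    ∫⁻ p : E n × E n, ‖charFun μ (s • p.1) - charFun μ (s • p.2)‖ₑ ^ 4
      ∂((stdGaussian (E n)).prod (stdGaussian (E n))) ≤ ENNReal.ofReal (6144 * s ^ 4) := by
  set γ := stdGaussian (E n)
  set ν : Measure ℝ := volume.restrict (Set.Ioc 0 (Real.pi / 2)) with hν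
  have hνu : ν Set.univ ≤ 2 := by
    rw [hν, Measure.restrict_apply_univ, Real.volume_Ioc, ← ENNReal.ofReal_ofNat]
    exact ENNReal.ofReal_le_ofReal (by linarith [Real.pi_le_four])
  let D : ℝ → E n × E n → ℂ := fun φ p =>
    charFunDeriv μ (s • (Real.cos φ • p.1 + Real.sin φ • p.2))
        (s • (-Real.sin φ • p.1 + Real.cos φ • p.2))
  have hDm : Measurable (Function.uncurry D) :=
    measurable_charFunDeriv.comp (f := fun q : ℝ × (E n × E n) =>
      (s • (Real.cos q.1 • q.2.1 + Real.sin q.1 • q.2.2),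
        s • (-Real.sin q.1 • q.2.1 + Real.cos q.1 • q.2.2))) (by fun_prop)
  have hpt : ∀ p : E n × E n, ‖charFun μ (s • p.1) - charFun μ (s • p.2)‖ₑ ^ 4
      ≤ 8 * ∫⁻ φ, ‖D φ p‖ₑ ^ 4 ∂ν := by
    intro p
    rw [← enorm_neg, neg_sub, h.charFun_sub_eq_integral,
      intervalIntegral.integral_of_le (by positivity)]
    have hm : Measurable fun φ => ‖D φ p‖ₑ := (hDm.comp (measurable_id.prodMk measurable_const)).enorm
    calc _ ≤ (∫⁻ φ, ‖D φ p‖ₑ ∂ν) ^ 4 := by gcongr; exact enorm_integral_le_lintegral_enorm _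
      _ ≤ _ := lintegral_pow_four_le ν hm.aemeasurable
      _ ≤ 2 ^ 3 * _ := by gcongr
      _ = _ := by norm_num
  -- Rotation invariance of `γ.prod γ` makes position and velocity independent Gaussian vectors for
  -- every angle, so the position can be frozen.
  have hrot : ∀ φ, ∫⁻ p, ‖D φ p‖ₑ ^ 4 ∂(γ.prod γ) ≤ ENNReal.ofReal (384 * s ^ 4) := by
    intro φ
    have hr := IsGaussian.map_rotation_eq_self (μ := γ) integral_id_stdGaussian φ
    have hm0 : Measurable fun p : E n × E n => ‖charFunDeriv μ (s • p.1) (s • p.2)‖ₑ ^ 4 :=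
      ((measurable_charFunDeriv (μ := μ)).comp
        (f := fun p : E n × E n => (s • p.1, s • p.2)) (by fun_prop)).enorm.pow_const 4
    calc ∫⁻ p, ‖D φ p‖ₑ ^ 4 ∂(γ.prod γ)
        = ∫⁻ p, ‖charFunDeriv μ (s • p.1) (s • p.2)‖ₑ ^ 4
            ∂((γ.prod γ).map (ContinuousLinearMap.rotation φ)) := by
          rw [lintegral_map hm0 (ContinuousLinearMap.continuous _).measurable]
          rfl
      _ = ∫⁻ z, ∫⁻ z', ‖charFunDeriv μ (s • z) (s • z')‖ₑ ^ 4 ∂γ ∂γ := by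
          rw [hr, lintegral_prod _ hm0.aemeasurable]
      _ ≤ ∫⁻ z, ENNReal.ofReal (384 * s ^ 4) ∂γ :=
          lintegral_mono fun z => h.lintegral_charFunDeriv_le _ _
      _ = _ := by simp
  calc _ ≤ ∫⁻ p, 8 * ∫⁻ φ, ‖D φ p‖ₑ ^ 4 ∂ν ∂(γ.prod γ) := lintegral_mono hpt
    _ = 8 * ∫⁻ p, ∫⁻ φ, ‖D φ p‖ₑ ^ 4 ∂ν ∂(γ.prod γ) :=
        lintegral_const_mul' _ _ (by simp)
    _ = 8 * ∫⁻ φ, ∫⁻ p, ‖D φ p‖ₑ ^ 4 ∂(γ.prod γ) ∂ν := by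
        rw [lintegral_lintegral_swap]
        exact ((hDm.comp measurable_swap).enorm.pow_const 4).aemeasurable
    _ ≤ 8 * ∫⁻ φ, ENNReal.ofReal (384 * s ^ 4) ∂ν := by gcongr with φ; exact hrot φ
    _ ≤ 8 * (ENNReal.ofReal (384 * s ^ 4) * 2) := by
        rw [lintegral_const]; gcongr
    _ = _ := by
        rw [← ENNReal.ofReal_ofNat 2, ← ENNReal.ofReal_ofNat 8, ← ENNReal.ofReal_mul (by positivity),
          ← ENNReal.ofReal_mul (by positivity)]
        ring_nf

end RandomizedCLT

/-! ### Concentration of the Gaussian radius and transfer to the sphere. -/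

namespace RandomizedCLT

variable {n : ℕ} {μ : Measure (E n)}

/-- With u = e / (2√n), the linear part of (u + u²)n/2 cancels the centring factor exp(-e√n/4). What
remains is exp(u²n/2) = exp(1/8). -/
theorem lintegral_exp_standardized_sq_norm_le [NeZero n] {e : ℝ} (he : |e| = 1) :
    ∫⁻ z, ENNReal.ofReal (Real.exp (e * ((‖z‖ ^ 2 - n) / √(n : ℝ) / 4))) ∂(stdGaussian (E n)) ≤ 2 := by
  have hn : (1 : ℝ) ≤ n := by exact_mod_cast NeZero.one_le
  have hs : 1 ≤ √(n : ℝ) := Real.one_le_sqrt.2 hn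
  have hs2 : √(n : ℝ) ^ 2 = n := Real.sq_sqrt (by positivity)
  set q := √(n : ℝ) with hq
  set u := e / (2 * q) with hu
  have hu' : |u| ≤ 1 / 2 := by
    rw [hu, abs_div, he, abs_of_pos (by positivity)]
    exact one_div_le_one_div_of_le (by norm_num) (by linarith)
  have hl : u / 2 < 1 / 2 := by linarith [le_abs_self u]
  have hp : ∀ z : E n, ENNReal.ofReal (Real.exp (e * ((‖z‖ ^ 2 - n) / q / 4)))
      = ENNReal.ofReal (Real.exp (-(e * q / 4))) * ENNReal.ofReal (Real.exp (u / 2 * ‖z‖ ^ 2)) := by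
    intro z
    rw [← ENNReal.ofReal_mul (Real.exp_pos _).le, ← Real.exp_add]
    congr 2
    rw [hu, ← hs2]
    field_simp
    ring
  simp_rw [hp]
  rw [lintegral_const_mul _ (by fun_prop), lintegral_exp_mul_sq_norm_stdGaussian n hl,
    ← ENNReal.ofReal_mul (Real.exp_pos _).le, ← ENNReal.ofReal_ofNat]
  refine ENNReal.ofReal_le_ofReal ?_
  have e2 : 2 * (u / 2) = u := by ring
  rw [e2]
  calc _ ≤ Real.exp (-(e * q / 4)) * Real.exp ((u + u ^ 2) * (n / 2)) := by
        gcongr; exact rpow_mul_exp_le hu'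
    _ = Real.exp (1 / 8) := by
        rw [← Real.exp_add]
        congr 1
        have he2 : e ^ 2 = 1 := by rw [← sq_abs, he, one_pow]
        rw [hu, ← hs2]
        field_simp
        linear_combination 32 * he2
    _ ≤ 2 := by
        have h2 : Real.exp (1 / 8) ^ 8 = Real.exp 1 := by rw [← Real.exp_nat_mul]; norm_num
        have h3 := Real.exp_one_lt_d9
        by_contra! hlt
        have : (2 : ℝ) ^ 8 < Real.exp (1 / 8) ^ 8 := by gcongr
        norm_num at this
        linarith

theorem lintegral_standardized_sq_norm_pow_four_le [NeZero n] :
    ∫⁻ z, ENNReal.ofReal (((‖z‖ ^ 2 - n) / √(n : ℝ)) ^ 4) ∂(stdGaussian (E n)) ≤ 24576 := by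
  -- 6144 = 24 · 4⁴, the fourth power coming from the division by 4 in the exponent.
  have h : ∀ z : E n, ENNReal.ofReal (((‖z‖ ^ 2 - n) / √(n : ℝ)) ^ 4) ≤
      6144 * (ENNReal.ofReal (Real.exp (1 * ((‖z‖ ^ 2 - n) / √(n : ℝ) / 4)))
        + ENNReal.ofReal (Real.exp ((-1) * ((‖z‖ ^ 2 - n) / √(n : ℝ) / 4)))) := by
    intro z
    rw [← ENNReal.ofReal_add (Real.exp_pos _).le (Real.exp_pos _).le,
      ← ENNReal.ofReal_ofNat 6144, ← ENNReal.ofReal_mul (by norm_num)]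
    refine ENNReal.ofReal_le_ofReal ?_
    have := pow_four_le_exp_add_exp ((‖z‖ ^ 2 - n) / √(n : ℝ) / 4)
    rw [div_pow _ 4 4] at this
    simp only [one_mul, neg_mul]
    linarith
  refine (lintegral_mono h).trans ?_
  rw [lintegral_const_mul _ (by fun_prop), lintegral_add_left (by fun_prop)]
  calc _ ≤ (6144 * (2 + 2) : ENNReal) := by
        gcongr
        · exact lintegral_exp_standardized_sq_norm_le (by simp)
        · exact lintegral_exp_standardized_sq_norm_le (by simp)
    _ = 24576 := by norm_num

/-- A probability measure on the half-line which is the law of the norm of a standard Gaussian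
vector, independent of its direction. -/
def IsRadialLaw (n : ℕ) (ρ : Measure (Set.Ioi (0 : ℝ))) : Prop :=
  MeasurePreserving (fun p : Sph n × Set.Ioi (0 : ℝ) => p.2.1 • (p.1 : E n))
    ((sphereMeasure n).prod ρ) (stdGaussian (E n))

variable {ρ : Measure (Set.Ioi (0 : ℝ))}

theorem IsRadialLaw.lintegral_norm [NeZero n] [IsProbabilityMeasure ρ] (hρ : IsRadialLaw n ρ)
    {f : ℝ → ENNReal} (hf : Measurable f) :
    ∫⁻ r, f r.1 ∂ρ = ∫⁻ z, f ‖z‖ ∂(stdGaussian (E n)) := by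
  have hρ' : MeasurePreserving _ _ _ := hρ
  rw [← hρ'.lintegral_comp (f := fun z => f ‖z‖) (by fun_prop),
    ← (measurePreserving_snd (μ := sphereMeasure n) (ν := ρ)).lintegral_comp
      (f := fun r => f r.1) (by fun_prop)]
  refine lintegral_congr fun p => ?_
  rw [norm_smul, norm_eq_of_mem_sphere, Real.norm_of_nonneg p.2.2.le, mul_one]

/-- For R ≥ 0 one has |1 - R| ≤ |1 - R²|, so the radius fluctuates no more than the squared norm
does. -/
theorem IsRadialLaw.lintegral_one_sub_pow_four_le [NeZero n] [IsProbabilityMeasure ρ]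
    (hρ : IsRadialLaw n ρ) :
    ∫⁻ r, ENNReal.ofReal ((1 - r.1 / √(n : ℝ)) ^ 4) ∂ρ ≤ ENNReal.ofReal (24576 / n ^ 2) := by
  have hn : (1 : ℝ) ≤ n := by exact_mod_cast NeZero.one_le
  have hs : 1 ≤ √(n : ℝ) := Real.one_le_sqrt.2 hn
  have hs2 : √(n : ℝ) ^ 2 = n := Real.sq_sqrt (by positivity)
  rw [hρ.lintegral_norm (f := fun r => ENNReal.ofReal ((1 - r / √(n : ℝ)) ^ 4)) (by fun_prop)]
  have h : ∀ z : E n, ENNReal.ofReal ((1 - ‖z‖ / √(n : ℝ)) ^ 4) ≤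
      ENNReal.ofReal (1 / n ^ 2) * ENNReal.ofReal (((‖z‖ ^ 2 - n) / √(n : ℝ)) ^ 4) := by
    intro z
    rw [← ENNReal.ofReal_mul (by positivity)]
    refine ENNReal.ofReal_le_ofReal ?_
    set q := √(n : ℝ)
    set R := ‖z‖ / q with hR
    have hz : ‖z‖ = R * q := by rw [hR]; field_simp
    have hR0 : 0 ≤ R := by positivity
    have e : 1 / (n : ℝ) ^ 2 * ((‖z‖ ^ 2 - n) / q) ^ 4 = (1 - R) ^ 4 * (1 + R) ^ 4 := by
      rw [hz, ← hs2]
      field_simp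
      ring
    rw [e]
    exact le_mul_of_one_le_right (by positivity) (one_le_pow₀ (by linarith))
  refine (lintegral_mono h).trans ?_
  rw [lintegral_const_mul _ (by fun_prop)]
  calc _ ≤ ENNReal.ofReal (1 / n ^ 2) * 24576 := by
        gcongr; exact lintegral_standardized_sq_norm_pow_four_le
    _ = _ := by
        rw [← ENNReal.ofReal_ofNat 24576, ← ENNReal.ofReal_mul (by positivity)]
        ring_nf

/-- Chernoff bound with exponent -4: the result (e/9)^{n/2} is largest at n = 2. -/
theorem stdGaussian_norm_sq_lt_le (hn : 2 ≤ n) :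
    stdGaussian (E n) {z | ‖z‖ ^ 2 < n / 8} ≤ ENNReal.ofReal (1 / 3) := by
  have hn' : (1 : ℝ) ≤ n / 2 := by
    have : (2 : ℝ) ≤ n := by exact_mod_cast hn
    linarith
  have hsub : {z : E n | ‖z‖ ^ 2 < n / 8} ⊆
      {z | 1 ≤ ENNReal.ofReal (Real.exp (n / 2)) * ENNReal.ofReal (Real.exp (-4 * ‖z‖ ^ 2))} := by
    intro z hz
    simp only [Set.mem_ofPred_eq] at hz ⊢
    rw [← ENNReal.ofReal_mul (Real.exp_pos _).le, ← Real.exp_add, ← ENNReal.ofReal_one]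
    exact ENNReal.ofReal_le_ofReal (Real.one_le_exp (by linarith))
  refine (measure_mono hsub).trans ?_
  have h := mul_meas_ge_le_lintegral (μ := stdGaussian (E n))
    (f := fun z => ENNReal.ofReal (Real.exp (n / 2)) * ENNReal.ofReal (Real.exp (-4 * ‖z‖ ^ 2)))
    (by fun_prop) 1
  rw [one_mul] at h
  refine h.trans ?_
  rw [lintegral_const_mul _ (by fun_prop), lintegral_exp_mul_sq_norm_stdGaussian n (by norm_num),
    ← ENNReal.ofReal_mul (Real.exp_pos _).le]
  refine ENNReal.ofReal_le_ofReal ?_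
  have e1 : (1 - 2 * (-4) : ℝ) = 9 := by norm_num
  rw [e1, ← Real.exp_one_rpow, Real.rpow_neg (by norm_num), ← Real.inv_rpow (by norm_num),
    ← Real.mul_rpow (Real.exp_pos _).le (by norm_num)]
  have h3 := Real.exp_one_lt_d9
  calc _ ≤ (Real.exp 1 * 9⁻¹) ^ (1 : ℝ) :=
        Real.rpow_le_rpow_of_exponent_ge (by positivity) (by linarith) hn'
    _ ≤ 1 / 3 := by rw [Real.rpow_one]; linarith

/-- Chernoff bound with exponent 1/4: the result (2e⁻⁴)^{n/2} is largest at n = 2. -/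
theorem stdGaussian_lt_norm_sq_le (hn : 2 ≤ n) :
    stdGaussian (E n) {z | 8 * n < ‖z‖ ^ 2} ≤ ENNReal.ofReal (1 / 8) := by
  have hn' : (1 : ℝ) ≤ n / 2 := by
    have : (2 : ℝ) ≤ n := by exact_mod_cast hn
    linarith
  have hsub : {z : E n | 8 * n < ‖z‖ ^ 2} ⊆
      {z | 1 ≤ ENNReal.ofReal (Real.exp (-4 * (n / 2))) *
        ENNReal.ofReal (Real.exp (1 / 4 * ‖z‖ ^ 2))} := by
    intro z hz
    simp only [Set.mem_ofPred_eq] at hz ⊢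
    rw [← ENNReal.ofReal_mul (Real.exp_pos _).le, ← Real.exp_add, ← ENNReal.ofReal_one]
    exact ENNReal.ofReal_le_ofReal (Real.one_le_exp (by linarith))
  refine (measure_mono hsub).trans ?_
  have h := mul_meas_ge_le_lintegral (μ := stdGaussian (E n))
    (f := fun z => ENNReal.ofReal (Real.exp (-4 * (n / 2))) *
      ENNReal.ofReal (Real.exp (1 / 4 * ‖z‖ ^ 2))) (by fun_prop) 1
  rw [one_mul] at h
  refine h.trans ?_
  rw [lintegral_const_mul _ (by fun_prop), lintegral_exp_mul_sq_norm_stdGaussian n (by norm_num),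
    ← ENNReal.ofReal_mul (Real.exp_pos _).le]
  refine ENNReal.ofReal_le_ofReal ?_
  have e1 : (1 - 2 * (1 / 4) : ℝ) = 2⁻¹ := by norm_num
  rw [e1, Real.exp_mul, Real.rpow_neg (by norm_num), Real.inv_rpow (by norm_num), inv_inv,
    ← Real.mul_rpow (Real.exp_pos _).le (by norm_num)]
  have h4 : Real.exp (-4) * 2 ≤ 1 / 8 := by
    have h1 : Real.exp 4 = Real.exp 1 ^ 4 := by rw [← Real.exp_nat_mul]; norm_num
    have h2 := Real.exp_one_gt_d9
    have h3 : (2 : ℝ) ^ 4 ≤ Real.exp 1 ^ 4 := by gcongr; linarith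
    rw [Real.exp_neg, h1, ← div_eq_inv_mul, div_le_div_iff₀ (by positivity) (by norm_num)]
    linarith
  calc _ ≤ (Real.exp (-4) * 2) ^ (1 : ℝ) :=
        Real.rpow_le_rpow_of_exponent_ge (by positivity) (by linarith) hn'
    _ ≤ 1 / 8 := by rwa [Real.rpow_one]

/-- The two tails total at most 1/3 + 1/8 < 1/2. A radius comparable to √n with fixed probability is
enough to bound spherical integrals of nonnegative functions by Gaussian ones. -/
theorem IsRadialLaw.one_half_le [NeZero n] [IsProbabilityMeasure ρ] (hρ : IsRadialLaw n ρ)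
    (hn : 2 ≤ n) :
    1 / 2 ≤ ρ {r | (n : ℝ) / 8 ≤ r.1 ^ 2 ∧ r.1 ^ 2 ≤ 8 * n} := by
  have hm1 : MeasurableSet {r : ℝ | r ^ 2 < (n : ℝ) / 8} :=
    measurableSet_lt (by fun_prop) (by fun_prop)
  have hm2 : MeasurableSet {r : ℝ | 8 * (n : ℝ) < r ^ 2} :=
    measurableSet_lt (by fun_prop) (by fun_prop)
  have tr : ∀ s : Set ℝ, MeasurableSet s →
      ρ (Subtype.val ⁻¹' s) = stdGaussian (E n) (norm ⁻¹' s) := by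
    intro s hs
    rw [← lintegral_indicator_one (measurable_subtype_coe hs),
      ← lintegral_indicator_one (measurable_norm hs)]
    exact hρ.lintegral_norm (measurable_one.indicator hs)
  have h1 := (tr _ hm1).trans_le (stdGaussian_norm_sq_lt_le hn)
  have h2 := (tr _ hm2).trans_le (stdGaussian_lt_norm_sq_le hn)
  set A := {r : Set.Ioi (0 : ℝ) | (n : ℝ) / 8 ≤ r.1 ^ 2 ∧ r.1 ^ 2 ≤ 8 * n}
  have hcov : (Set.univ : Set (Set.Ioi (0 : ℝ))) ⊆ A ∪ (Subtype.val ⁻¹' {r : ℝ | r ^ 2 < (n : ℝ) / 8} ∪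
      Subtype.val ⁻¹' {r : ℝ | 8 * (n : ℝ) < r ^ 2}) := by
    intro r _
    by_cases h1 : r.1 ^ 2 < (n : ℝ) / 8
    · exact Or.inr (Or.inl h1)
    · by_cases h2 : 8 * (n : ℝ) < r.1 ^ 2
      · exact Or.inr (Or.inr h2)
      · exact Or.inl ⟨not_lt.1 h1, not_lt.1 h2⟩
  have h3 : 1 ≤ ρ A + ENNReal.ofReal (1 / 2) := by
    calc (1 : ENNReal) = ρ Set.univ := measure_univ.symm
      _ ≤ ρ A + (ENNReal.ofReal (1 / 3) + ENNReal.ofReal (1 / 8)) :=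
          (measure_mono hcov).trans ((measure_union_le _ _).trans
            (add_le_add le_rfl ((measure_union_le _ _).trans (add_le_add h1 h2))))
      _ ≤ _ := by
          rw [← ENNReal.ofReal_add (by norm_num) (by norm_num)]
          gcongr
          norm_num
  have h4 : ENNReal.ofReal (1 / 2) = 1 / 2 := by
    rw [ENNReal.ofReal_div_of_pos (by norm_num)]; simp
  rw [h4] at h3
  have := tsub_le_iff_right.2 h3
  simpa using this

/-- Spherical concentration in fourth mean for the characteristic function of an isotropic law. -/
theorem IsotropicLaw.lintegral_charFun_sub_sphere_le [NeZero n] [IsProbabilityMeasure μ]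
    (h : IsotropicLaw μ) (t : ℝ) :
    ∫⁻ q : Sph n × Sph n, ‖charFun μ (t • (q.1 : E n)) - charFun μ (t • (q.2 : E n))‖ₑ ^ 4
      ∂((sphereMeasure n).prod (sphereMeasure n)) ≤ ENNReal.ofReal (1500000 * t ^ 4 / n ^ 2) := by
  obtain ⟨ρ, hρp, hρ⟩ := exists_polar_stdGaussian n
  have hn : (1 : ℝ) ≤ n := by exact_mod_cast NeZero.one_le
  have hs2 : √(n : ℝ) ^ 2 = n := Real.sq_sqrt (by positivity)
  have hs0 : 0 < √(n : ℝ) := Real.sqrt_pos.2 (by linarith)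
  set q := √(n : ℝ) with hq
  set σ := sphereMeasure n
  set γ := stdGaussian (E n)
  set PP := (σ.prod ρ).prod (σ.prod ρ)
  let pol : Sph n × Set.Ioi (0 : ℝ) → E n := fun p => p.2.1 • (p.1 : E n)
  have mpS : MeasurePreserving (Prod.map Prod.fst Prod.fst) PP (σ.prod σ) :=
    measurePreserving_fst.prod measurePreserving_fst
  have mpG : MeasurePreserving (Prod.map pol pol) PP (γ.prod γ) := hρ.prod hρ
  have mpR1 : MeasurePreserving (fun w : (Sph n × Set.Ioi (0 : ℝ)) × (Sph n × Set.Ioi (0 : ℝ)) =>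
      w.1.2) PP ρ := measurePreserving_snd.comp measurePreserving_fst
  have mpR2 : MeasurePreserving (fun w : (Sph n × Set.Ioi (0 : ℝ)) × (Sph n × Set.Ioi (0 : ℝ)) =>
      w.2.2) PP ρ := measurePreserving_snd.comp measurePreserving_snd
  have hφ : Measurable (charFun μ) := measurable_charFun
  rw [← mpS.lintegral_comp (by fun_prop)]
  let A : Set.Ioi (0 : ℝ) → ENNReal := fun r => ENNReal.ofReal ((1 - r.1 / q) ^ 4)
  let G : E n × E n → ENNReal := fun p => ‖charFun μ ((t / q) • p.1) - charFun μ ((t / q) • p.2)‖ₑ ^ 4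
  have hA : Measurable A := by unfold A; fun_prop
  have hG : Measurable G := by unfold G; fun_prop
  -- Replacing tθ by the Gaussian vector rθ scaled by t/√n costs at most |t||1 - r/√n|, since the
  -- characteristic function is 1-Lipschitz.
  have one : ∀ p : Sph n × Set.Ioi (0 : ℝ),
      ‖charFun μ (t • (p.1 : E n)) - charFun μ ((t / q) • pol p)‖ ≤ |t| * |1 - p.2.1 / q| := by
    intro p
    refine (h.norm_charFun_sub_le _ _).trans ?_
    have e : t • (p.1 : E n) - (t / q) • pol p = (t * (1 - p.2.1 / q)) • (p.1 : E n) := by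
      simp only [pol, smul_smul, ← sub_smul]
      congr 1; field_simp
    rw [e, norm_smul, norm_eq_of_mem_sphere, mul_one, Real.norm_eq_abs, abs_mul]
  have hpt : ∀ w : (Sph n × Set.Ioi (0 : ℝ)) × (Sph n × Set.Ioi (0 : ℝ)),
      ‖charFun μ (t • ((Prod.map Prod.fst Prod.fst w : Sph n × Sph n).1 : E n))
        - charFun μ (t • ((Prod.map Prod.fst Prod.fst w : Sph n × Sph n).2 : E n))‖ₑ ^ 4
      ≤ 27 * (ENNReal.ofReal (t ^ 4) * A w.1.2 + G (Prod.map pol pol w)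
        + ENNReal.ofReal (t ^ 4) * A w.2.2) := by
    intro w
    simp only [Prod.map_fst, Prod.map_snd, A, G]
    have ha := one w.1
    have hb := one w.2
    set x := charFun μ (t • (w.1.1 : E n))
    set y := charFun μ (t • (w.2.1 : E n))
    set x' := charFun μ ((t / q) • pol w.1)
    set y' := charFun μ ((t / q) • pol w.2)
    rw [← ofReal_norm, ← ofReal_norm, ← ENNReal.ofReal_pow (norm_nonneg _),
      ← ENNReal.ofReal_pow (norm_nonneg _), ← ENNReal.ofReal_mul (by positivity),
      ← ENNReal.ofReal_mul (by positivity), ← ENNReal.ofReal_add (by positivity) (by positivity),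
      ← ENNReal.ofReal_add (by positivity) (by positivity), ← ENNReal.ofReal_ofNat 27,
      ← ENNReal.ofReal_mul (by positivity)]
    refine ENNReal.ofReal_le_ofReal ?_
    have htri : ‖x - y‖ ≤ |t| * |1 - w.1.2.1 / q| + ‖x' - y'‖ + |t| * |1 - w.2.2.1 / q| := by
      have e : x - y = (x - x') + (x' - y') + -(y - y') := by ring
      rw [e]
      refine (norm_add_le _ _).trans ?_
      rw [norm_neg]
      gcongr
      exact (norm_add_le _ _).trans (by gcongr)
    have c4 : ∀ a b c : ℝ, (a + b + c) ^ 4 ≤ 27 * (a ^ 4 + b ^ 4 + c ^ 4) := by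
      intro a b c
      have s1 : (a + b + c) ^ 2 ≤ 3 * (a ^ 2 + b ^ 2 + c ^ 2) := by
        nlinarith [sq_nonneg (a - b), sq_nonneg (a - c), sq_nonneg (b - c)]
      have s2 : (a ^ 2 + b ^ 2 + c ^ 2) ^ 2 ≤ 3 * (a ^ 4 + b ^ 4 + c ^ 4) := by
        nlinarith [sq_nonneg (a ^ 2 - b ^ 2), sq_nonneg (a ^ 2 - c ^ 2), sq_nonneg (b ^ 2 - c ^ 2)]
      calc (a + b + c) ^ 4 = ((a + b + c) ^ 2) ^ 2 := by ring
        _ ≤ (3 * (a ^ 2 + b ^ 2 + c ^ 2)) ^ 2 := by gcongr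
        _ ≤ _ := by nlinarith
    have ev : ∀ y : ℝ, |y| ^ 4 = y ^ 4 := fun y => Even.pow_abs (by decide) y
    calc ‖x - y‖ ^ 4 ≤ (|t| * |1 - w.1.2.1 / q| + ‖x' - y'‖ + |t| * |1 - w.2.2.1 / q|) ^ 4 := by
          gcongr
      _ ≤ _ := c4 _ _ _
      _ = _ := by simp only [mul_pow, ev]
  refine (lintegral_mono hpt).trans ?_
  have hm1 : Measurable fun w : (Sph n × Set.Ioi (0 : ℝ)) × (Sph n × Set.Ioi (0 : ℝ)) =>
      ENNReal.ofReal (t ^ 4) * A w.1.2 := by fun_prop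
  have hm2 : Measurable fun w : (Sph n × Set.Ioi (0 : ℝ)) × (Sph n × Set.Ioi (0 : ℝ)) =>
      G (Prod.map pol pol w) := hG.comp mpG.measurable
  have hm3 : Measurable fun w : (Sph n × Set.Ioi (0 : ℝ)) × (Sph n × Set.Ioi (0 : ℝ)) =>
      A w.1.2 := by fun_prop
  have hm4 : Measurable fun w : (Sph n × Set.Ioi (0 : ℝ)) × (Sph n × Set.Ioi (0 : ℝ)) =>
      A w.2.2 := by fun_prop
  rw [lintegral_const_mul' _ _ (by simp), lintegral_add_left (by exact hm1.add hm2),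
    lintegral_add_left hm1, lintegral_const_mul _ hm3, lintegral_const_mul _ hm4,
    mpR1.lintegral_comp hA, mpR2.lintegral_comp hA, mpG.lintegral_comp hG]
  have bA : ∫⁻ r, A r ∂ρ ≤ ENNReal.ofReal (24576 / n ^ 2) :=
    IsRadialLaw.lintegral_one_sub_pow_four_le hρ
  have bG := h.lintegral_charFun_sub_stdGaussian_le (t / q)
  calc _ ≤ 27 * (ENNReal.ofReal (t ^ 4) * ENNReal.ofReal (24576 / n ^ 2)
        + ENNReal.ofReal (6144 * (t / q) ^ 4)
        + ENNReal.ofReal (t ^ 4) * ENNReal.ofReal (24576 / n ^ 2)) := by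
        gcongr
    _ ≤ _ := by
        rw [← ENNReal.ofReal_mul (by positivity), ← ENNReal.ofReal_add (by positivity)
          (by positivity), ← ENNReal.ofReal_add (by positivity) (by positivity),
          ← ENNReal.ofReal_ofNat 27, ← ENNReal.ofReal_mul (by positivity)]
        refine ENNReal.ofReal_le_ofReal ?_
        have e : (t / q) ^ 4 = t ^ 4 / n ^ 2 := by rw [div_pow, ← hs2]; ring
        rw [e]
        have : 0 ≤ t ^ 4 / (n : ℝ) ^ 2 := by positivity
        calc _ = 1492992 * (t ^ 4 / (n : ℝ) ^ 2) := by ring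
          _ ≤ 1500000 * (t ^ 4 / (n : ℝ) ^ 2) := by gcongr; norm_num
          _ = _ := by ring

end RandomizedCLT

/-! ### Small ball estimate for a signed sum of four independent copies. -/

namespace RandomizedCLT

section GramBound
variable {α : Type*} [MeasurableSpace α] {μ : Measure α} [IsProbabilityMeasure μ]
  {v q : α → ENNReal} {e : α → α → ENNReal}

theorem lintegral_rotate {F : α → α → α → ENNReal}
    (hF : Measurable fun p : α × α × α => F p.1 p.2.1 p.2.2) :
    ∫⁻ b, ∫⁻ c, ∫⁻ d, F c d b ∂μ ∂μ ∂μ = ∫⁻ b, ∫⁻ c, ∫⁻ d, F b c d ∂μ ∂μ ∂μ := by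
  rw [lintegral_lintegral_swap]
  · refine lintegral_congr fun c => ?_
    rw [lintegral_lintegral_swap]
    exact (hF.comp (f := fun p : α × α => (c, p.2, p.1)) (by fun_prop)).aemeasurable
  · have : Measurable fun w : (α × α) × α => F w.1.2 w.2 w.1.1 :=
      hF.comp (f := fun w : (α × α) × α => (w.1.2, w.2, w.1.1)) (by fun_prop)
    exact this.lintegral_prod_right'.aemeasurable

/-- Only e(b, a) shares a point with v(a), and it gives the mixed integral of v q; the other terms
factor by independence. -/
theorem lintegral_vertex_term (hv : Measurable v) (he : Measurable fun p : α × α => e p.1 p.2)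
    (hq : Measurable q) (hint : ∀ x, ∫⁻ y, e x y ∂μ = q x) (hsymm : ∀ x y, e x y = e y x) :
    ∫⁻ a, ∫⁻ b, ∫⁻ c, ∫⁻ d, v a * (v b + e b a + e b c + e b d) ∂μ ∂μ ∂μ ∂μ =
      (∫⁻ x, v x ∂μ) ^ 2 + ∫⁻ x, v x * q x ∂μ + 2 * (∫⁻ x, q x ∂μ) * ∫⁻ x, v x ∂μ := by
  have hx : ∀ x, Measurable (e x) := fun x => he.comp (measurable_const.prodMk measurable_id)
  have hx' : ∀ x, Measurable fun y => e y x := fun x => he.comp (measurable_id.prodMk measurable_const)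
  have h1 : ∀ a b c, ∫⁻ d, v a * (v b + e b a + e b c + e b d) ∂μ
      = v a * (v b + e b a + e b c + q b) := by
    intro a b c
    rw [lintegral_const_mul _ (by fun_prop), lintegral_add_left (by fun_prop), hint]
    simp
  have h2 : ∀ a b, ∫⁻ c, v a * (v b + e b a + e b c + q b) ∂μ = v a * (v b + e b a + 2 * q b) := by
    intro a b
    rw [lintegral_const_mul _ (by fun_prop), lintegral_add_right _ (by fun_prop),
      lintegral_add_left (by fun_prop), hint]
    simp
    ring
  have h3 : ∀ a, ∫⁻ b, v a * (v b + e b a + 2 * q b) ∂μ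
      = v a * (∫⁻ x, v x ∂μ + 2 * ∫⁻ x, q x ∂μ) + v a * q a := by
    intro a
    rw [lintegral_const_mul _ (by fun_prop), lintegral_add_right _ (by fun_prop),
      lintegral_add_left (by fun_prop), lintegral_const_mul _ hq]
    simp_rw [hsymm _ a]
    rw [hint]
    ring
  simp_rw [h1, h2, h3]
  rw [lintegral_add_right _ (by fun_prop), lintegral_mul_const _ hv]
  ring

/-- Two edges with a common point integrate to the integral of q², while the disjoint edge {c, d}
and the vertex c contribute products. -/
theorem lintegral_edge_term (hv : Measurable v) (he : Measurable fun p : α × α => e p.1 p.2)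
    (hq : Measurable q) (hint : ∀ x, ∫⁻ y, e x y ∂μ = q x) (hsymm : ∀ x y, e x y = e y x) :
    ∫⁻ a, ∫⁻ b, ∫⁻ c, ∫⁻ d, e a b * (v c + e c a + e c b + e c d) ∂μ ∂μ ∂μ ∂μ =
      (∫⁻ x, q x ∂μ) * ∫⁻ x, v x ∂μ + 2 * ∫⁻ x, q x ^ 2 ∂μ + (∫⁻ x, q x ∂μ) ^ 2 := by
  have hx : ∀ x, Measurable (e x) := fun x => he.comp (measurable_const.prodMk measurable_id)
  have hx' : ∀ x, Measurable fun y => e y x := fun x => he.comp (measurable_id.prodMk measurable_const)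
  have h1 : ∀ a b c, ∫⁻ d, e a b * (v c + e c a + e c b + e c d) ∂μ
      = e a b * (v c + e c a + e c b + q c) := by
    intro a b c
    rw [lintegral_const_mul _ (by fun_prop), lintegral_add_left (by fun_prop), hint]
    simp
  have h2 : ∀ a b, ∫⁻ c, e a b * (v c + e c a + e c b + q c) ∂μ
      = e a b * (∫⁻ x, v x ∂μ + ∫⁻ x, q x ∂μ + q a) + e a b * q b := by
    intro a b
    rw [lintegral_const_mul _ (by fun_prop), lintegral_add_right _ (by fun_prop),
      lintegral_add_right _ (by fun_prop), lintegral_add_right _ (by fun_prop)]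
    simp_rw [hsymm _ a, hsymm _ b]
    rw [hint, hint, hsymm b a]
    ring
  have h3 : ∀ a, ∫⁻ b, (e a b * (∫⁻ x, v x ∂μ + ∫⁻ x, q x ∂μ + q a) + e a b * q b) ∂μ
      = q a * (∫⁻ x, v x ∂μ + ∫⁻ x, q x ∂μ) + q a ^ 2 + ∫⁻ b, e a b * q b ∂μ := by
    intro a
    rw [lintegral_add_left (by fun_prop), lintegral_mul_const _ (by fun_prop), hint]
    ring
  have h4 : ∫⁻ a, ∫⁻ b, e a b * q b ∂μ ∂μ = ∫⁻ x, q x ^ 2 ∂μ := by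
    rw [lintegral_lintegral_swap (by exact (he.mul (hq.comp measurable_snd)).aemeasurable)]
    refine lintegral_congr fun b => ?_
    rw [lintegral_mul_const _ (by fun_prop)]
    simp_rw [hsymm _ b]
    rw [hint, sq]
  simp_rw [h1, h2, h3]
  rw [lintegral_add_left (by fun_prop), lintegral_add_left (by fun_prop), lintegral_mul_const _ hq,
    h4]
  ring

/-- If among four independent points every point is either exceptional (`v`) or interacts (`e`) with
another one, then at least two independent exceptional events occur. -/
theorem lintegral_four_le (hv : Measurable v) (he : Measurable fun p : α × α => e p.1 p.2)
    (hq : Measurable q) (hint : ∀ x, ∫⁻ y, e x y ∂μ = q x) (hsymm : ∀ x y, e x y = e y x)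
    {f : α → α → α → α → ENNReal} (hf1 : ∀ a b c d, f a b c d ≤ 1)
    (ha : ∀ a b c d, f a b c d ≠ 0 → 1 ≤ v a + e a b + e a c + e a d)
    (hb : ∀ a b c d, f a b c d ≠ 0 → 1 ≤ v b + e b a + e b c + e b d)
    (hc : ∀ a b c d, f a b c d ≠ 0 → 1 ≤ v c + e c a + e c b + e c d)
    (hd : ∀ a b c d, f a b c d ≠ 0 → 1 ≤ v d + e d a + e d b + e d c) :
    ∫⁻ a, ∫⁻ b, ∫⁻ c, ∫⁻ d, f a b c d ∂μ ∂μ ∂μ ∂μ ≤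
      (∫⁻ x, v x ∂μ) ^ 2 + ∫⁻ x, v x * q x ∂μ + 5 * ((∫⁻ x, q x ∂μ) * ∫⁻ x, v x ∂μ)
        + 6 * ∫⁻ x, q x ^ 2 ∂μ + 3 * (∫⁻ x, q x ∂μ) ^ 2 := by
  let T1 : α → α → α → α → ENNReal := fun a b c d => v a * (v b + e b a + e b c + e b d)
  let T2 : α → α → α → α → ENNReal := fun a b c d => e a b * (v c + e c a + e c b + e c d)
  have hem : ∀ {β : Type _} [MeasurableSpace β] {f g : β → α}, Measurable f → Measurable g →
      Measurable fun w => e (f w) (g w) := fun hf hg => he.comp (hf.prodMk hg)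
  -- The condition at `a` gives a first event. If it is v(a), the condition at `b` gives a second
  -- one; if it is an edge from `a`, the condition at a point off that edge does.
  have hpt : ∀ a b c d, f a b c d ≤ T1 a b c d + T2 a b c d + T2 a c d b + T2 a d b c := by
    intro a b c d
    by_cases h0 : f a b c d = 0
    · rw [h0]; exact zero_le
    have A := ha a b c d h0
    have B := hb a b c d h0
    have C := hc a b c d h0
    have D := hd a b c d h0
    refine (hf1 a b c d).trans (A.trans ?_)
    simp only [T1, T2]
    have D' : 1 ≤ v d + e d a + e d c + e d b := by rwa [add_right_comm] at D
    have B' : 1 ≤ v b + e b a + e b d + e b c := by rwa [add_right_comm] at B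
    gcongr
    · exact le_mul_of_one_le_right' B
    · exact le_mul_of_one_le_right' C
    · exact le_mul_of_one_le_right' D'
    · exact le_mul_of_one_le_right' B'
  have hT1 : Measurable fun p : α × α × α × α => T1 p.1 p.2.1 p.2.2.1 p.2.2.2 := by
    refine Measurable.mul (by fun_prop) (((Measurable.add (by fun_prop) ?_).add ?_).add ?_) <;>
    exact hem (by fun_prop) (by fun_prop)
  have hT2 : Measurable fun p : α × α × α × α => T2 p.1 p.2.1 p.2.2.1 p.2.2.2 := by
    refine Measurable.mul ?_ (((Measurable.add (by fun_prop) ?_).add ?_).add ?_) <;>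
    exact hem (by fun_prop) (by fun_prop)
  have r1 : ∀ a, ∫⁻ b, ∫⁻ c, ∫⁻ d, T2 a c d b ∂μ ∂μ ∂μ = ∫⁻ b, ∫⁻ c, ∫⁻ d, T2 a b c d ∂μ ∂μ ∂μ :=
    fun a => lintegral_rotate (F := T2 a)
      (hT2.comp (f := fun p : α × α × α => (a, p)) (by fun_prop))
  have r2 : ∀ a, ∫⁻ b, ∫⁻ c, ∫⁻ d, T2 a d b c ∂μ ∂μ ∂μ = ∫⁻ b, ∫⁻ c, ∫⁻ d, T2 a b c d ∂μ ∂μ ∂μ :=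
    fun a => (lintegral_rotate (F := fun b c d => T2 a d b c)
      (hT2.comp (f := fun p : α × α × α => (a, p.2.2, p.1, p.2.1)) (by fun_prop))).symm
  have split : ∀ {F G : α → α → α → α → ENNReal},
      (Measurable fun p : α × α × α × α => F p.1 p.2.1 p.2.2.1 p.2.2.2) →
      ∫⁻ a, ∫⁻ b, ∫⁻ c, ∫⁻ d, (F a b c d + G a b c d) ∂μ ∂μ ∂μ ∂μ =
      ∫⁻ a, ∫⁻ b, ∫⁻ c, ∫⁻ d, F a b c d ∂μ ∂μ ∂μ ∂μ +
        ∫⁻ a, ∫⁻ b, ∫⁻ c, ∫⁻ d, G a b c d ∂μ ∂μ ∂μ ∂μ := by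
    intro F G hF
    have m1 : Measurable fun p : α × α × α => ∫⁻ d, F p.1 p.2.1 p.2.2 d ∂μ :=
      Measurable.lintegral_prod_right' (f := fun w : (α × α × α) × α => F w.1.1 w.1.2.1 w.1.2.2 w.2)
        (hF.comp (f := fun w : (α × α × α) × α => (w.1.1, w.1.2.1, w.1.2.2, w.2)) (by fun_prop))
    have m2 : Measurable fun p : α × α => ∫⁻ c, ∫⁻ d, F p.1 p.2 c d ∂μ ∂μ :=
      Measurable.lintegral_prod_right' (f := fun w : (α × α) × α => ∫⁻ d, F w.1.1 w.1.2 w.2 d ∂μ)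
        (m1.comp (f := fun w : (α × α) × α => (w.1.1, w.1.2, w.2)) (by fun_prop))
    have m3 : Measurable fun a => ∫⁻ b, ∫⁻ c, ∫⁻ d, F a b c d ∂μ ∂μ ∂μ := m2.lintegral_prod_right'
    rw [← lintegral_add_left m3]
    refine lintegral_congr fun a => ?_
    rw [← lintegral_add_left (by exact m2.comp (measurable_const.prodMk measurable_id))]
    refine lintegral_congr fun b => ?_
    rw [← lintegral_add_left (by exact m1.comp (f := fun c => (a, b, c)) (by fun_prop))]
    refine lintegral_congr fun c => ?_
    rw [← lintegral_add_left (by exact hF.comp (f := fun d => (a, b, c, d)) (by fun_prop))]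
  have e1 : ∫⁻ a, ∫⁻ b, ∫⁻ c, ∫⁻ d, T1 a b c d ∂μ ∂μ ∂μ ∂μ = _ :=
    lintegral_vertex_term hv he hq hint hsymm
  have e2 : ∫⁻ a, ∫⁻ b, ∫⁻ c, ∫⁻ d, T2 a b c d ∂μ ∂μ ∂μ ∂μ = _ :=
    lintegral_edge_term hv he hq hint hsymm
  have m3 : Measurable fun p : α × α × α × α => T2 p.1 p.2.2.1 p.2.2.2 p.2.1 :=
    hT2.comp (f := fun p : α × α × α × α => (p.1, p.2.2.1, p.2.2.2, p.2.1)) (by fun_prop)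
  calc _ ≤ ∫⁻ a, ∫⁻ b, ∫⁻ c, ∫⁻ d, (T1 a b c d + T2 a b c d + T2 a c d b + T2 a d b c)
        ∂μ ∂μ ∂μ ∂μ := by gcongr; exact hpt _ _ _ _
    _ = _ := by
        rw [split (by exact (hT1.add hT2).add m3), split (by exact hT1.add hT2), split hT1]
        simp_rw [r1, r2]
        rw [e1, e2]
        ring

end GramBound

variable {n : ℕ} {μ : Measure (E n)}

/-- If a signed sum of four vectors is short, then each of them is either short or has a large scalar
product with another one. -/
theorem one_le_of_norm_sum_sq_le [NeZero n] {a b c d : E n} (h : ‖a + b + c + d‖ ^ 2 ≤ n / 8) :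
    (1 : ENNReal) ≤ {x : E n | ‖x‖ ^ 2 ≤ n / 2}.indicator 1 a
      + ENNReal.ofReal (144 / n ^ 2 * inner ℝ a b ^ 2)
      + ENNReal.ofReal (144 / n ^ 2 * inner ℝ a c ^ 2)
      + ENNReal.ofReal (144 / n ^ 2 * inner ℝ a d ^ 2) := by
  have hn : (1 : ℝ) ≤ n := by exact_mod_cast NeZero.one_le
  by_cases hv : ‖a‖ ^ 2 ≤ n / 2
  · rw [Set.indicator_of_mem (show a ∈ {x : E n | ‖x‖ ^ 2 ≤ n / 2} from hv)]
    simp only [Pi.one_apply, add_assoc]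
    exact le_self_add
  rw [Set.indicator_of_notMem (show a ∉ {x : E n | ‖x‖ ^ 2 ≤ n / 2} from hv), zero_add]
  push Not at hv
  have h1 : inner ℝ a (a + b + c + d) = ‖a‖ ^ 2 + inner ℝ a b + inner ℝ a c + inner ℝ a d := by
    simp only [inner_add_right, real_inner_self_eq_norm_sq]
  -- If |a|² > n/2, then with `h1` the three scalar products sum to less than n/8 - 3n/8 = -n/4. One
  -- of them is therefore at most -n/12, and 144/n² normalizes its square to at least 1.
  have h2 : inner ℝ a (a + b + c + d) ≤ ‖a‖ ^ 2 / 4 + n / 8 := by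
    have := real_inner_le_norm a (a + b + c + d)
    nlinarith [sq_nonneg (‖a‖ / 2 - ‖a + b + c + d‖)]
  have key : ∀ y : ℝ, (n : ℝ) / 12 ≤ -y → 1 ≤ ENNReal.ofReal (144 / n ^ 2 * y ^ 2) := by
    intro y hy
    rw [← ENNReal.ofReal_one]
    refine ENNReal.ofReal_le_ofReal ?_
    rw [div_mul_eq_mul_div, le_div_iff₀ (by positivity)]
    nlinarith
  by_cases hb : (n : ℝ) / 12 ≤ -inner ℝ a b
  · rw [add_assoc]; exact (key _ hb).trans le_self_add
  by_cases hc : (n : ℝ) / 12 ≤ -inner ℝ a c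
  · exact ((key _ hc).trans le_add_self).trans le_self_add
  by_cases hd : (n : ℝ) / 12 ≤ -inner ℝ a d
  · exact (key _ hd).trans le_add_self
  · exfalso; linarith

/-- Small ball estimate for a signed sum of four independent isotropic vectors. -/
theorem IsotropicLaw.lintegral_small_ball_le [NeZero n] [IsProbabilityMeasure μ]
    (h : IsotropicLaw μ) {s : ℝ} (hs : 0 ≤ s)
    (hvar : ∫⁻ x, ENNReal.ofReal ((‖x‖ ^ 2 - n) ^ 2) ∂μ ≤ ENNReal.ofReal (n * s)) :
    ∫⁻ a, ∫⁻ b, ∫⁻ c, ∫⁻ d, {x : E n | ‖x‖ ^ 2 ≤ n / 8}.indicator 1 (a + b - c - d)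
      ∂μ ∂μ ∂μ ∂μ ≤ ENNReal.ofReal (320000 * (1 + s) ^ 2 / n ^ 2) := by
  have hn : (1 : ℝ) ≤ n := by exact_mod_cast NeZero.one_le
  set v : E n → ENNReal := {x : E n | ‖x‖ ^ 2 ≤ n / 2}.indicator 1 with hvdef
  set e : E n → E n → ENNReal := fun x y => ENNReal.ofReal (144 / n ^ 2 * inner ℝ x y ^ 2) with hedef
  set q : E n → ENNReal := fun x => ENNReal.ofReal (144 / n ^ 2 * ‖x‖ ^ 2) with hqdef
  have hvm : Measurable v :=
    measurable_one.indicator (measurableSet_le (by fun_prop) (by fun_prop))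
  have hvneg : ∀ x, v (-x) = v x := fun x => by simp [hvdef, Set.indicator_apply]
  have heneg : ∀ x y, e (-x) y = e x y := fun x y => by simp [hedef]
  have heneg' : ∀ x y, e x (-y) = e x y := fun x y => by simp [hedef]
  have hqm : Measurable q := by unfold q; fun_prop
  have hint : ∀ x, ∫⁻ y, e x y ∂μ = q x := by
    intro x
    have : ∀ y, e x y = ENNReal.ofReal (144 / n ^ 2) * ENNReal.ofReal (inner ℝ y x ^ 2) := fun y => by
      rw [← ENNReal.ofReal_mul (by positivity), real_inner_comm]
    simp_rw [this]
    rw [lintegral_const_mul _ (by fun_prop), h.lintegral_inner_sq, ← ENNReal.ofReal_mul (by positivity)]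
  refine (lintegral_four_le hvm (q := q) (e := e) (by unfold e; fun_prop) hqm hint
    (fun x y => by simp only [hedef, real_inner_comm]) ?_ ?_ ?_ ?_ ?_).trans ?_
  · intro a b c d
    by_cases hm : a + b - c - d ∈ {x : E n | ‖x‖ ^ 2 ≤ n / 8} <;> simp [hm]
  · intro a b c d h0
    have hm : ‖a + b - c - d‖ ^ 2 ≤ n / 8 := Set.mem_of_indicator_ne_zero
      (s := {x : E n | ‖x‖ ^ 2 ≤ n / 8}) h0
    have := one_le_of_norm_sum_sq_le (a := a) (b := b) (c := -c) (d := -d)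
      (by simpa only [sub_eq_add_neg] using hm)
    change 1 ≤ v a + e a b + e a (-c) + e a (-d) at this
    simpa only [heneg, heneg', hvneg] using this
  · intro a b c d h0
    have hm : ‖a + b - c - d‖ ^ 2 ≤ n / 8 := Set.mem_of_indicator_ne_zero
      (s := {x : E n | ‖x‖ ^ 2 ≤ n / 8}) h0
    have := one_le_of_norm_sum_sq_le (a := b) (b := a) (c := -c) (d := -d)
      (by simpa only [sub_eq_add_neg, add_comm b a] using hm)
    change 1 ≤ v b + e b a + e b (-c) + e b (-d) at this
    simpa only [heneg, heneg', hvneg] using this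
  · intro a b c d h0
    have hm : ‖a + b - c - d‖ ^ 2 ≤ n / 8 := Set.mem_of_indicator_ne_zero
      (s := {x : E n | ‖x‖ ^ 2 ≤ n / 8}) h0
    have := one_le_of_norm_sum_sq_le (a := -c) (b := a) (c := b) (d := -d)
      (by convert! hm using 3; abel)
    change 1 ≤ v (-c) + e (-c) a + e (-c) b + e (-c) (-d) at this
    simpa only [heneg, heneg', hvneg] using this
  · intro a b c d h0
    have hm : ‖a + b - c - d‖ ^ 2 ≤ n / 8 := Set.mem_of_indicator_ne_zero
      (s := {x : E n | ‖x‖ ^ 2 ≤ n / 8}) h0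
    have := one_le_of_norm_sum_sq_le (a := -d) (b := a) (c := b) (d := -c)
      (by convert! hm using 3; abel)
    change 1 ≤ v (-d) + e (-d) a + e (-d) b + e (-d) (-c) at this
    simpa only [heneg, heneg', hvneg] using this
  -- Chebyshev: a short vector has (|x|² - n)² ≥ n²/4.
  have bV : ∫⁻ x, v x ∂μ ≤ ENNReal.ofReal (4 * s / n) := by
    have hp : ∀ x, v x ≤ ENNReal.ofReal (4 / n ^ 2) * ENNReal.ofReal ((‖x‖ ^ 2 - n) ^ 2) := by
      intro x
      by_cases hx : ‖x‖ ^ 2 ≤ n / 2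
      · rw [hvdef, Set.indicator_of_mem (show x ∈ {x : E n | ‖x‖ ^ 2 ≤ n / 2} from hx),
          ← ENNReal.ofReal_mul (by positivity), Pi.one_apply, ← ENNReal.ofReal_one]
        refine ENNReal.ofReal_le_ofReal ?_
        rw [div_mul_eq_mul_div, le_div_iff₀ (by positivity)]
        nlinarith
      · rw [hvdef, Set.indicator_of_notMem (show x ∉ {x : E n | ‖x‖ ^ 2 ≤ n / 2} from hx)]
        exact zero_le
    refine (lintegral_mono hp).trans ?_
    rw [lintegral_const_mul _ (by fun_prop)]
    refine (mul_le_mul_right hvar _).trans (le_of_eq ?_)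
    rw [← ENNReal.ofReal_mul (by positivity)]
    congr 1
    field_simp
  have bN : ∫⁻ x, q x ∂μ = ENNReal.ofReal (144 / n) := by
    have : ∀ x : E n, q x = ∑ i : Fin n, ENNReal.ofReal (144 / n ^ 2) *
        ENNReal.ofReal (inner ℝ x (EuclideanSpace.single i (1 : ℝ)) ^ 2) := by
      intro x
      rw [← Finset.mul_sum, ← ENNReal.ofReal_sum_of_nonneg fun i _ => sq_nonneg _,
        ← ENNReal.ofReal_mul (by positivity), hqdef]
      simp only
      rw [EuclideanSpace.norm_sq_eq]
      simp [EuclideanSpace.inner_single_right]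
    simp_rw [this]
    rw [lintegral_finsetSum _ (fun i _ => by fun_prop)]
    simp_rw [lintegral_const_mul' _ _ ENNReal.ofReal_ne_top, h.lintegral_inner_sq]
    simp only [PiLp.norm_single, norm_one, one_pow, ENNReal.ofReal_one, mul_one,
      Finset.sum_const, Finset.card_univ, Fintype.card_fin, nsmul_eq_mul]
    rw [← ENNReal.ofReal_natCast, ← ENNReal.ofReal_mul (by positivity)]
    congr 1
    field_simp
  -- The factors are dependent, but q ≤ 72/n wherever v is nonzero, so the order n⁻² survives.
  have bW : ∫⁻ x, v x * q x ∂μ ≤ ENNReal.ofReal (288 * s / n ^ 2) := by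
    have hp : ∀ x, v x * q x ≤ v x * ENNReal.ofReal (72 / n) := by
      intro x
      by_cases hx : ‖x‖ ^ 2 ≤ n / 2
      · gcongr
        refine ENNReal.ofReal_le_ofReal ?_
        calc 144 / (n : ℝ) ^ 2 * ‖x‖ ^ 2 ≤ 144 / (n : ℝ) ^ 2 * ((n : ℝ) / 2) := by gcongr
          _ = 72 / (n : ℝ) := by field_simp; norm_num
      · rw [hvdef, Set.indicator_of_notMem (show x ∉ {x : E n | ‖x‖ ^ 2 ≤ n / 2} from hx)]
        simp
    refine (lintegral_mono hp).trans ?_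
    rw [lintegral_mul_const _ hvm]
    refine (mul_le_mul_left bV _).trans (le_of_eq ?_)
    rw [← ENNReal.ofReal_mul (by positivity)]
    congr 1
    field_simp; ring
  -- Uses |x|⁴ ≤ 2(|x|² - n)² + 2n², with 41472 = 2 · 144².
  have bQ : ∫⁻ x, q x ^ 2 ∂μ ≤ ENNReal.ofReal (41472 * (1 + s) / n ^ 2) := by
    have hp : ∀ x, q x ^ 2 ≤ ENNReal.ofReal (41472 / n ^ 4) * (ENNReal.ofReal ((‖x‖ ^ 2 - n) ^ 2)
        + ENNReal.ofReal (n ^ 2)) := by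
      intro x
      rw [hqdef]
      simp only
      rw [← ENNReal.ofReal_pow (by positivity), ← ENNReal.ofReal_add (by positivity) (by positivity),
        ← ENNReal.ofReal_mul (by positivity)]
      refine ENNReal.ofReal_le_ofReal ?_
      rw [mul_pow, div_pow, div_mul_eq_mul_div, div_mul_eq_mul_div,
        show ((n : ℝ) ^ 2) ^ 2 = (n : ℝ) ^ 4 by ring]
      refine div_le_div_of_nonneg_right ?_ (by positivity)
      nlinarith [sq_nonneg (‖x‖ ^ 2 - 2 * n)]
    refine (lintegral_mono hp).trans ?_
    rw [lintegral_const_mul _ (by fun_prop), lintegral_add_right _ (by fun_prop), lintegral_const,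
      measure_univ, mul_one]
    calc _ ≤ ENNReal.ofReal (41472 / n ^ 4) * (ENNReal.ofReal (n * s) + ENNReal.ofReal (n ^ 2)) := by
          gcongr
      _ ≤ _ := by
          rw [← ENNReal.ofReal_add (by positivity) (by positivity), ← ENNReal.ofReal_mul (by positivity)]
          refine ENNReal.ofReal_le_ofReal ?_
          have : n * s + (n : ℝ) ^ 2 ≤ n ^ 2 * (1 + s) := by nlinarith [mul_nonneg hs (sub_nonneg.2 hn)]
          calc _ ≤ 41472 / (n : ℝ) ^ 4 * (n ^ 2 * (1 + s)) := by gcongr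
            _ = _ := by field_simp
  rw [bN]
  calc _ ≤ ENNReal.ofReal (4 * s / n) ^ 2 + ENNReal.ofReal (288 * s / n ^ 2)
        + 5 * (ENNReal.ofReal (144 / n) * ENNReal.ofReal (4 * s / n))
        + 6 * ENNReal.ofReal (41472 * (1 + s) / n ^ 2) + 3 * ENNReal.ofReal (144 / n) ^ 2 := by
        gcongr
    _ = ENNReal.ofReal ((4 * s / n) ^ 2 + 288 * s / n ^ 2 + 5 * (144 / n * (4 * s / n))
        + 6 * (41472 * (1 + s) / n ^ 2) + 3 * (144 / n) ^ 2) := by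
        rw [ENNReal.ofReal_add (by positivity) (by positivity),
          ENNReal.ofReal_add (by positivity) (by positivity),
          ENNReal.ofReal_add (by positivity) (by positivity),
          ENNReal.ofReal_add (by positivity) (by positivity),
          ENNReal.ofReal_mul (p := 5) (by positivity), ENNReal.ofReal_mul (p := 6) (by positivity),
          ENNReal.ofReal_mul (p := 3) (by positivity), ENNReal.ofReal_pow (by positivity),
          ENNReal.ofReal_pow (by positivity), ENNReal.ofReal_mul (p := 144 / n) (by positivity)]
        simp only [ENNReal.ofReal_ofNat]
    _ ≤ _ := by
        refine ENNReal.ofReal_le_ofReal ?_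
        have e : (4 * s / n) ^ 2 + 288 * s / n ^ 2 + 5 * (144 / n * (4 * s / n))
            + 6 * (41472 * (1 + s) / n ^ 2) + 3 * (144 / n) ^ 2
            = (16 * s ^ 2 + 252000 * s + 311040) / (n : ℝ) ^ 2 := by
          field_simp; ring
        rw [e]
        gcongr
        nlinarith

end RandomizedCLT

/-! ### High frequencies: decay of the characteristic function. -/

namespace RandomizedCLT

open scoped Convolution
variable {n : ℕ} {μ : Measure (E n)}

theorem integral_charFun_stdGaussian (ν : Measure (E n)) [IsFiniteMeasure ν] (s : ℝ) :
    ∫ z, charFun ν (s • z) ∂(stdGaussian (E n)) =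
      ((∫ x, Real.exp (-(s ^ 2 * ‖x‖ ^ 2 / 2)) ∂ν : ℝ) : ℂ) := by
  simp only [charFun_apply]
  rw [integral_integral_swap]
  · rw [← integral_complex_ofReal]
    congr 1
    funext x
    have : ∀ z : E n, Complex.exp (inner ℝ x (s • z) * Complex.I)
        = Complex.exp (inner ℝ z (s • x) * Complex.I) := by
      intro z
      rw [inner_smul_right, inner_smul_right, real_inner_comm]
    simp_rw [this]
    rw [← charFun_apply, charFun_stdGaussian, norm_smul]
    simp only [Real.norm_eq_abs, Complex.ofReal_mul, mul_pow]
    push_cast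
    rw [← Complex.ofReal_pow, sq_abs]
    push_cast
    ring_nf
  · refine (integrable_const (1 : ℝ)).mono' (Measurable.aestronglyMeasurable (by fun_prop))
      (Filter.Eventually.of_forall fun w => ?_)
    simp [Function.uncurry, Complex.norm_exp_ofReal_mul_I]

/-- The Gaussian average of `|φ|⁴` as a Laplace-type functional of a signed sum of four independent
copies. -/
theorem lintegral_charFun_pow_four_stdGaussian [IsProbabilityMeasure μ] (s : ℝ) :
    ∫⁻ z, ‖charFun μ (s • z)‖ₑ ^ 4 ∂(stdGaussian (E n)) =
      ∫⁻ a, ∫⁻ b, ∫⁻ c, ∫⁻ d, ENNReal.ofReal (Real.exp (-(s ^ 2 * ‖a + b - c - d‖ ^ 2 / 2)))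
        ∂μ ∂μ ∂μ ∂μ := by
  have hnm : Measurable fun x : E n => (-1 : ℝ) • x := by fun_prop
  set μ' := μ.map fun x : E n => (-1 : ℝ) • x with hμ'
  have hp' : IsProbabilityMeasure μ' := Measure.isProbabilityMeasure_map hnm.aemeasurable
  -- |φ|⁴ is φ²φ̄², the characteristic function of a + b - c - d; the reflected law `μ'` produces
  -- the conjugates.
  set ν := μ ∗ (μ ∗ (μ' ∗ μ')) with hν
  have hch : ∀ u, charFun ν u = ((‖charFun μ u‖ ^ 4 : ℝ) : ℂ) := by
    intro u
    rw [hν, charFun_conv, charFun_conv, charFun_conv, hμ', charFun_map_smul, neg_one_smul,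
      charFun_neg]
    have : charFun μ u * (starRingEnd ℂ) (charFun μ u) = ((‖charFun μ u‖ ^ 2 : ℝ) : ℂ) := by
      rw [Complex.mul_conj, Complex.normSq_eq_norm_sq]
    calc _ = (charFun μ u * (starRingEnd ℂ) (charFun μ u)) ^ 2 := by ring
      _ = _ := by rw [this]; push_cast; ring
  have h := integral_charFun_stdGaussian ν s
  simp_rw [hch] at h
  rw [integral_complex_ofReal, Complex.ofReal_inj] at h
  have i1 : Integrable (fun z => ‖charFun μ (s • z)‖ ^ 4) (stdGaussian (E n)) := by
    refine (integrable_const (1 : ℝ)).mono' (Measurable.aestronglyMeasurable (by fun_prop))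
      (Filter.Eventually.of_forall fun w => ?_)
    rw [norm_pow, norm_norm]
    exact pow_le_one₀ (norm_nonneg _) (norm_charFun_le_one _)
  have i2 : Integrable (fun x : E n => Real.exp (-(s ^ 2 * ‖x‖ ^ 2 / 2))) ν := by
    refine (integrable_const (1 : ℝ)).mono' (Measurable.aestronglyMeasurable (by fun_prop))
      (Filter.Eventually.of_forall fun w => ?_)
    rw [Real.norm_of_nonneg (Real.exp_pos _).le, Real.exp_le_one_iff]
    have : 0 ≤ s ^ 2 * ‖w‖ ^ 2 / 2 := by positivity
    linarith
  have e1 : ∀ z, ‖charFun μ (s • z)‖ₑ ^ 4 = ENNReal.ofReal (‖charFun μ (s • z)‖ ^ 4) := by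
    intro z
    rw [← ofReal_norm, ENNReal.ofReal_pow (norm_nonneg _)]
  simp_rw [e1]
  rw [← ofReal_integral_eq_lintegral_ofReal i1 (Filter.Eventually.of_forall fun z => by positivity),
    h, ofReal_integral_eq_lintegral_ofReal i2
      (Filter.Eventually.of_forall fun z => (Real.exp_pos _).le), hν,
    Measure.lintegral_conv (by fun_prop)]
  refine lintegral_congr fun a => ?_
  rw [Measure.lintegral_conv (by fun_prop)]
  refine lintegral_congr fun b => ?_
  rw [Measure.lintegral_conv (by fun_prop), hμ', lintegral_map ?_ hnm]
  · refine lintegral_congr fun c => ?_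
    rw [lintegral_map (by fun_prop) hnm]
    refine lintegral_congr fun d => ?_
    have e : a + (b + ((-1 : ℝ) • c + (-1 : ℝ) • d)) = a + b - c - d := by
      rw [neg_one_smul, neg_one_smul]; abel
    rw [e]
  · exact Measurable.lintegral_prod_right' (f := fun p : E n × E n =>
      ENNReal.ofReal (Real.exp (-(s ^ 2 * ‖a + (b + (p.1 + p.2))‖ ^ 2 / 2)))) (by fun_prop)

/-- The Gaussian weight is split at |x|² = n/8. Inside, the small ball estimate applies; outside,
the weight is at most exp(-s²n/16), which `hlog` brings below n⁻². -/
theorem IsotropicLaw.lintegral_charFun_pow_four_le [NeZero n] [IsProbabilityMeasure μ]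
    (h : IsotropicLaw μ) {σ : ℝ} (hs : 0 ≤ σ)
    (hvar : ∫⁻ x, ENNReal.ofReal ((‖x‖ ^ 2 - n) ^ 2) ∂μ ≤ ENNReal.ofReal (n * σ)) {s : ℝ}
    (hlog : 32 * Real.log n ≤ s ^ 2 * n) :
    ∫⁻ z, ‖charFun μ (s • z)‖ₑ ^ 4 ∂(stdGaussian (E n)) ≤
      ENNReal.ofReal (320001 * (1 + σ) ^ 2 / n ^ 2) := by
  have hn : (1 : ℝ) ≤ n := by exact_mod_cast NeZero.one_le
  have hexp : Real.exp (-(s ^ 2 * n / 16)) ≤ 1 / n ^ 2 := by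
    calc _ ≤ Real.exp (-(2 * Real.log n)) := Real.exp_le_exp.2 (by linarith)
      _ = 1 / n ^ 2 := by
        rw [Real.exp_neg, two_mul, Real.exp_add, Real.exp_log (by linarith)]
        field_simp
  have hp : ∀ x : E n, ENNReal.ofReal (Real.exp (-(s ^ 2 * ‖x‖ ^ 2 / 2))) ≤
      {x : E n | ‖x‖ ^ 2 ≤ n / 8}.indicator 1 x + ENNReal.ofReal (1 / n ^ 2) := by
    intro x
    by_cases hx : ‖x‖ ^ 2 ≤ n / 8
    · rw [Set.indicator_of_mem (show x ∈ {x : E n | ‖x‖ ^ 2 ≤ n / 8} from hx), Pi.one_apply]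
      refine le_trans ?_ le_self_add
      rw [← ENNReal.ofReal_one]
      refine ENNReal.ofReal_le_ofReal (Real.exp_le_one_iff.2 ?_)
      have : 0 ≤ s ^ 2 * ‖x‖ ^ 2 / 2 := by positivity
      linarith
    · rw [Set.indicator_of_notMem (show x ∉ {x : E n | ‖x‖ ^ 2 ≤ n / 8} from hx), zero_add]
      refine ENNReal.ofReal_le_ofReal (le_trans (Real.exp_le_exp.2 ?_) hexp)
      have : s ^ 2 * (n / 8) ≤ s ^ 2 * ‖x‖ ^ 2 := by
        gcongr; exact (not_le.1 hx).le
      linarith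
  rw [lintegral_charFun_pow_four_stdGaussian]
  calc _ ≤ ∫⁻ a, ∫⁻ b, ∫⁻ c, ∫⁻ d, ({x : E n | ‖x‖ ^ 2 ≤ n / 8}.indicator 1 (a + b - c - d)
        + ENNReal.ofReal (1 / n ^ 2)) ∂μ ∂μ ∂μ ∂μ := by gcongr; exact hp _
    _ = ∫⁻ a, ∫⁻ b, ∫⁻ c, ∫⁻ d, {x : E n | ‖x‖ ^ 2 ≤ n / 8}.indicator 1 (a + b - c - d)
        ∂μ ∂μ ∂μ ∂μ + ENNReal.ofReal (1 / n ^ 2) := by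
        simp [lintegral_add_right]
    _ ≤ ENNReal.ofReal (320000 * (1 + σ) ^ 2 / n ^ 2) + ENNReal.ofReal (1 / n ^ 2) := by
        gcongr; exact h.lintegral_small_ball_le hs hvar
    _ ≤ _ := by
        rw [← ENNReal.ofReal_add (by positivity) (by positivity), ← add_div]
        refine ENNReal.ofReal_le_ofReal ?_
        gcongr
        nlinarith

theorem lintegral_inv_sq_tail_le {T : ℝ} (hT : 0 < T) :
    ∫⁻ s in {s : ℝ | T < |s|}, ENNReal.ofReal (1 / s ^ 2) ≤ ENNReal.ofReal (2 / T) := by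
  have hIoi : ∫⁻ s in Set.Ioi T, ENNReal.ofReal (1 / s ^ 2) = ENNReal.ofReal (1 / T) := by
    have e : ∀ s ∈ Set.Ioi T, 1 / s ^ 2 = s ^ (-2 : ℝ) := fun s hs => by
      rw [Real.rpow_neg (hT.trans hs).le, one_div]; norm_cast
    have hi := integrableOn_Ioi_rpow_of_lt (a := -2) (by norm_num) hT
    have hv := integral_Ioi_rpow_of_lt (a := -2) (by norm_num) hT
    rw [setLIntegral_congr_fun measurableSet_Ioi (fun s hs => by rw [e s hs]),
      ← ofReal_integral_eq_lintegral_ofReal hi, hv]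
    · congr 1
      norm_num
      rw [Real.rpow_neg_one]
    · filter_upwards [ae_restrict_mem measurableSet_Ioi] with s hs
      exact Real.rpow_nonneg (hT.trans hs).le _
  have hIio : ∫⁻ s in Set.Iio (-T), ENNReal.ofReal (1 / s ^ 2) = ENNReal.ofReal (1 / T) := by
    rw [← hIoi, ← (Measure.measurePreserving_neg (volume : Measure ℝ)).setLIntegral_comp_preimage
      measurableSet_Iio (by fun_prop)]
    simp
  have hsub : {s : ℝ | T < |s|} ⊆ Set.Ioi T ∪ Set.Iio (-T) := by
    intro s hs
    rcases lt_abs.1 (show T < |s| from hs) with h | h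
    · exact Or.inl h
    · exact Or.inr (show s < -T by linarith)
  refine (lintegral_mono_set hsub).trans ((lintegral_union_le _ _ _).trans ?_)
  rw [hIoi, hIio, ← ENNReal.ofReal_add (by positivity) (by positivity)]
  exact ENNReal.ofReal_le_ofReal (le_of_eq (by ring))

/-- The high frequency part of the spectral energy of `μ` in the direction `z`. -/
noncomputable def highFreq (μ : Measure (E n)) (T : ℝ) (z : E n) : ENNReal :=
  ∫⁻ s in {s : ℝ | T < |s|}, ENNReal.ofReal (1 / s ^ 2) * ‖charFun μ (s • z)‖ₑ ^ 2

theorem measurableSet_lt_abs (T : ℝ) : MeasurableSet {s : ℝ | T < |s|} :=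
  measurableSet_lt (by fun_prop) (by fun_prop)

theorem measurable_highFreq [SFinite μ] (T : ℝ) : Measurable (highFreq μ T) := by
  have : Measurable (charFun μ) := measurable_charFun
  exact Measurable.lintegral_prod_right' (f := fun p : E n × ℝ =>
    ENNReal.ofReal (1 / p.2 ^ 2) * ‖charFun μ (p.2 • p.1)‖ₑ ^ 2) (by fun_prop)

theorem highFreq_anti {T T' : ℝ} (h : T ≤ T') (z : E n) : highFreq μ T' z ≤ highFreq μ T z :=
  lintegral_mono_set fun _ hs => lt_of_le_of_lt h hs

/-- The substitution s ↦ rs. The cutoff moves with the radius, which is why monotonicity in the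
cutoff is needed to pass to the sphere. -/
theorem highFreq_smul [SFinite μ] (T : ℝ) {r : ℝ} (hr : 0 < r) (z : E n) :
    highFreq μ T (r • z) = ENNReal.ofReal r * highFreq μ (T * r) z := by
  have hφ : Measurable (charFun μ) := measurable_charFun
  have hm : Measurable fun s : ℝ => {s : ℝ | T * r < |s|}.indicator
      (fun s => ENNReal.ofReal (1 / s ^ 2) * ‖charFun μ (s • z)‖ₑ ^ 2) s :=
    Measurable.indicator (by fun_prop) (measurableSet_lt_abs _)
  have h1 : ∀ s : ℝ, {s : ℝ | T < |s|}.indicator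
      (fun s => ENNReal.ofReal (1 / s ^ 2) * ‖charFun μ (s • r • z)‖ₑ ^ 2) s
      = ENNReal.ofReal (r ^ 2) * {s : ℝ | T * r < |s|}.indicator
        (fun s => ENNReal.ofReal (1 / s ^ 2) * ‖charFun μ (s • z)‖ₑ ^ 2) (r * s) := by
    intro s
    by_cases hs : T < |s|
    · have hs' : T * r < |r * s| := by
        rw [abs_mul, abs_of_pos hr, mul_comm]; gcongr
      rw [Set.indicator_of_mem (show s ∈ {s : ℝ | T < |s|} from hs),
        Set.indicator_of_mem (show r * s ∈ {s : ℝ | T * r < |s|} from hs'), ← mul_assoc,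
        ← ENNReal.ofReal_mul (by positivity), smul_smul, mul_comm s r]
      congr 2
      field_simp
    · have hs' : ¬ T * r < |r * s| := by
        rw [abs_mul, abs_of_pos hr, mul_comm]
        exact fun h => hs (lt_of_mul_lt_mul_left h hr.le)
      rw [Set.indicator_of_notMem (show s ∉ {s : ℝ | T < |s|} from hs),
        Set.indicator_of_notMem (show r * s ∉ {s : ℝ | T * r < |s|} from hs'), mul_zero]
  rw [highFreq, ← lintegral_indicator (measurableSet_lt_abs _)]
  simp_rw [h1]
  rw [lintegral_const_mul' _ _ ENNReal.ofReal_ne_top,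
    ← lintegral_map hm (measurable_const_mul r), Real.map_volume_mul_left hr.ne',
    lintegral_smul_measure, smul_eq_mul, ← mul_assoc, ← ENNReal.ofReal_mul (by positivity),
    lintegral_indicator (measurableSet_lt_abs _), highFreq]
  congr 2
  rw [abs_of_pos (by positivity)]
  field_simp

/-- Cauchy–Schwarz against the weight 1/s², of mass at most 2/T beyond `T`, reduces the square to
the fourth-moment bound at each frequency. -/
theorem IsotropicLaw.lintegral_highFreq_stdGaussian_le [NeZero n] [IsProbabilityMeasure μ]
    (h : IsotropicLaw μ) {σ : ℝ} (hs : 0 ≤ σ)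
    (hvar : ∫⁻ x, ENNReal.ofReal ((‖x‖ ^ 2 - n) ^ 2) ∂μ ≤ ENNReal.ofReal (n * σ)) {T : ℝ}
    (hT : 0 < T) (hlog : 32 * Real.log n ≤ T ^ 2 * n) :
    ∫⁻ z, highFreq μ T z ^ 2 ∂(stdGaussian (E n)) ≤
      ENNReal.ofReal (4 / T ^ 2 * (320001 * (1 + σ) ^ 2 / n ^ 2)) := by
  have hφ : Measurable (charFun μ) := measurable_charFun
  set M := ENNReal.ofReal (320001 * (1 + σ) ^ 2 / n ^ 2) with hM
  set ν : Measure ℝ := volume.restrict {s : ℝ | T < |s|} with hν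
  have hp : ∀ z, highFreq μ T z ^ 2 ≤ ENNReal.ofReal (2 / T) *
      ∫⁻ s, ENNReal.ofReal (1 / s ^ 2) * ‖charFun μ (s • z)‖ₑ ^ 4 ∂ν := by
    intro z
    refine (lintegral_mul_sq_le _ (by fun_prop) (by fun_prop)).trans ?_
    simp_rw [← pow_mul]
    gcongr
    exact lintegral_inv_sq_tail_le hT
  calc _ ≤ ∫⁻ z, ENNReal.ofReal (2 / T) *
        ∫⁻ s, ENNReal.ofReal (1 / s ^ 2) * ‖charFun μ (s • z)‖ₑ ^ 4 ∂ν ∂(stdGaussian (E n)) :=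
        lintegral_mono hp
    _ = ENNReal.ofReal (2 / T) * ∫⁻ s, ∫⁻ z,
        ENNReal.ofReal (1 / s ^ 2) * ‖charFun μ (s • z)‖ₑ ^ 4 ∂(stdGaussian (E n)) ∂ν := by
        rw [lintegral_const_mul' _ _ ENNReal.ofReal_ne_top, lintegral_lintegral_swap]
        exact Measurable.aemeasurable (by fun_prop)
    _ ≤ ENNReal.ofReal (2 / T) * ∫⁻ s, ENNReal.ofReal (1 / s ^ 2) * M ∂ν := by
        refine mul_le_mul_right ?_ _
        refine setLIntegral_mono' (measurableSet_lt_abs _) fun s hs => ?_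
        rw [lintegral_const_mul' _ _ ENNReal.ofReal_ne_top]
        gcongr
        refine h.lintegral_charFun_pow_four_le ‹_› hvar (hlog.trans ?_)
        have : T ^ 2 ≤ s ^ 2 := by
          rw [← sq_abs s]
          have : T < |s| := hs
          gcongr
        gcongr
    _ ≤ ENNReal.ofReal (2 / T) * (ENNReal.ofReal (2 / T) * M) := by
        rw [lintegral_mul_const _ (by fun_prop)]
        gcongr
        exact lintegral_inv_sq_tail_le hT
    _ = _ := by
        rw [hM, ← ENNReal.ofReal_mul (by positivity), ← ENNReal.ofReal_mul (by positivity)]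
        congr 1
        field_simp
        norm_num

/-- Second moment of the high frequency energy over the sphere. -/
theorem IsotropicLaw.lintegral_highFreq_sphere_le [NeZero n] [IsProbabilityMeasure μ]
    (h : IsotropicLaw μ) (hn2 : 2 ≤ n) {σ : ℝ} (hs : 0 ≤ σ)
    (hvar : ∫⁻ x, ENNReal.ofReal ((‖x‖ ^ 2 - n) ^ 2) ∂μ ≤ ENNReal.ofReal (n * σ)) {T : ℝ}
    (hT : 0 < T) (hlog : 256 * Real.log n ≤ T ^ 2) :
    ∫⁻ θ : Sph n, highFreq μ T θ ^ 2 ∂(sphereMeasure n) ≤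
      ENNReal.ofReal (170000000 * (1 + σ) ^ 2 / (T ^ 2 * n ^ 2)) := by
  obtain ⟨ρ, hρp, hρ⟩ := exists_polar_stdGaussian n
  have hn : (1 : ℝ) ≤ n := by exact_mod_cast NeZero.one_le
  -- The largest radius in `A`: with Gaussian cutoff T/q the rescaled cutoff (T/q)r never exceeds
  -- `T` there. It also turns the constant 32 in the logarithmic condition into 256.
  set q := √(8 * n : ℝ) with hq
  have hq2 : q ^ 2 = 8 * n := Real.sq_sqrt (by positivity)
  have hq0 : 0 < q := Real.sqrt_pos.2 (by positivity)
  have hT' : 0 < T / q := by positivity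
  have hTq : (T / q) ^ 2 = T ^ 2 / (8 * n) := by rw [div_pow, hq2]
  have hG := h.lintegral_highFreq_stdGaussian_le hs hvar hT' (by
    rw [hTq]
    have : T ^ 2 / (8 * (n : ℝ)) * n = T ^ 2 / 8 := by field_simp
    rw [this]; linarith)
  have hHm := measurable_highFreq (μ := μ) (T / q)
  set A := {r : Set.Ioi (0 : ℝ) | (n : ℝ) / 8 ≤ r.1 ^ 2 ∧ r.1 ^ 2 ≤ 8 * n} with hA
  have hA1 : MeasurableSet {r : Set.Ioi (0 : ℝ) | (n : ℝ) / 8 ≤ r.1 ^ 2} :=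
    measurableSet_le (by fun_prop) (by fun_prop)
  have hA3 : MeasurableSet {r : Set.Ioi (0 : ℝ) | r.1 ^ 2 ≤ 8 * n} :=
    measurableSet_le (by fun_prop) (by fun_prop)
  have hAm : MeasurableSet A := hA1.inter hA3
  have hA2 : 1 / 2 ≤ ρ A := IsRadialLaw.one_half_le hρ hn2
  rw [← hρ.lintegral_comp (hHm.pow_const 2), lintegral_prod _ (by
    exact ((hHm.pow_const 2).comp hρ.measurable).aemeasurable)] at hG
  have hlow : ∀ θ : Sph n, highFreq μ T θ ^ 2 * ENNReal.ofReal (n / 16) ≤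
      ∫⁻ r : Set.Ioi (0 : ℝ), highFreq μ (T / q) (r.1 • (θ : E n)) ^ 2 ∂ρ := by
    intro θ
    calc highFreq μ T θ ^ 2 * ENNReal.ofReal (n / 16)
        ≤ highFreq μ T θ ^ 2 * (ENNReal.ofReal (n / 8) * ρ A) := by
          gcongr
          calc ENNReal.ofReal (n / 16) = ENNReal.ofReal (n / 8) * (1 / 2) := by
                have : (1 / 2 : ENNReal) = ENNReal.ofReal (1 / 2) := by
                  rw [ENNReal.ofReal_div_of_pos (by norm_num)]; simp
                rw [this, ← ENNReal.ofReal_mul (by positivity)]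
                congr 1; ring
            _ ≤ _ := by gcongr
      _ = ∫⁻ r in A, highFreq μ T θ ^ 2 * ENNReal.ofReal (n / 8) ∂ρ := by
          rw [setLIntegral_const, mul_assoc]
      _ ≤ ∫⁻ r in A, highFreq μ (T / q) (r.1 • (θ : E n)) ^ 2 ∂ρ := by
          refine setLIntegral_mono' hAm fun r hr => ?_
          rw [highFreq_smul _ r.2, mul_pow, mul_comm, ← ENNReal.ofReal_pow r.2.le]
          gcongr
          · exact hr.1
          · refine highFreq_anti ?_ _
            have : r.1 ≤ q := by
              rw [hq]; exact Real.le_sqrt_of_sq_le hr.2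
            calc T / q * r.1 ≤ T / q * q := by gcongr
              _ = T := by field_simp
      _ ≤ _ := setLIntegral_le_lintegral _ _
  have h2 : (∫⁻ θ : Sph n, highFreq μ T θ ^ 2 ∂(sphereMeasure n)) * ENNReal.ofReal (n / 16) ≤
      ENNReal.ofReal (4 / (T / q) ^ 2 * (320001 * (1 + σ) ^ 2 / n ^ 2)) := by
    rw [← lintegral_mul_const' _ _ ENNReal.ofReal_ne_top]
    exact (lintegral_mono hlow).trans hG
  rw [← ENNReal.le_div_iff_mul_le (Or.inl (by
      rw [Ne, ENNReal.ofReal_eq_zero, not_le]; positivity)) (Or.inl ENNReal.ofReal_ne_top),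
    ← ENNReal.ofReal_div_of_pos (by positivity)] at h2
  refine h2.trans (ENNReal.ofReal_le_ofReal ?_)
  rw [hTq]
  have e : 4 / (T ^ 2 / (8 * n)) * (320001 * (1 + σ) ^ 2 / n ^ 2) / ((n : ℝ) / 16)
      = 163840512 * (1 + σ) ^ 2 / (T ^ 2 * n ^ 2) := by field_simp; norm_num
  rw [e]
  gcongr
  norm_num

end RandomizedCLT

/-! ### Spectral energy and the fourth moment of the distance. -/

namespace RandomizedCLT

variable {n : ℕ} {μ : Measure (E n)}

/-- The spectral energy of the difference of two one-dimensional projections of `μ`. -/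
noncomputable def spectralEnergy (μ : Measure (E n)) (z z' : E n) : ENNReal :=
  ∫⁻ t : ℝ, ENNReal.ofReal (1 / t ^ 2) * ‖charFun μ (t • z) - charFun μ (t • z')‖ₑ ^ 2

theorem measurable_spectralEnergy [SFinite μ] :
    Measurable fun p : E n × E n => spectralEnergy μ p.1 p.2 := by
  have : Measurable (charFun μ) := measurable_charFun
  exact Measurable.lintegral_prod_right' (f := fun p : (E n × E n) × ℝ =>
    ENNReal.ofReal (1 / p.2 ^ 2) * ‖charFun μ (p.2 • p.1.1) - charFun μ (p.2 • p.1.2)‖ₑ ^ 2)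
    (by fun_prop)

theorem enorm_sub_sq_le (x y : ℂ) : ‖x - y‖ₑ ^ 2 ≤ 2 * ‖x‖ₑ ^ 2 + 2 * ‖y‖ₑ ^ 2 := by
  rw [← ofReal_norm, ← ofReal_norm, ← ofReal_norm, ← ENNReal.ofReal_pow (norm_nonneg _),
    ← ENNReal.ofReal_pow (norm_nonneg _), ← ENNReal.ofReal_pow (norm_nonneg _),
    ← ENNReal.ofReal_ofNat, ← ENNReal.ofReal_mul (by norm_num), ← ENNReal.ofReal_mul (by norm_num),
    ← ENNReal.ofReal_add (by positivity) (by positivity)]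
  refine ENNReal.ofReal_le_ofReal ?_
  have h := norm_sub_le x y
  calc ‖x - y‖ ^ 2 ≤ (‖x‖ + ‖y‖) ^ 2 := by gcongr
    _ ≤ _ := by nlinarith [sq_nonneg (‖x‖ - ‖y‖)]

theorem ennreal_add_sq_le (a b c : ENNReal) :
    (a + b + c) ^ 2 ≤ 3 * a ^ 2 + 3 * b ^ 2 + 3 * c ^ 2 := by
  by_cases ha : a = ⊤
  · simp [ha]
  by_cases hb : b = ⊤
  · simp [hb]
  by_cases hc : c = ⊤
  · simp [hc]
  lift a to NNReal using ha
  lift b to NNReal using hb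
  lift c to NNReal using hc
  norm_cast
  rw [← NNReal.coe_le_coe]
  push_cast
  nlinarith [sq_nonneg ((a : ℝ) - b), sq_nonneg ((a : ℝ) - c), sq_nonneg ((b : ℝ) - c)]

theorem spectralEnergy_le [SFinite μ] (T : ℝ) (z z' : E n) :
    spectralEnergy μ z z' ≤ (∫⁻ t in {t : ℝ | T < |t|}ᶜ,
        ENNReal.ofReal (1 / t ^ 2) * ‖charFun μ (t • z) - charFun μ (t • z')‖ₑ ^ 2)
      + 2 * highFreq μ T z + 2 * highFreq μ T z' := by
  have hφ : Measurable (charFun μ) := measurable_charFun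
  rw [spectralEnergy, ← lintegral_add_compl _ (measurableSet_lt_abs T), add_comm, add_assoc]
  gcongr
  rw [highFreq, highFreq, ← lintegral_const_mul' _ _ (by simp), ← lintegral_const_mul' _ _ (by simp),
    ← lintegral_add_left (by fun_prop)]
  refine lintegral_mono fun t => ?_
  calc _ ≤ ENNReal.ofReal (1 / t ^ 2) *
        (2 * ‖charFun μ (t • z)‖ₑ ^ 2 + 2 * ‖charFun μ (t • z')‖ₑ ^ 2) := by
        gcongr; exact enorm_sub_sq_le _ _
    _ = _ := by ring

/-- After Cauchy–Schwarz on an interval of length 2T, the factor t⁴ from spherical concentration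
absorbs 1/t⁴. -/
theorem IsotropicLaw.lintegral_lowFreq_sq_le [NeZero n] [IsProbabilityMeasure μ]
    (h : IsotropicLaw μ) {T : ℝ} (hT : 0 < T) :
    ∫⁻ q : Sph n × Sph n, (∫⁻ t in {t : ℝ | T < |t|}ᶜ, ENNReal.ofReal (1 / t ^ 2) *
        ‖charFun μ (t • (q.1 : E n)) - charFun μ (t • (q.2 : E n))‖ₑ ^ 2) ^ 2
      ∂((sphereMeasure n).prod (sphereMeasure n)) ≤ ENNReal.ofReal (6000000 * T ^ 2 / n ^ 2) := by
  have hφ : Measurable (charFun μ) := measurable_charFun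
  have hn : (1 : ℝ) ≤ n := by exact_mod_cast NeZero.one_le
  have hvol : volume {t : ℝ | T < |t|}ᶜ = ENNReal.ofReal (2 * T) := by
    have : {t : ℝ | T < |t|}ᶜ = Set.Icc (-T) T := by
      ext t; simp [abs_le]
    rw [this, Real.volume_Icc]; ring_nf
  set S := {t : ℝ | T < |t|}ᶜ
  set S2 := (sphereMeasure n).prod (sphereMeasure n)
  have hp : ∀ q : Sph n × Sph n, (∫⁻ t in S, ENNReal.ofReal (1 / t ^ 2) *
        ‖charFun μ (t • (q.1 : E n)) - charFun μ (t • (q.2 : E n))‖ₑ ^ 2) ^ 2 ≤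
      ENNReal.ofReal (2 * T) * ∫⁻ t in S, ENNReal.ofReal (1 / t ^ 4) *
        ‖charFun μ (t • (q.1 : E n)) - charFun μ (t • (q.2 : E n))‖ₑ ^ 4 := by
    intro q
    refine (lintegral_sq_le _ (by fun_prop)).trans (le_of_eq ?_)
    rw [Measure.restrict_apply_univ, hvol]
    congr 1
    refine lintegral_congr fun t => ?_
    rw [mul_pow, ← pow_mul, ← ENNReal.ofReal_pow (by positivity), one_div_pow, ← pow_mul]
  calc _ ≤ ∫⁻ q, ENNReal.ofReal (2 * T) * (∫⁻ t in S, ENNReal.ofReal (1 / t ^ 4) *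
        ‖charFun μ (t • (q.1 : E n)) - charFun μ (t • (q.2 : E n))‖ₑ ^ 4) ∂S2 := lintegral_mono hp
    _ = ENNReal.ofReal (2 * T) * ∫⁻ t in S, ENNReal.ofReal (1 / t ^ 4) *
        ∫⁻ q, ‖charFun μ (t • (q.1 : E n)) - charFun μ (t • (q.2 : E n))‖ₑ ^ 4 ∂S2 := by
        rw [lintegral_const_mul' _ _ ENNReal.ofReal_ne_top, lintegral_lintegral_swap (by
          exact Measurable.aemeasurable (by fun_prop))]
        simp_rw [lintegral_const_mul' _ _ ENNReal.ofReal_ne_top]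
    _ ≤ ENNReal.ofReal (2 * T) * ∫⁻ t in S, ENNReal.ofReal (1500000 / n ^ 2) := by
        refine mul_le_mul_right (lintegral_mono fun t => ?_) _
        refine (mul_le_mul_right (h.lintegral_charFun_sub_sphere_le t) _).trans ?_
        rw [← ENNReal.ofReal_mul (by positivity)]
        refine ENNReal.ofReal_le_ofReal ?_
        rcases eq_or_ne t 0 with rfl | ht
        · simp; positivity
        · exact le_of_eq (by field_simp)
    _ = _ := by
        rw [setLIntegral_const, hvol, ← ENNReal.ofReal_mul (by positivity),
          ← ENNReal.ofReal_mul (by positivity)]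
        ring_nf

/-- Second moment of the spectral energy over pairs of independent directions. -/
theorem IsotropicLaw.lintegral_spectralEnergy_sq_le [NeZero n] [IsProbabilityMeasure μ]
    (h : IsotropicLaw μ) (hn2 : 2 ≤ n) {σ : ℝ} (hs : 0 ≤ σ)
    (hvar : ∫⁻ x, ENNReal.ofReal ((‖x‖ ^ 2 - n) ^ 2) ∂μ ≤ ENNReal.ofReal (n * σ)) :
    ∫⁻ q : Sph n × Sph n, spectralEnergy μ q.1 q.2 ^ 2
      ∂((sphereMeasure n).prod (sphereMeasure n)) ≤
      ENNReal.ofReal (5000000000 * Real.log n * (1 + σ) ^ 2 / n ^ 2) := by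
  have hφ : Measurable (charFun μ) := measurable_charFun
  have hn : (2 : ℝ) ≤ n := by exact_mod_cast hn2
  have hL : 1 / 2 ≤ Real.log n := by
    have := Real.log_two_gt_d9
    have := Real.log_le_log (by norm_num) hn
    linarith
  set L := Real.log n with hLdef
  -- The smallest cutoff admitted by the high-frequency bound. Low frequencies then contribute order
  -- log n / n², the source of the logarithm, and high ones only order (1 + σ)² / (n² log n).
  set T := √(256 * L) with hT
  have hT2 : T ^ 2 = 256 * L := Real.sq_sqrt (by positivity)
  have hT0 : 0 < T := Real.sqrt_pos.2 (by positivity)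
  set S2 := (sphereMeasure n).prod (sphereMeasure n)
  set A : Sph n × Sph n → ENNReal := fun q => ∫⁻ t in {t : ℝ | T < |t|}ᶜ, ENNReal.ofReal (1 / t ^ 2) *
        ‖charFun μ (t • (q.1 : E n)) - charFun μ (t • (q.2 : E n))‖ₑ ^ 2 with hA
  have hAm : Measurable A := Measurable.lintegral_prod_right' (f := fun p : (Sph n × Sph n) × ℝ =>
    ENNReal.ofReal (1 / p.2 ^ 2) *
      ‖charFun μ (p.2 • (p.1.1 : E n)) - charFun μ (p.2 • (p.1.2 : E n))‖ₑ ^ 2) (by fun_prop)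
  have hHm := measurable_highFreq (μ := μ) T
  have hH := h.lintegral_highFreq_sphere_le hn2 hs hvar hT0 hT2.ge
  have hHs : Measurable fun θ : Sph n => highFreq μ T (θ : E n) ^ 2 := by fun_prop
  have hp : ∀ q : Sph n × Sph n, spectralEnergy μ q.1 q.2 ^ 2 ≤
      3 * A q ^ 2 + 12 * highFreq μ T (q.1 : E n) ^ 2 + 12 * highFreq μ T (q.2 : E n) ^ 2 := by
    intro q
    calc _ ≤ (A q + 2 * highFreq μ T (q.1 : E n) + 2 * highFreq μ T (q.2 : E n)) ^ 2 := by
          gcongr; exact spectralEnergy_le T _ _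
      _ ≤ _ := ennreal_add_sq_le _ _ _
      _ = _ := by ring
  have e1 : ∫⁻ q, highFreq μ T (q.1 : E n) ^ 2 ∂S2 = ∫⁻ θ : Sph n, highFreq μ T θ ^ 2 ∂(sphereMeasure n) :=
    measurePreserving_fst.lintegral_comp hHs
  have e2 : ∫⁻ q, highFreq μ T (q.2 : E n) ^ 2 ∂S2 = ∫⁻ θ : Sph n, highFreq μ T θ ^ 2 ∂(sphereMeasure n) :=
    measurePreserving_snd.lintegral_comp hHs
  calc _ ≤ ∫⁻ q, (3 * A q ^ 2 + 12 * highFreq μ T (q.1 : E n) ^ 2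
        + 12 * highFreq μ T (q.2 : E n) ^ 2) ∂S2 := lintegral_mono hp
    _ = 3 * ∫⁻ q, A q ^ 2 ∂S2 + 12 * ∫⁻ θ : Sph n, highFreq μ T θ ^ 2 ∂(sphereMeasure n)
        + 12 * ∫⁻ θ : Sph n, highFreq μ T θ ^ 2 ∂(sphereMeasure n) := by
        rw [lintegral_add_left (by fun_prop), lintegral_add_left (by fun_prop),
          lintegral_const_mul' _ _ (by simp), lintegral_const_mul' _ _ (by simp),
          lintegral_const_mul' _ _ (by simp), e1, e2]
    _ ≤ 3 * ENNReal.ofReal (6000000 * T ^ 2 / n ^ 2)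
        + 12 * ENNReal.ofReal (170000000 * (1 + σ) ^ 2 / (T ^ 2 * n ^ 2))
        + 12 * ENNReal.ofReal (170000000 * (1 + σ) ^ 2 / (T ^ 2 * n ^ 2)) := by
        gcongr
        exact h.lintegral_lowFreq_sq_le hT0
    _ = ENNReal.ofReal (3 * (6000000 * T ^ 2 / n ^ 2)
        + 12 * (170000000 * (1 + σ) ^ 2 / (T ^ 2 * n ^ 2))
        + 12 * (170000000 * (1 + σ) ^ 2 / (T ^ 2 * n ^ 2))) := by
        rw [ENNReal.ofReal_add (by positivity) (by positivity),
          ENNReal.ofReal_add (by positivity) (by positivity),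
          ENNReal.ofReal_mul (p := 3) (by norm_num), ENNReal.ofReal_mul (p := 12) (by norm_num)]
        simp only [ENNReal.ofReal_ofNat]
    _ ≤ _ := by
        refine ENNReal.ofReal_le_ofReal ?_
        rw [hT2]
        have h1 : 1 ≤ (1 + σ) ^ 2 := one_le_pow₀ (by linarith)
        have e : 3 * (6000000 * (256 * L) / (n : ℝ) ^ 2)
            + 12 * (170000000 * (1 + σ) ^ 2 / (256 * L * n ^ 2))
            + 12 * (170000000 * (1 + σ) ^ 2 / (256 * L * n ^ 2))
            = (4608000000 * L + 15937500 * (1 + σ) ^ 2 / L) / (n : ℝ) ^ 2 := by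
          field_simp; ring
        rw [e]
        gcongr
        have h2 : (1 + σ) ^ 2 / L ≤ 4 * L * (1 + σ) ^ 2 := by
          rw [div_le_iff₀ (by positivity)]
          nlinarith [mul_nonneg (sub_nonneg.2 hL) (sub_nonneg.2 hL)]
        have h3 : L ≤ L * (1 + σ) ^ 2 := le_mul_of_one_le_right (by positivity) h1
        calc _ = 4608000000 * L + 15937500 * ((1 + σ) ^ 2 / L) := by ring
          _ ≤ 4608000000 * (L * (1 + σ) ^ 2) + 15937500 * (4 * L * (1 + σ) ^ 2) := by gcongr
          _ ≤ _ := by nlinarith [mul_pos (show 0 < L by linarith) (show 0 < (1 + σ) ^ 2 by linarith)]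

/-- Jensen for the square. It serves to replace the typical distribution function by that of an
independent direction. -/
theorem ofReal_sub_integral_sq_le {α : Type*} [MeasurableSpace α] {ν : Measure α}
    [IsProbabilityMeasure ν] {f : α → ℝ} (hf : Measurable f) (hf0 : ∀ a, 0 ≤ f a)
    (hf1 : ∀ a, f a ≤ 1) (c : ℝ) :
    ENNReal.ofReal ((c - ∫ a, f a ∂ν) ^ 2) ≤ ∫⁻ a, ENNReal.ofReal ((c - f a) ^ 2) ∂ν := by
  have ix : Integrable f ν := (integrable_const (1 : ℝ)).mono' hf.aestronglyMeasurable
    (Filter.Eventually.of_forall fun a => by rw [Real.norm_of_nonneg (hf0 a)]; exact hf1 a)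
  have i1 : Integrable (fun a => c - f a) ν := (integrable_const c).sub ix
  have i2 : Integrable (fun a => (c - f a) ^ 2) ν := by
    refine (integrable_const ((|c| + 1) ^ 2)).mono' (by fun_prop)
      (Filter.Eventually.of_forall fun a => ?_)
    rw [Real.norm_of_nonneg (sq_nonneg _), ← sq_abs]
    gcongr
    exact (abs_sub c (f a)).trans (by rw [abs_of_nonneg (hf0 a)]; linarith [hf1 a])
  rw [← ofReal_integral_eq_lintegral_ofReal i2 (Filter.Eventually.of_forall fun _ => sq_nonneg _)]
  refine ENNReal.ofReal_le_ofReal (le_trans (le_of_eq ?_) (sq_integral_le i1 i2))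
  rw [integral_sub (integrable_const c) ix]
  simp

section Distance
variable {Ω : Type*} [MeasurableSpace Ω] {P : Measure Ω} [IsProbabilityMeasure P] {X : Ω → E n}

theorem measurable_Fθ (hX : Measurable X) :
    Measurable fun p : Sph n × ℝ => Fθ P X p.1 p.2 := by
  have hs : MeasurableSet {q : (Sph n × ℝ) × Ω | inner ℝ (X q.2) (q.1.1 : E n) ≤ q.1.2} :=
    measurableSet_le (by fun_prop) (by fun_prop)
  exact (measurable_measure_prodMk_left (ν := P) hs).ennreal_toReal

theorem measurable_Fθ_comp {α : Type*} [MeasurableSpace α] (hX : Measurable X) {f : α → Sph n}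
    {g : α → ℝ} (hf : Measurable f) (hg : Measurable g) :
    Measurable fun a => Fθ P X (f a) (g a) :=
  (measurable_Fθ hX).comp (f := fun a => (f a, g a)) (hf.prodMk hg)

theorem measurable_typicalF [NeZero n] (hX : Measurable X) : Measurable (typicalF P X) :=
  ((measurable_Fθ hX).stronglyMeasurable.integral_prod_left' (μ := sphereMeasure n)).measurable

theorem measurable_omegaDist_Fθ [NeZero n] (hX : Measurable X) :
    Measurable fun θ : Sph n => omegaDist (Fθ P X θ) (typicalF P X) := by
  have h1 : Measurable fun p : Sph n × ℝ => (Fθ P X p.1 p.2 - typicalF P X p.2) ^ 2 :=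
    ((measurable_Fθ hX).sub ((measurable_typicalF hX).comp measurable_snd)).pow_const 2
  exact (h1.stronglyMeasurable.integral_prod_right' (ν := volume)).measurable.sqrt

theorem lintegral_sq_Fθ_sub (hX : Measurable X) (h : IsotropicLaw (P.map X)) (θ θ' : Sph n) :
    ∫⁻ x, ENNReal.ofReal ((Fθ P X θ x - Fθ P X θ' x) ^ 2) =
      ENNReal.ofReal (1 / (2 * absKernelConst)) * spectralEnergy (P.map X) θ θ' := by
  have hp : IsProbabilityMeasure (P.map X) := Measure.isProbabilityMeasure_map hX.aemeasurable
  have hi : ∀ v : E n, Integrable (fun w => inner ℝ (X w) v) P := fun v =>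
    (h.integrable_inner v).comp_measurable hX
  obtain ⟨i1, i2, e⟩ := integral_sq_cdf_sub (P := P) (a := fun w => inner ℝ (X w) (θ : E n))
    (b := fun w => inner ℝ (X w) (θ' : E n)) (by fun_prop) (by fun_prop) ((hi _).sub (hi _))
  have hch : ∀ (v : E n) (t : ℝ), ∫ w, Complex.exp ((inner ℝ (X w) v : ℝ) * t * Complex.I) ∂P
      = charFun (P.map X) (t • v) := by
    intro v t
    rw [charFun_apply, integral_map hX.aemeasurable (Measurable.aestronglyMeasurable (by fun_prop))]
    congr 1
    funext w
    rw [inner_smul_right]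
    push_cast
    ring_nf
  simp_rw [hch] at i2 e
  have hκ := absKernelConst_pos
  have e2 : spectralEnergy (P.map X) θ θ' = ENNReal.ofReal (∫ t : ℝ,
      ‖charFun (P.map X) (t • (θ : E n)) - charFun (P.map X) (t • (θ' : E n))‖ ^ 2 / t ^ 2) := by
    rw [ofReal_integral_eq_lintegral_ofReal i2 (Filter.Eventually.of_forall fun t => by positivity),
      spectralEnergy]
    refine lintegral_congr fun t => ?_
    rw [← ofReal_norm, ← ENNReal.ofReal_pow (norm_nonneg _), ← ENNReal.ofReal_mul (by positivity)]
    congr 1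
    ring
  rw [e2, e, ← ENNReal.ofReal_mul (by positivity),
    ← ofReal_integral_eq_lintegral_ofReal (by exact i1)
      (Filter.Eventually.of_forall fun t => sq_nonneg _)]
  congr 1
  unfold Fθ
  field_simp

/-- Fourth moment bound for the `L²`-distance to the typical distribution. -/
theorem lintegral_omegaDist_pow_four_le [NeZero n] (hn2 : 2 ≤ n) (hX : Measurable X)
    (h : IsotropicLaw (P.map X)) {σ : ℝ} (hs : 0 ≤ σ)
    (hvar : ∫⁻ x, ENNReal.ofReal ((‖x‖ ^ 2 - n) ^ 2) ∂(P.map X) ≤ ENNReal.ofReal (n * σ)) :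
    ∫⁻ θ, ENNReal.ofReal (omegaDist (Fθ P X θ) (typicalF P X) ^ 4) ∂(sphereMeasure n) ≤
      ENNReal.ofReal ((1 / (2 * absKernelConst)) ^ 2 *
        (5000000000 * Real.log n * (1 + σ) ^ 2 / n ^ 2)) := by
  have hp : IsProbabilityMeasure (P.map X) := Measure.isProbabilityMeasure_map hX.aemeasurable
  have hκ := absKernelConst_pos
  have hjensen : ∀ θ x, ENNReal.ofReal ((Fθ P X θ x - typicalF P X x) ^ 2) ≤
      ∫⁻ θ', ENNReal.ofReal ((Fθ P X θ x - Fθ P X θ' x) ^ 2) ∂(sphereMeasure n) := by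
    intro θ x
    have hmx : Measurable fun θ' => Fθ P X θ' x := 
      measurable_Fθ_comp hX measurable_id measurable_const
    have h0 : ∀ θ', 0 ≤ Fθ P X θ' x := fun θ' => measureReal_nonneg
    have h1 : ∀ θ', Fθ P X θ' x ≤ 1 := fun θ' => measureReal_le_one
    exact ofReal_sub_integral_sq_le hmx h0 h1 (Fθ P X θ x)
  have hmd : ∀ θ, Measurable fun x => (Fθ P X θ x - typicalF P X x) ^ 2 := fun θ =>
    ((measurable_Fθ_comp hX measurable_const measurable_id).sub
      (measurable_typicalF hX)).pow_const 2
  have hω : ∀ θ, ENNReal.ofReal (omegaDist (Fθ P X θ) (typicalF P X) ^ 2) ≤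
      ∫⁻ θ', ENNReal.ofReal (1 / (2 * absKernelConst)) *
        spectralEnergy (P.map X) θ θ' ∂(sphereMeasure n) := by
    intro θ
    rw [omegaDist, Real.sq_sqrt (integral_nonneg fun _ => sq_nonneg _),
      integral_eq_lintegral_of_nonneg_ae (Filter.Eventually.of_forall fun _ => sq_nonneg _)
        (hmd θ).aestronglyMeasurable]
    -- `toReal` sends ∞ to 0, so the inequality needs no prior finiteness.
    refine ENNReal.ofReal_toReal_le.trans ((lintegral_mono (hjensen θ)).trans (le_of_eq ?_))
    rw [lintegral_lintegral_swap]
    · exact lintegral_congr fun θ' => lintegral_sq_Fθ_sub hX h θ θ'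
    · have m1 : Measurable fun p : ℝ × Sph n => Fθ P X θ p.1 :=
        measurable_Fθ_comp hX measurable_const measurable_fst
      have m2 : Measurable fun p : ℝ × Sph n => Fθ P X p.2 p.1 :=
        measurable_Fθ_comp hX measurable_snd measurable_fst
      exact ((m1.sub m2).pow_const 2).ennreal_ofReal.aemeasurable
  have hSm : Measurable fun q : Sph n × Sph n => spectralEnergy (P.map X) q.1 q.2 :=
    measurable_spectralEnergy.comp (f := fun q : Sph n × Sph n => ((q.1 : E n), (q.2 : E n)))
      (by fun_prop)
  have hω4 : ∀ θ, ENNReal.ofReal (omegaDist (Fθ P X θ) (typicalF P X) ^ 4) ≤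
      ENNReal.ofReal ((1 / (2 * absKernelConst)) ^ 2) *
        ∫⁻ θ', spectralEnergy (P.map X) θ θ' ^ 2 ∂(sphereMeasure n) := by
    intro θ
    have hm : Measurable fun θ' : Sph n => spectralEnergy (P.map X) θ θ' :=
      hSm.comp (f := fun θ' : Sph n => (θ, θ')) (by fun_prop)
    have e : omegaDist (Fθ P X θ) (typicalF P X) ^ 4
        = (omegaDist (Fθ P X θ) (typicalF P X) ^ 2) ^ 2 := by ring
    rw [e, ENNReal.ofReal_pow (sq_nonneg _)]
    refine (pow_le_pow_left' (hω θ) 2).trans ?_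
    rw [lintegral_const_mul' _ _ ENNReal.ofReal_ne_top, mul_pow, ENNReal.ofReal_pow (by positivity)]
    gcongr
    have := lintegral_sq_le (sphereMeasure n) hm.aemeasurable
    rwa [measure_univ, one_mul] at this
  refine (lintegral_mono hω4).trans ?_
  rw [lintegral_const_mul' _ _ ENNReal.ofReal_ne_top, ENNReal.ofReal_mul (by positivity)]
  gcongr
  have := h.lintegral_spectralEnergy_sq_le hn2 hs hvar
  rwa [lintegral_prod _ (hSm.pow_const 2).aemeasurable] at this

end Distance

end RandomizedCLT

/-! ### Bounded isotropic vectors and the final moment bounds. -/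

namespace RandomizedCLT

section Bounded
variable {Ω : Type*} [MeasurableSpace Ω] {P : Measure Ω} [IsProbabilityMeasure P] {n : ℕ}
  {X : Ω → E n} {C : ℝ}

theorem integrable_apply_mul_apply (hX : Measurable X) (hC : ∀ᵐ w ∂P, ‖X w‖ ≤ C) (i j : Fin n) :
    Integrable (fun w => X w i * X w j) P := by
  refine (integrable_const (C * C)).mono' (Measurable.aestronglyMeasurable (by fun_prop)) ?_
  filter_upwards [hC] with w hw
  rw [norm_mul]
  have h1 := (PiLp.norm_apply_le (X w) i).trans hw
  have h2 := (PiLp.norm_apply_le (X w) j).trans hw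
  exact mul_le_mul h1 h2 (norm_nonneg _) ((norm_nonneg _).trans h1)

theorem IsIsotropic.isotropicLaw (hX : Measurable X) (hC : ∀ᵐ w ∂P, ‖X w‖ ≤ C)
    (hiso : IsIsotropic P X) : IsotropicLaw (P.map X) := by
  refine ⟨?_, fun v => ?_⟩
  · rw [memLp_map_measure_iff aestronglyMeasurable_id hX.aemeasurable]
    exact MemLp.of_bound hX.aestronglyMeasurable C hC
  · rw [integral_map hX.aemeasurable (Measurable.aestronglyMeasurable (by fun_prop))]
    have e : ∀ w, inner ℝ (X w) v ^ 2 = ∑ i, ∑ j, v i * v j * (X w i * X w j) := by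
      intro w
      rw [sq, PiLp.inner_apply, Finset.sum_mul_sum]
      refine Finset.sum_congr rfl fun i _ => Finset.sum_congr rfl fun j _ => ?_
      simp only [RCLike.inner_apply, conj_trivial]
      ring
    have hi := integrable_apply_mul_apply hX hC
    simp_rw [e]
    rw [integral_finsetSum _ fun i _ => integrable_finsetSum _ fun j _ => (hi i j).const_mul _]
    simp_rw [integral_finsetSum _ fun j _ => (hi _ j).const_mul _, integral_const_mul, hiso _ _]
    rw [EuclideanSpace.norm_sq_eq]
    simp [sq]

theorem IsIsotropic.integral_norm_sq (hX : Measurable X) (hC : ∀ᵐ w ∂P, ‖X w‖ ≤ C)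
    (hiso : IsIsotropic P X) : ∫ w, ‖X w‖ ^ 2 ∂P = n := by
  simp_rw [EuclideanSpace.norm_sq_eq, Real.norm_eq_abs, sq_abs, sq]
  rw [integral_finsetSum _ fun i _ => integrable_apply_mul_apply hX hC i i]
  simp_rw [hiso _ _]
  simp

/-- Because n = E|X|² ≤ b²n; the sign of `b` comes from one point where the bound holds. -/
theorem IsIsotropic.one_le_of_norm_le [NeZero n] (hX : Measurable X) {b : ℝ}
    (hb : ∀ᵐ w ∂P, ‖X w‖ ≤ b * √(n : ℝ)) (hiso : IsIsotropic P X) : 1 ≤ b := by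
  have hn : (0 : ℝ) < n := by exact_mod_cast Nat.pos_of_neZero n
  obtain ⟨w, hw⟩ := hb.exists
  have hb0 : 0 ≤ b := by
    by_contra! h
    have := mul_neg_of_neg_of_pos h (Real.sqrt_pos.2 hn)
    linarith [norm_nonneg (X w)]
  have h1 : ∫ w, ‖X w‖ ^ 2 ∂P ≤ ∫ _w, b ^ 2 * n ∂P := by
    refine integral_mono_of_nonneg (Filter.Eventually.of_forall fun _ => sq_nonneg _)
      (integrable_const _) ?_
    filter_upwards [hb] with w hw
    have := pow_le_pow_left₀ (norm_nonneg _) hw 2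
    rwa [mul_pow, Real.sq_sqrt hn.le] at this
  rw [hiso.integral_norm_sq hX hb] at h1
  simp only [integral_const, probReal_univ, smul_eq_mul, one_mul] at h1
  have h2 : 1 ≤ b ^ 2 := le_of_mul_le_mul_right (by linarith) hn
  nlinarith

/-- Isotropy gives |X|² the mean n, so the left side is exactly its variance. -/
theorem IsIsotropic.lintegral_norm_sq_sub_le [NeZero n] (hX : Measurable X)
    (hC : ∀ᵐ w ∂P, ‖X w‖ ≤ C) (hiso : IsIsotropic P X) :
    ∫⁻ x, ENNReal.ofReal ((‖x‖ ^ 2 - n) ^ 2) ∂(P.map X) ≤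
      ENNReal.ofReal (n * sigma4 P X ^ 2) := by
  have hn : (0 : ℝ) < n := by exact_mod_cast Nat.pos_of_neZero n
  have hi : Integrable (fun w => (‖X w‖ ^ 2 - n) ^ 2) P := by
    refine (integrable_const ((C ^ 2 + n) ^ 2)).mono'
      (Measurable.aestronglyMeasurable (by fun_prop)) ?_
    filter_upwards [hC] with w hw
    rw [Real.norm_of_nonneg (sq_nonneg _)]
    have := pow_le_pow_left₀ (norm_nonneg _) hw 2
    have h0 := sq_nonneg ‖X w‖
    refine sq_le_sq' ?_ ?_ <;> linarith
  rw [lintegral_map (by fun_prop) hX, ← ofReal_integral_eq_lintegral_ofReal hi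
    (Filter.Eventually.of_forall fun _ => sq_nonneg _)]
  refine ENNReal.ofReal_le_ofReal (le_of_eq ?_)
  rw [sigma4, Real.sq_sqrt (mul_nonneg (by positivity) (variance_nonneg _ _)),
    variance_eq_integral (by fun_prop), hiso.integral_norm_sq hX hC]
  field_simp

end Bounded

/-- Truncation at l = 2y³/m leaves the remainder m²/(4y²) ≤ m/4, because m ≤ y². The sharper
m^{3/2}/y² would bring in fractional powers and is not needed. -/
theorem sq_div_le_of_fourth_moment {Θ : Type*} [MeasurableSpace Θ] {σ : Measure Θ}
    [IsProbabilityMeasure σ] {f : Θ → ℝ} (hf0 : ∀ θ, 0 ≤ f θ)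
    (h1 : Integrable f σ) (h2 : Integrable (fun θ => f θ ^ 2) σ)
    (h4 : Integrable (fun θ => f θ ^ 4) σ) {y : ℝ} (hy : 0 < y)
    (hm : 0 < ∫ θ, f θ ^ 2 ∂σ) (hK : ∫ θ, f θ ^ 4 ∂σ ≤ y ^ 4) :
    (∫ θ, f θ ^ 2 ∂σ) ^ 2 / (4 * y ^ 3) ≤ ∫ θ, f θ ∂σ := by
  have hmy := integral_sq_le_sqrt_fourth h2 h4 hK
  set m := ∫ θ, f θ ^ 2 ∂σ
  have hmy' : m ≤ y ^ 2 := by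
    refine (sq_le_sq₀ hm.le (by positivity)).1 ?_
    rw [← pow_mul]; exact hmy
  have h := rpow_le_integral_of_fourth_moment hf0 h1 h2 h4
    (l := 2 * y ^ 3 / m) (by positivity) hK
  have e : y ^ 4 / (2 * y ^ 3 / m) ^ 2 ≤ m / 4 := by
    rw [div_pow, div_div_eq_mul_div, div_le_iff₀ (by positivity)]
    have : y ^ 4 * m * m ≤ y ^ 4 * m * y ^ 2 := by gcongr
    nlinarith [this]
  have h5 : m / 2 ≤ 2 * y ^ 3 / m * ∫ θ, f θ ∂σ := by
    change m ≤ _ at h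
    linarith
  have h6 := mul_le_mul_of_nonneg_left h5 (show 0 ≤ m / (2 * y ^ 3) by positivity)
  calc _ = m / (2 * y ^ 3) * (m / 2) := by ring
    _ ≤ _ := h6
    _ = _ := by field_simp

theorem exists_omegaDist_fourth_moment_const :
    ∃ z : ℝ, 1 ≤ z ∧ ∀ (n : ℕ), 2 ≤ n →
      ∀ (Ω : Type*) [MeasurableSpace Ω] (P : Measure Ω) [IsProbabilityMeasure P]
        (X : Ω → E n) (C : ℝ), Measurable X → IsIsotropic P X → (∀ᵐ w ∂P, ‖X w‖ ≤ C) →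
        ∫⁻ θ, ENNReal.ofReal (omegaDist (Fθ P X θ) (typicalF P X) ^ 4) ∂(sphereMeasure n) ≤
          ENNReal.ofReal ((z * Real.log n ^ (1 / 4 : ℝ) * (1 + sigma4 P X) / √(n : ℝ)) ^ 4) := by
  have hκ := absKernelConst_pos
  -- Adding 1 makes the constant at most its own fourth power, so no fourth root is needed.
  refine ⟨(1 / (2 * absKernelConst)) ^ 2 * 5000000000 + 1, ?_, ?_⟩
  · have : 0 ≤ (1 / (2 * absKernelConst)) ^ 2 * 5000000000 := by positivity
    linarith
  intro n hn Ω _ P _ X C hX hiso hC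
  have : NeZero n := ⟨by omega⟩
  have hn0 : (0 : ℝ) < n := by exact_mod_cast Nat.pos_of_neZero n
  have hL : 0 ≤ Real.log n := Real.log_natCast_nonneg n
  have hs : 0 ≤ sigma4 P X := Real.sqrt_nonneg _
  refine (lintegral_omegaDist_pow_four_le hn hX (hiso.isotropicLaw hX hC) (sq_nonneg _)
    (hiso.lintegral_norm_sq_sub_le hX hC)).trans (ENNReal.ofReal_le_ofReal ?_)
  have e1 : (Real.log n ^ (1 / 4 : ℝ)) ^ 4 = Real.log n := by
    rw [← Real.rpow_natCast, ← Real.rpow_mul hL]; norm_num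
  have e2 : √(n : ℝ) ^ 4 = (n : ℝ) ^ 2 := by
    rw [show 4 = 2 * 2 by norm_num, pow_mul, Real.sq_sqrt hn0.le]
  set C0 := (1 / (2 * absKernelConst)) ^ 2 * 5000000000
  have hC0 : 0 ≤ C0 := by positivity
  have h1 : C0 ≤ (C0 + 1) ^ 4 :=
    (by linarith : C0 ≤ C0 + 1).trans (le_self_pow₀ (by linarith) (by norm_num))
  have h2 : (1 + sigma4 P X ^ 2) ^ 2 ≤ (1 + sigma4 P X) ^ 4 := by
    rw [show 4 = 2 * 2 by norm_num, pow_mul]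
    gcongr
    nlinarith
  calc _ = C0 * Real.log n * (1 + sigma4 P X ^ 2) ^ 2 / n ^ 2 := by
        simp only [C0]; ring
    _ ≤ (C0 + 1) ^ 4 * Real.log n * (1 + sigma4 P X) ^ 4 / n ^ 2 := by gcongr
    _ = _ := by rw [div_pow, mul_pow _ (1 + _), mul_pow, e1, e2]

end RandomizedCLT

/-! ### Conclusion. -/

theorem proposition12p4 :
    ∃ c : ℝ, 0 < c ∧
      ∀ (n : ℕ), 2 ≤ n →
      ∀ (Ω : Type*) [MeasurableSpace Ω] (P : Measure Ω) [IsProbabilityMeasure P]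
        (X : Ω → RandomizedCLT.E n) (b D : ℝ),
        Measurable X →
        RandomizedCLT.IsIsotropic P X →
        (∀ᵐ w ∂P, ‖X w‖ ≤ b * √(n : ℝ)) →
        0 < D →
        D / n ≤ ∫ θ, RandomizedCLT.omegaDist (RandomizedCLT.Fθ P X θ)
            (RandomizedCLT.typicalF P X) ^ 2 ∂(RandomizedCLT.sphereMeasure n) →
        c / ((1 + RandomizedCLT.sigma4 P X) ^ 3 * b ^ (3 / 2 : ℝ)) *
            (D ^ 2 / (Real.log n ^ (15 / 4 : ℝ) * √(n : ℝ))) ≤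
          ∫ θ, RandomizedCLT.omegaDist (RandomizedCLT.Fθ P X θ)
            (RandomizedCLT.typicalF P X) ∂(RandomizedCLT.sphereMeasure n) ∧
        c / ((1 + RandomizedCLT.sigma4 P X) ^ 6 * b ^ 3) *
            (D ^ 3 / Real.log n ^ (15 / 2 : ℝ)) ≤
          (RandomizedCLT.sphereMeasure n).real
            {θ | 1 / √(2 * (n : ℝ)) * √D ≤
              RandomizedCLT.omegaDist (RandomizedCLT.Fθ P X θ) (RandomizedCLT.typicalF P X)} := by
  obtain ⟨z, hz, hfour⟩ := RandomizedCLT.exists_omegaDist_fourth_moment_const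
  have hz0 : 0 < z := by linarith
  -- The surplus logarithms satisfy ℓ¹² ≥ 1/8 and ℓ²⁴ ≥ 1/64 because log n ≥ 1/2; 256/64 = 4 fits
  -- the second bound exactly and the first with room.
  refine ⟨1 / (256 * z ^ 6), by positivity, ?_⟩
  intro n hn Ω _ P _ X b D hX hiso hb hD hm
  have : NeZero n := ⟨by omega⟩
  have hn0 : (0 : ℝ) < n := by exact_mod_cast Nat.pos_of_neZero n
  have hb1 := hiso.one_le_of_norm_le hX hb
  have h4' := hfour n hn Ω P X _ hX hiso hb
  have hωm := RandomizedCLT.measurable_omegaDist_Fθ (P := P) hX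
  set f := fun θ => RandomizedCLT.omegaDist (RandomizedCLT.Fθ P X θ) (RandomizedCLT.typicalF P X)
  change ∫⁻ θ, ENNReal.ofReal (f θ ^ 4) ∂_ ≤ _ at h4'
  change D / n ≤ ∫ θ, f θ ^ 2 ∂_ at hm
  change _ ≤ ∫ θ, f θ ∂_ ∧ _ ≤ Measure.real _ {θ | _ ≤ f θ}
  have hf0 : ∀ θ, 0 ≤ f θ := fun θ => Real.sqrt_nonneg _
  set ν := RandomizedCLT.sphereMeasure n
  set s := 1 + RandomizedCLT.sigma4 P X
  have hs : 1 ≤ s := le_add_of_nonneg_right (Real.sqrt_nonneg _)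
  set ℓ := Real.log n ^ (1 / 4 : ℝ) with hℓdef
  set r := √(n : ℝ)
  have hr : 0 < r := Real.sqrt_pos.2 hn0
  have hr2 : r ^ 2 = n := Real.sq_sqrt hn0.le
  have hL : 1 / 2 ≤ Real.log n := by
    have h1 : Real.log 2 ≤ Real.log n := Real.log_le_log (by norm_num) (by exact_mod_cast hn)
    linarith [Real.log_two_gt_d9]
  have hℓ : 0 < ℓ := Real.rpow_pos_of_pos (by linarith) _
  have hℓk : ∀ k : ℕ, ℓ ^ k = Real.log n ^ ((k : ℝ) / 4) := by
    intro k
    rw [hℓdef, ← Real.rpow_natCast, ← Real.rpow_mul (by linarith)]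
    ring_nf
  have hℓ4 : 1 / 2 ≤ ℓ ^ 4 := by rw [hℓk]; norm_num; linarith
  have e15 : Real.log n ^ (15 / 4 : ℝ) = ℓ ^ 15 := by rw [hℓk]; norm_num
  have e30 : Real.log n ^ (15 / 2 : ℝ) = ℓ ^ 30 := by rw [hℓk]; norm_num
  set y := z * ℓ * s / r with hy
  have hy0 : 0 < y := by positivity
  have i4 : Integrable (fun θ => f θ ^ 4) ν := by
    refine ⟨(hωm.pow_const 4).aestronglyMeasurable, ?_⟩
    rw [hasFiniteIntegral_iff_ofReal (Filter.Eventually.of_forall fun θ => pow_nonneg (hf0 θ) 4)]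
    exact h4'.trans_lt ENNReal.ofReal_lt_top
  have i2 : Integrable (fun θ => f θ ^ 2) ν := by
    refine ((integrable_const (1 : ℝ)).add i4).mono' (hωm.pow_const 2).aestronglyMeasurable
      (Filter.Eventually.of_forall fun θ => ?_)
    rw [Real.norm_of_nonneg (sq_nonneg _)]
    change f θ ^ 2 ≤ 1 + f θ ^ 4
    nlinarith [sq_nonneg (f θ ^ 2 - 1), sq_nonneg (f θ ^ 2)]
  have i1 : Integrable f ν := by
    refine ((integrable_const (1 : ℝ)).add i2).mono' hωm.aestronglyMeasurable
      (Filter.Eventually.of_forall fun θ => ?_)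
    rw [Real.norm_of_nonneg (hf0 θ)]
    change f θ ≤ 1 + f θ ^ 2
    nlinarith [sq_nonneg (f θ - 1), hf0 θ]
  have hK : ∫ θ, f θ ^ 4 ∂ν ≤ y ^ 4 := by
    rw [← ofReal_integral_eq_lintegral_ofReal i4
      (Filter.Eventually.of_forall fun θ => pow_nonneg (hf0 θ) 4)] at h4'
    exact (ENNReal.ofReal_le_ofReal_iff (by positivity)).1 h4'
  have hDn : 0 < D / n := by positivity
  have hm0 : 0 < ∫ θ, f θ ^ 2 ∂ν := hDn.trans_le hm
  have hb32 : 1 ≤ b ^ (3 / 2 : ℝ) := Real.one_le_rpow hb1 (by norm_num)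
  have hb3 : 1 ≤ b ^ 3 := one_le_pow₀ hb1
  have hz3 : z ^ 3 ≤ z ^ 6 := pow_le_pow_right₀ hz (by norm_num)
  rw [e15, e30]
  constructor
  · refine le_trans ?_
      (RandomizedCLT.sq_div_le_of_fourth_moment hf0 i1 i2 i4 hy0 hm0 hK)
    have hℓ12 : 1 / 8 ≤ ℓ ^ 12 := by
      have := pow_le_pow_left₀ (by norm_num) hℓ4 3
      rw [← pow_mul] at this; norm_num at this; linarith
    calc _ = (D ^ 2 / (s ^ 3 * ℓ ^ 3 * r)) * (1 / (256 * z ^ 6 * b ^ (3 / 2 : ℝ) * ℓ ^ 12)) := by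
          field_simp
      -- The moment argument yields ℓ³ = (log n)^{3/4} and no `b`; the further factor ℓ¹² b^{3/2} in
      -- the claim is bounded below by a constant.
      _ ≤ (D ^ 2 / (s ^ 3 * ℓ ^ 3 * r)) * (1 / (4 * z ^ 3)) := by
          gcongr ?_ * (1 / ?_)
          calc 4 * z ^ 3 ≤ 256 * z ^ 6 * 1 * (1 / 8) := by nlinarith [pow_pos hz0 3]
            _ ≤ _ := by gcongr
      _ = (D / n) ^ 2 / (4 * y ^ 3) := by
          rw [hy, ← hr2]; field_simp
      _ ≤ _ := by gcongr
  · have hpz := RandomizedCLT.sq_le_measure_of_fourth_moment hωm i2 i4 (K := y ^ 4)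
      (by positivity) hm0 hK
    have hmy := RandomizedCLT.integral_sq_le_sqrt_fourth i2 i4 hK
    set m := ∫ θ, f θ ^ 2 ∂ν
    have hmy' : m ≤ y ^ 2 := by
      refine (sq_le_sq₀ hm0.le (by positivity)).1 ?_
      rw [← pow_mul]; exact hmy
    have hℓ24 : 1 / 64 ≤ ℓ ^ 24 := by
      have := pow_le_pow_left₀ (by norm_num) hℓ4 6
      rw [← pow_mul] at this; norm_num at this; linarith
    have hsub : {θ | m / 2 ≤ f θ ^ 2} ⊆ {θ | 1 / √(2 * (n : ℝ)) * √D ≤ f θ} := by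
      intro θ hθ
      change m / 2 ≤ f θ ^ 2 at hθ
      change _ ≤ f θ
      refine (sq_le_sq₀ (by positivity) (hf0 θ)).1 ?_
      rw [mul_pow, div_pow, Real.sq_sqrt (by positivity), Real.sq_sqrt hD.le]
      calc _ = D / n / 2 := by field_simp
        _ ≤ m / 2 := by gcongr
        _ ≤ _ := hθ
    refine le_trans ?_ (hpz.trans (measureReal_mono hsub))
    calc _ = (D ^ 3 / (s ^ 6 * ℓ ^ 6)) * (1 / (256 * z ^ 6 * b ^ 3 * ℓ ^ 24)) := by
          field_simp
      _ ≤ (D ^ 3 / (s ^ 6 * ℓ ^ 6)) * (1 / (4 * z ^ 6)) := by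
          gcongr ?_ * (1 / ?_)
          calc 4 * z ^ 6 = 256 * z ^ 6 * 1 * (1 / 64) := by ring
            _ ≤ _ := by gcongr
      _ = (D / n) ^ 3 / (4 * y ^ 6) := by
          rw [hy, ← hr2]; field_simp
      _ ≤ m ^ 3 / (4 * y ^ 6) := by gcongr
      -- The third power of D in the claim arises here, by giving up a factor m/y² ≤ 1.
      _ ≤ m ^ 2 / (4 * y ^ 4) := by
          rw [div_le_div_iff₀ (by positivity) (by positivity)]
          have : m ^ 2 * y ^ 4 * m ≤ m ^ 2 * y ^ 4 * y ^ 2 := by gcongr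
          nlinarith [this]
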